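/- Let $d\ge 3$ and $\epsilon\in(0,1)$. For $N\ge 2$ let $\mathbb T=(\mathbb Z/N\mathbb Z)^d$ be the discrete torus with nearest-neighbour edges, and let $B(0,s)$ denote the closed $\ell_\infty$-ball of radius $s$ around $0$ in $\mathbb T$. For $1\le r\le N^{1-\epsilon}$ put $A=B(0,r)$, $B=B(0,N^{1-\epsilon/2})$, $C=B(0,N/4)$; assume that $N$ is such that $B\subseteq C$ (then $A\subseteq B\subseteq C$; this holds for all $N$ large enough). Let $\phi$ be the bijection from $C$ to the $\ell_\infty$-ball $\{z\in\mathbb Z^d:|z|_\infty\le N/4\}$ that is inverse to reduction modulo $N$, and let $\mathsf A=\phi(A)$. Let $(Y_t)_{t\ge 0}$ be the continuous-time simple random walk with jump rate $1$ on $\mathbb T$ or on $\mathbb Z^d$, with law $P_x$ when started at $x$, and let $P_\mu=\sum_x\mu(x)P_x$. For a set $V$ of vertices let $H_V=\inf\{t\ge0:Y_t\in V\}$ and $\tilde H_V=\inf\{t\ge\tau_1:Y_t\in V\}$, where $\tau_1$ is the first jump time. The equilibrium measure of $\mathsf A$ is $e_{\mathsf A}(z)=\mathbf 1_{z\in\mathsf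 A}P_z[\tilde H_{\mathsf A}=\infty]$, $z\in\mathbb Z^d$, its capacity is $\mathrm{cap}(\mathsf A)=\sum_{z\in\mathbb Z^d} e_{\mathsf A}(z)$, and $e_A(x)=e_{\mathsf A}(\phi(x))$ for $x\in A$. The internal boundary $\partial_iA$ is the set of vertices of $A$ with at least one neighbour outside $A$. Let $\sigma$ be the quasistationary distribution on $\mathbb T\setminus B$, that is, $\sigma(x)=(v_1)_x/\sum_{y}(v_1)_y$ for $x\in\mathbb T\setminus B$, where $v_1$ is the (unique up to scaling) eigenvector with non-negative entries for the largest eigenvalue of the matrix $P^B=\bigl(\tfrac1{2d}\mathbf 1_{\{x\sim y\}}\bigr)_{x,y\in\mathbb T\setminus B}$. Then there are constants $c_\epsilon,c'_\epsilon>0$, depending only on $d$ and $\epsilon$, such that for all such $N$ and $r$, $e_A(x)>0$ for every $x\in\partial_iA$ and $$\sup_{x\in\partial_i A}\left|\frac{P_\sigma[Y_{H_A}=x]\,\mathrm{cap}(\mathsf A)}{e_A(x)}-1\right|\le c_\epsilon N^{-c'_\epsilon}.$$ -/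

import Mathlib

open MeasureTheory ProbabilityTheory
open scoped NNReal ENNReal

namespace TorusWalk

noncomputable section

/-! ### Lattice geometry

`Fin d → R` is the lattice `ℤ^d` for `R = ℤ` and the discrete torus `(ℤ/Nℤ)^d` for
`R = ZMod N`. -/

/-- The step `± e_i` encoded by the direction `i` and a sign. -/
def step {d : ℕ} (R : Type*) [Ring R] (u : Fin d × Bool) : Fin d → R :=
  Pi.single u.1 (if u.2 then 1 else -1)

/-- Two vertices are neighbours if they differ by `± e_i` for some `i`. -/
def Adj {d : ℕ} {R : Type*} [Ring R] (x y : Fin d → R) : Prop :=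
  ∃ u : Fin d × Bool, y = x + step R u

/-- The internal boundary `∂_i V`: vertices of `V` with at least one neighbour outside `V`. -/
def innerBoundary {d : ℕ} {R : Type*} [Ring R] (V : Set (Fin d → R)) : Set (Fin d → R) :=
  {x | x ∈ V ∧ ∃ y, Adj x y ∧ y ∉ V}

/-- The representative in `ℤ^d` of a vertex of the torus, with all its coordinates in
`(-N/2, N/2]`. On `B(0, N/4)` this is the inverse `φ` of the canonical projection
`B(0, N/4) ⊆ ℤ^d → B(0, N/4) ⊆ (ℤ/Nℤ)^d`. -/
def lift {d N : ℕ} (x : Fin d → ZMod N) : Fin d → ℤ :=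
  fun i => (x i).valMinAbs

/-- The closed ball `B(0, r)` of the torus `(ℤ/Nℤ)^d` for the `ℓ_∞`-distance. -/
def box (d N : ℕ) (r : ℝ) : Set (Fin d → ZMod N) :=
  {x | ∀ i, |((lift x i : ℤ) : ℝ)| ≤ r}

/-! ### The random walk -/

/-- The sample space: a sequence of steps and a sequence of holding times. -/
abbrev Sample (d : ℕ) : Type := (ℕ → Fin d × Bool) × (ℕ → ℝ)

/-- The probability measure under which the steps are i.i.d. uniform on the `2d` unit steps
`± e_i` and, independently, the holding times are i.i.d. exponential with parameter `1`. -/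
def walkMeasure (d : ℕ) : Measure (Sample d) :=
  (Measure.infinitePi fun _ : ℕ => uniformOn (Set.univ : Set (Fin d × Bool))).prod
    (Measure.infinitePi fun _ : ℕ => expMeasure 1)

theorem isProbabilityMeasure_walkMeasure {d : ℕ} (hd : d ≠ 0) :
    IsProbabilityMeasure (walkMeasure d) := by
  have : NeZero d := ⟨hd⟩
  have : IsProbabilityMeasure (expMeasure 1) := isProbabilityMeasure_expMeasure one_pos
  unfold walkMeasure
  infer_instance

/-- The discrete-time simple random walk `X_n` started at `x`, on `ℤ^d` or on the torus (where
it is the projection of the walk on `ℤ^d` with the same steps). -/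
def X {d : ℕ} {R : Type*} [Ring R] (x : Fin d → R) (ω : Sample d) (n : ℕ) : Fin d → R :=
  x + ∑ k ∈ Finset.range n, step R (ω.1 k)

/-- The jump times `τ_n`, the partial sums of the holding times. The holding times are almost
surely positive, so that `Real.toNNReal` changes nothing. -/
def jumpTime {d : ℕ} (ω : Sample d) (n : ℕ) : ℝ≥0 :=
  ∑ k ∈ Finset.range n, (ω.2 k).toNNReal

/-- The Poisson process `N_t` of intensity `1`: the number of the jump times
`τ_1, τ_2, …` in `[0, t]`. -/
def jumpCount {d : ℕ} (ω : Sample d) (t : ℝ≥0) : ℕ :=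
  Set.ncard {n : ℕ | jumpTime ω (n + 1) ≤ t}

/-- The continuous-time random walk `Y_t = X_{N_t}` started at `x`. -/
def Y {d : ℕ} {R : Type*} [Ring R] (x : Fin d → R) (ω : Sample d) (t : ℝ≥0) : Fin d → R :=
  X x ω (jumpCount ω t)

/-- The entrance time `H_V = inf {t ≥ 0 : y_t ∈ V}` of a path `y`, `∞` if `V` is not visited. -/
def entranceTime {S : Type*} (V : Set S) (y : ℝ≥0 → S) : ℝ≥0∞ :=
  ⨅ (t : ℝ≥0) (_ : y t ∈ V), (t : ℝ≥0∞)

/-- The hitting time `H̃_V = H_V ∘ θ_{τ_1} + τ_1` of the walk started at `x`. -/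
def hittingTime {d : ℕ} {R : Type*} [Ring R] (V : Set (Fin d → R)) (x : Fin d → R)
    (ω : Sample d) : ℝ≥0∞ :=
  entranceTime V (fun t => Y x ω (jumpTime ω 1 + t)) + (jumpTime ω 1 : ℝ≥0∞)

/-- The entrance distribution `P_x[H_V < ∞, Y_{H_V} = z]` of `V` for the walk started at `x`. -/
def entranceProb {d : ℕ} {R : Type*} [Ring R] (V : Set (Fin d → R)) (x z : Fin d → R) : ℝ :=
  (walkMeasure d).real
    {ω | ∃ t : ℝ≥0, entranceTime V (Y x ω) = (t : ℝ≥0∞) ∧ Y x ω t = z}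

/-- The entrance distribution `P_σ[Y_{H_V} = z] = ∑_x σ(x) P_x[Y_{H_V} = z]` on the torus, for
the starting distribution `σ`. -/
def entranceProbFrom {d N : ℕ} [NeZero N] (σ : (Fin d → ZMod N) → ℝ)
    (V : Set (Fin d → ZMod N)) (z : Fin d → ZMod N) : ℝ :=
  ∑ x, σ x * entranceProb V x z

/-! ### Equilibrium measure and capacity on `ℤ^d` -/

open Classical in
/-- The equilibrium measure `e_V(x) = 1_{x ∈ V} P_x[H̃_V = ∞]` of `V ⊆ ℤ^d`. -/
def equilibrium {d : ℕ} (V : Set (Fin d → ℤ)) (x : Fin d → ℤ) : ℝ :=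
  if x ∈ V then (walkMeasure d).real {ω | hittingTime V x ω = ∞} else 0

/-- The capacity of a (finite) set `V ⊆ ℤ^d`, the total mass of `e_V`. -/
def capacity {d : ℕ} (V : Set (Fin d → ℤ)) : ℝ :=
  ∑' x, equilibrium V x

/-! ### The quasistationary distribution -/

open Classical in
/-- The transition matrix `P^B = ((2d)⁻¹ 1_{x ∼ y})_{x, y ∉ B}` of the walk killed in `B`. -/
def killedMatrix {d N : ℕ} (B : Set (Fin d → ZMod N)) :
    Matrix {x : Fin d → ZMod N // x ∉ B} {x : Fin d → ZMod N // x ∉ B} ℝ :=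
  Matrix.of fun x y => if Adj x.1 y.1 then (2 * (d : ℝ))⁻¹ else 0

open Classical in
/-- `σ` is, up to extension by `0` to `B`, the normalization `v / (vᵀ 1)` of an entrywise
non-negative eigenvector `v` of `P^B` for its largest eigenvalue `l`. -/
def IsQuasistationary {d N : ℕ} [NeZero N] (B : Set (Fin d → ZMod N))
    (σ : (Fin d → ZMod N) → ℝ) : Prop :=
  ∃ (l : ℝ) (v : {x : Fin d → ZMod N // x ∉ B} → ℝ),
    v ≠ 0 ∧ (killedMatrix B).mulVec v = l • v ∧
    (∀ (m : ℝ) (w : {x : Fin d → ZMod N // x ∉ B} → ℝ),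
      w ≠ 0 → (killedMatrix B).mulVec w = m • w → m ≤ l) ∧
    (∀ x, 0 ≤ v x) ∧
    ∀ x, σ x = if h : x ∉ B then v ⟨x, h⟩ / ∑ y, v y else 0

/-- The quasistationary distribution on the complement of `B`: the function characterized by
`IsQuasistationary`. It exists and is unique (Perron–Frobenius) as soon as the complement of `B`
is non-empty and connected. -/
def quasistationary {d N : ℕ} [NeZero N] (B : Set (Fin d → ZMod N)) :
    (Fin d → ZMod N) → ℝ :=
  Classical.epsilon (IsQuasistationary B)

end

end TorusWalk

/-! Fix `z ∈ A` and let `f x` be the probability that the walk from `x` enters `A` at `z`; it is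
non-negative on the torus and harmonic off `A`. Let `k x` be the probability of visiting `A` before
the complement of `B`, and on `A` put `E = 2 * d - nbrSum k`, which is `2d` times the probability of
escaping to the complement of `B` before returning to `A`. Green's identity (`green_identity`)
writes `E z` as the sum of `f x * nbrSum k x` over `x ∉ B`. With `f = 1` it gives the total mass `S`
of `E` on `A` as the sum of the same weights. If `f` is constant off `B` up to a factor `1 + η`,
then `f` is close to `E z / S` there, and so is its mean under any probability distribution carried
by the complement of `B`. This is the only property of `σ` that is used (`entranceLaw_bounds`).

Two estimates remain. First, `E` agrees with `2d` times the equilibrium measure up to a factor `1 -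
δ`, where `δ` bounds the probability on `ℤ^d` of reaching `A` from outside `B`
(`hitProb_comparison`). Comparison with an explicit superharmonic function gives `δ` of order `√(r /
b)` (`hitProb_box_le`), `b` being the radius of `B`. Second, `η` is at most a constant times `(b /
r) ^ (-β)`: by the Harnack inequality the oscillation of `f` outside a box shrinks by a fixed factor
whenever the radius doubles (`exists_torus_oscillation`). Since `b / r ≥ N ^ (ε / 2)`, both errors
are powers of `N`.

The Harnack inequality (`exists_harnack`) comes from explicit barriers and the minimum principle: a
gradient estimate by reflection, and a Gaussian barrier that carries lower bounds from a ball to its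
double. If Harnack failed, these two facts would produce points of a bounded box with unbounded
values.

For the finitely many small `N` crude bounds suffice. -/

namespace TorusWalk

/-! ### Discrete harmonic functions and the minimum principle -/

section MinimumPrinciple

variable {d : ℕ} {R : Type*} [Ring R]

/-- The sum of the values of `F` at the `2d` neighbours of `x`. -/
def nbrSum (F : (Fin d → R) → ℝ) (x : Fin d → R) : ℝ :=
  ∑ u : Fin d × Bool, F (x + step R u)

/-- `F` is harmonic at `x`. -/
def HarmonicAt (F : (Fin d → R) → ℝ) (x : Fin d → R) : Prop :=
  nbrSum F x = 2 * d * F x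

theorem nbrSum_add (F G : (Fin d → R) → ℝ) (x : Fin d → R) :
    nbrSum (fun y => F y + G y) x = nbrSum F x + nbrSum G x := by
  simp [nbrSum, Finset.sum_add_distrib]

theorem nbrSum_sub (F G : (Fin d → R) → ℝ) (x : Fin d → R) :
    nbrSum (fun y => F y - G y) x = nbrSum F x - nbrSum G x := by
  simp [nbrSum, Finset.sum_sub_distrib]

theorem nbrSum_const_mul (c : ℝ) (F : (Fin d → R) → ℝ) (x : Fin d → R) :
    nbrSum (fun y => c * F y) x = c * nbrSum F x := by
  simp [nbrSum, Finset.mul_sum]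

theorem nbrSum_const (c : ℝ) (x : Fin d → R) : nbrSum (fun _ => c) x = 2 * d * c := by
  simp only [nbrSum, Finset.sum_const, Finset.card_univ, Fintype.card_prod, Fintype.card_fin,
    Fintype.card_bool, nsmul_eq_mul]
  push_cast
  ring

theorem nbrSum_eq (F : (Fin d → R) → ℝ) (x : Fin d → R) :
    nbrSum F x = ∑ i, (F (x + Pi.single i 1) + F (x - Pi.single i 1)) := by
  simp [nbrSum, Fintype.sum_prod_type, step, sub_eq_add_neg, Pi.single_neg]

theorem nbrSum_mono {F G : (Fin d → R) → ℝ} (x : Fin d → R)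
    (h : ∀ u, F (x + step R u) ≤ G (x + step R u)) : nbrSum F x ≤ nbrSum G x :=
  Finset.sum_le_sum fun u _ => h u

theorem HarmonicAt.sub_const {F : (Fin d → R) → ℝ} {x : Fin d → R} (h : HarmonicAt F x) (c : ℝ) :
    HarmonicAt (fun y => F y - c) x := by
  unfold HarmonicAt at *
  rw [nbrSum_sub, nbrSum_const, h]; ring

theorem HarmonicAt.const_sub {F : (Fin d → R) → ℝ} {x : Fin d → R} (h : HarmonicAt F x) (c : ℝ) :
    HarmonicAt (fun y => c - F y) x := by
  unfold HarmonicAt at *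
  rw [nbrSum_sub, nbrSum_const, h]; ring

/-- The minimum principle: a function that is superharmonic on a finite set `D` and non-negative
at the neighbours of `D` outside `D` is non-negative on `D`, provided that one can leave `D` by
following neighbours along which an `ℕ`-valued function decreases. -/
theorem minimum_principle {D : Set (Fin d → R)} (hD : D.Finite) (ψ : (Fin d → R) → ℕ)
    (hψ : ∀ x ∈ D, ∃ u, ψ (x + step R u) < ψ x) {F : (Fin d → R) → ℝ}
    (hF : ∀ x ∈ D, nbrSum F x ≤ 2 * d * F x)
    (hb : ∀ x ∈ D, ∀ u, x + step R u ∉ D → 0 ≤ F (x + step R u)) :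
    ∀ x ∈ D, 0 ≤ F x := by
  by_contra! hneg
  obtain ⟨x₀, hx₀, hx₀neg⟩ := hneg
  obtain ⟨x₁, hx₁, hmin⟩ := hD.exists_minimalFor F D ⟨x₀, hx₀⟩
  have hmin' : ∀ y ∈ D, F x₁ ≤ F y := fun y hy => by
    by_contra! h
    exact absurd (hmin hy h.le) (not_le.2 h)
  -- Among the minimisers of `F` take one with least `ψ`. Its `ψ`-decreasing neighbour is not a
  -- minimiser, which makes the sum over neighbours strictly too large.
  obtain ⟨x, hx, hxmin⟩ := (hD.subset (Set.sep_subset D fun y => F y = F x₁)).exists_minimalFor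
    ψ _ ⟨x₁, hx₁, rfl⟩
  have hxneg : F x < 0 := hx.2 ▸ (hmin' x₀ hx₀).trans_lt hx₀neg
  obtain ⟨u₀, hu₀⟩ := hψ x hx.1
  have hge : ∀ u, F x ≤ F (x + step R u) := fun u => by
    by_cases h : x + step R u ∈ D
    · exact hx.2 ▸ hmin' _ h
    · exact hxneg.le.trans (hb x hx.1 u h)
  have hgt : F x < F (x + step R u₀) := by
    by_cases h : x + step R u₀ ∈ D
    · refine lt_of_le_of_ne (hge u₀) fun he => ?_
      exact absurd (hxmin ⟨h, he ▸ hx.2⟩ hu₀.le) (not_le.2 hu₀)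
    · exact hxneg.trans_le (hb x hx.1 u₀ h)
  have : nbrSum (fun _ => F x) x < nbrSum F x :=
    Finset.sum_lt_sum (fun u _ => hge u) ⟨u₀, Finset.mem_univ _, hgt⟩
  rw [nbrSum_const] at this
  exact absurd (hF x hx.1) (not_le.2 this)

end MinimumPrinciple

/-! ### Finite domains in `ℤ^d` -/

section Lattice

variable {d : ℕ}

theorem nbrSum_comp_add (F : (Fin d → ℤ) → ℝ) (a x : Fin d → ℤ) :
    nbrSum (fun y => F (y + a)) x = nbrSum F (x + a) := by
  simp [nbrSum, add_right_comm]

theorem minimum_principle_int [NeZero d] {D : Set (Fin d → ℤ)} (hD : D.Finite)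
    {F : (Fin d → ℤ) → ℝ} (hF : ∀ x ∈ D, nbrSum F x ≤ 2 * d * F x)
    (hb : ∀ x ∈ D, ∀ u, x + step ℤ u ∉ D → 0 ≤ F (x + step ℤ u)) :
    ∀ x ∈ D, 0 ≤ F x := by
  obtain ⟨K, hK⟩ := (hD.image fun x => x 0).bddAbove
  refine minimum_principle hD (fun x => (K + 1 - x 0).toNat) (fun x hx => ⟨(0, true), ?_⟩) hF hb
  have : x 0 ≤ K := hK ⟨x, hx, rfl⟩
  simp only [step, Pi.add_apply, Pi.single_eq_same, if_true]
  omega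

theorem finite_sup_ball (x : Fin d → ℤ) (n : ℤ) : {y : Fin d → ℤ | ∀ i, |y i - x i| ≤ n}.Finite :=
  (Set.finite_Icc (fun i => x i - n) (fun i => x i + n)).subset fun y hy =>
    ⟨fun i => by have := abs_le.1 (hy i); linarith [this.1],
      fun i => by have := abs_le.1 (hy i); linarith [this.2]⟩

end Lattice

/-! ### Gradient estimate for bounded harmonic functions -/

section Gradient

variable {d : ℕ}

/-- The squared Euclidean norm of a lattice point. -/
def normSq (y : Fin d → ℤ) : ℝ := ∑ j, (y j : ℝ) ^ 2

theorem normSq_nonneg (y : Fin d → ℤ) : 0 ≤ normSq y :=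
  Finset.sum_nonneg fun _ _ => sq_nonneg _

theorem sq_le_normSq (y : Fin d → ℤ) (i : Fin d) : (y i : ℝ) ^ 2 ≤ normSq y :=
  Finset.single_le_sum (f := fun j => (y j : ℝ) ^ 2) (fun _ _ => sq_nonneg _) (Finset.mem_univ i)

theorem normSq_add_single (y : Fin d → ℤ) (i : Fin d) (c : ℤ) :
    normSq (y + Pi.single i c) = normSq y + 2 * c * y i + (c : ℝ) ^ 2 := by
  unfold normSq
  rw [← Finset.add_sum_erase _ _ (Finset.mem_univ i),
    ← Finset.add_sum_erase Finset.univ (fun j => (y j : ℝ) ^ 2) (Finset.mem_univ i)]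
  have : ∀ j ∈ Finset.univ.erase i, (((y + Pi.single i c : Fin d → ℤ) j : ℤ) : ℝ) ^ 2 = (y j : ℝ) ^ 2 := by
    intro j hj
    simp [Pi.single_eq_of_ne (Finset.ne_of_mem_erase hj)]
  rw [Finset.sum_congr rfl this]
  simp
  ring

theorem normSq_sub_single (y : Fin d → ℤ) (i : Fin d) :
    normSq (y - Pi.single i 1) = normSq y - 2 * y i + 1 := by
  rw [sub_eq_add_neg, ← Pi.single_neg, normSq_add_single]
  push_cast
  ring

theorem nbrSum_normSq (y : Fin d → ℤ) : nbrSum normSq y = 2 * d * normSq y + 2 * d := by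
  rw [nbrSum_eq]
  simp only [normSq_add_single, normSq_sub_single]
  rw [Finset.sum_congr rfl (g := fun _ => 2 * normSq y + 2)
    (fun i _ => by push_cast; ring)]
  simp
  ring

theorem nbrSum_coord (i : Fin d) (f : ℤ → ℝ) (y : Fin d → ℤ) :
    nbrSum (fun y => f (y i)) y = 2 * d * f (y i) + (f (y i + 1) + f (y i - 1) - 2 * f (y i)) := by
  rw [nbrSum_eq, ← Finset.add_sum_erase _ _ (Finset.mem_univ i)]
  have : ∀ j ∈ Finset.univ.erase i, f ((y + Pi.single j 1 : Fin d → ℤ) i) + f ((y - Pi.single j 1 : Fin d → ℤ) i)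
      = 2 * f (y i) := by
    intro j hj
    simp [Pi.single_eq_of_ne (Finset.ne_of_mem_erase hj).symm]
    ring
  rw [Finset.sum_congr rfl this, Finset.sum_const, Finset.card_erase_of_mem (Finset.mem_univ i)]
  have hd : 1 ≤ d := i.pos
  simp [Nat.cast_sub hd]
  ring

/-- Reflection in the hyperplane `y i = 1 / 2`. -/
def reflect (i : Fin d) (y : Fin d → ℤ) : Fin d → ℤ := Function.update y i (1 - y i)

theorem reflect_same (i : Fin d) (y : Fin d → ℤ) : reflect i y i = 1 - y i := by simp [reflect]

theorem reflect_of_ne {i j : Fin d} (h : j ≠ i) (y : Fin d → ℤ) : reflect i y j = y j := by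
  simp [reflect, h]

theorem reflect_reflect (i : Fin d) (y : Fin d → ℤ) : reflect i (reflect i y) = y := by
  simp [reflect]

theorem nbrSum_comp_reflect (i : Fin d) (F : (Fin d → ℤ) → ℝ) (y : Fin d → ℤ) :
    nbrSum (fun y => F (reflect i y)) y = nbrSum F (reflect i y) := by
  rw [nbrSum_eq, nbrSum_eq]
  refine Finset.sum_congr rfl fun j _ => ?_
  by_cases h : j = i
  · subst h
    have h1 : reflect j (y + Pi.single j 1) = reflect j y - Pi.single j 1 := by
      ext k
      by_cases hk : k = j
      · subst hk; simp [reflect]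
      · simp [reflect, hk]
    have h2 : reflect j (y - Pi.single j 1) = reflect j y + Pi.single j 1 := by
      ext k
      by_cases hk : k = j
      · subst hk; simp [reflect]; ring
      · simp [reflect, hk]
    rw [h1, h2, add_comm]
  · have h1 : reflect i (y + Pi.single j 1) = reflect i y + Pi.single j 1 := by
      ext k
      by_cases hk : k = i
      · subst hk; simp [reflect, Ne.symm h]
      · simp [reflect, hk]
    have h2 : reflect i (y - Pi.single j 1) = reflect i y - Pi.single j 1 := by
      ext k
      by_cases hk : k = i
      · subst hk; simp [reflect, Ne.symm h]
      · simp [reflect, hk]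
    rw [h1, h2]

/-- The harmonic barrier in the half-box `1 ≤ y i ≤ n` (up to normalization). -/
def halfBoxBarrier (i : Fin d) (n : ℝ) (y : Fin d → ℤ) : ℝ :=
  (d * n + d - 1) * y i - d * (y i : ℝ) ^ 2 + normSq y

/-- The second difference `-2d` of `-d * (y i) ^ 2` cancels the Laplacian `2d` of `normSq`, and the
linear term is harmonic. -/
theorem harmonicAt_halfBoxBarrier (i : Fin d) (n : ℝ) (y : Fin d → ℤ) :
    HarmonicAt (halfBoxBarrier i n) y := by
  have h1 := nbrSum_coord i (fun t => (d * n + d - 1) * (t : ℝ) - d * (t : ℝ) ^ 2) y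
  have h2 := nbrSum_normSq y
  have h3 := nbrSum_add (fun y : Fin d → ℤ => (d * n + d - 1) * (y i : ℝ) - d * (y i : ℝ) ^ 2)
    normSq y
  unfold HarmonicAt halfBoxBarrier
  rw [h3, h1, h2]
  push_cast
  ring

theorem sq_add_sq_le_normSq (y : Fin d → ℤ) {i j : Fin d} (h : j ≠ i) :
    (y i : ℝ) ^ 2 + (y j : ℝ) ^ 2 ≤ normSq y := by
  unfold normSq
  rw [← Finset.add_sum_erase _ _ (Finset.mem_univ i)]
  gcongr
  exact Finset.single_le_sum (f := fun j => (y j : ℝ) ^ 2) (fun _ _ => sq_nonneg _)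
    (Finset.mem_erase.2 ⟨h, Finset.mem_univ j⟩)

/-- After scaling by `M / n ^ 2`, the barrier is at least `M` on the outer faces of the half-box,
hence dominates any difference of two values in `[0, M]`. -/
theorem sq_le_halfBoxBarrier {i : Fin d} {n : ℤ} {y : Fin d → ℤ} (h1 : 1 ≤ y i) (hn : y i ≤ n)
    (h : y i = n ∨ ∃ j, j ≠ i ∧ |y j| = n) : (n : ℝ) ^ 2 ≤ halfBoxBarrier i n y := by
  have hd : (1 : ℝ) ≤ d := by exact_mod_cast i.pos
  have h1' : (1 : ℝ) ≤ y i := by exact_mod_cast h1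
  have hn' : (y i : ℝ) ≤ n := by exact_mod_cast hn
  unfold halfBoxBarrier
  rcases h with h | ⟨j, hj, h⟩
  · have := sq_le_normSq y i
    have h' : (y i : ℝ) = n := by exact_mod_cast h
    rw [h'] at this h1' ⊢
    nlinarith [mul_nonneg (sub_nonneg.2 hd) (sub_nonneg.2 h1')]
  · have := sq_add_sq_le_normSq y hj
    have h' : (y j : ℝ) ^ 2 = (n : ℝ) ^ 2 := by
      rw [← sq_abs]
      congr 1
      exact_mod_cast h
    nlinarith [mul_nonneg (sub_nonneg.2 hd) (sub_nonneg.2 h1'),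
      mul_nonneg (mul_nonneg (sub_nonneg.2 hd) (sub_nonneg.2 h1')) (sub_nonneg.2 hn'),
      mul_nonneg (sub_nonneg.2 hn') (sub_nonneg.2 h1'), mul_nonneg (sub_nonneg.2 hd) (sub_nonneg.2 hn')]

theorem halfBoxBarrier_reflect_add_nonneg {i : Fin d} {n : ℤ} (hn : 0 ≤ n) {y : Fin d → ℤ}
    (h1 : y i = 1) : 0 ≤ halfBoxBarrier i n (reflect i y) + halfBoxBarrier i n y := by
  have hd : (1 : ℝ) ≤ d := by exact_mod_cast i.pos
  have hn' : (0 : ℝ) ≤ n := by exact_mod_cast hn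
  have h2 : reflect i y i = 0 := by simp [reflect, h1]
  have h3 := normSq_nonneg (reflect i y)
  have h4 := sq_le_normSq y i
  unfold halfBoxBarrier
  rw [h2]
  rw [h1] at h4 ⊢
  push_cast at h4 ⊢
  nlinarith

theorem abs_step_le (u : Fin d × Bool) (j : Fin d) : |step ℤ u j| ≤ 1 := by
  unfold step
  by_cases h : j = u.1
  · subst h; cases u.2 <;> simp
  · simp [h]

/-- The difference `F y - F (reflect i y)` is odd under the reflection that exchanges `0` and the
unit vector in direction `i`. In the half-box `1 ≤ y i` it is dominated by `M / n ^ 2` times the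
barrier, whose value at that unit vector is `d * n`. -/
theorem gradient_estimate_zero {F : (Fin d → ℤ) → ℝ} {n : ℤ} (hn : 1 ≤ n) {M : ℝ} (i : Fin d)
    (hF : ∀ y : Fin d → ℤ, (∀ j, |y j| ≤ n) → HarmonicAt F y ∧ 0 ≤ F y ∧ F y ≤ M) :
    F (Pi.single i 1) - F 0 ≤ d * M / n := by
  have : NeZero d := ⟨i.pos.ne'⟩
  have hn' : (1 : ℝ) ≤ n := by exact_mod_cast hn
  have hM : 0 ≤ M := by
    have := hF 0 (fun j => by simp; omega)
    exact this.2.1.trans this.2.2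
  set h : (Fin d → ℤ) → ℝ := fun y =>
    M / (n : ℝ) ^ 2 * halfBoxBarrier i n y - (F y - F (reflect i y)) with hh
  have hreflect : ∀ {y : Fin d → ℤ}, 0 ≤ y i → y i ≤ n → (∀ j, |y j| ≤ n) →
      ∀ j, |reflect i y j| ≤ n := by
    intro y h0 h1 hy j
    by_cases hj : j = i
    · subst hj
      rw [reflect_same, abs_le]
      constructor <;> omega
    · rw [reflect_of_ne hj]; exact hy j
  have hboundary : ∀ y : Fin d → ℤ, 1 ≤ y i → y i ≤ n → (∀ j, |y j| ≤ n) →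
      (y i = n ∨ ∃ j, j ≠ i ∧ |y j| = n) → 0 ≤ h y := by
    intro y h1 h2 hy hor
    have hb := sq_le_halfBoxBarrier h1 h2 hor
    have hFy := hF y hy
    have hFr := hF _ (hreflect (by omega) h2 hy)
    have : M ≤ M / (n : ℝ) ^ 2 * halfBoxBarrier i n y := by
      rw [div_mul_eq_mul_div, le_div_iff₀ (by positivity)]
      exact mul_le_mul_of_nonneg_left hb hM
    simp only [hh]
    linarith [hFy.2.2, hFr.2.1]
  -- The domain contains only points where `h` is negative, so the claim says that it is empty.
  -- Negativity is needed at the face `y i = 1`: there the neighbour with `y i = 0` is the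
  -- reflection of `y`, and oddness turns `h y < 0` into `0 ≤ h (reflect i y)`.
  have key : ∀ y ∈ {y : Fin d → ℤ | 1 ≤ y i ∧ y i ≤ n - 1 ∧ (∀ j, |y j| ≤ n - 1) ∧ h y < 0},
      0 ≤ h y := by
    refine minimum_principle_int ((finite_sup_ball 0 n).subset ?_) ?_ ?_
    · rintro y ⟨_, _, hy, _⟩ j
      have := hy j
      simp only [Pi.zero_apply, sub_zero]
      omega
    · rintro y ⟨h1, h2, hy, _⟩
      have hy' : ∀ j, |y j| ≤ n := fun j => (hy j).trans (by omega)
      have e1 : nbrSum h y = M / (n : ℝ) ^ 2 * nbrSum (halfBoxBarrier i n) y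
          - (nbrSum F y - nbrSum F (reflect i y)) := by
        rw [hh, nbrSum_sub, nbrSum_const_mul, nbrSum_sub, nbrSum_comp_reflect]
      rw [e1, harmonicAt_halfBoxBarrier i n y, (hF y hy').1,
        (hF _ (hreflect (by omega) (by omega) hy')).1]
      apply le_of_eq
      simp only [hh]
      ring
    · rintro y ⟨h1, h2, hy, hneg⟩ u hu
      have hy' : ∀ j, |(y + step ℤ u) j| ≤ n := fun j => by
        have := abs_step_le u j
        have := hy j
        rw [Pi.add_apply]
        rw [abs_le] at *
        constructor <;> omega
      have hstep := abs_step_le u i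
      rw [abs_le] at hstep
      by_cases h0 : (y + step ℤ u) i = 0
      · have hyi : y i = 1 := by
          rw [Pi.add_apply] at h0
          omega
        have hs : step ℤ u i = -1 := by
          rw [Pi.add_apply] at h0
          omega
        have hui : u.1 = i := by
          by_contra hne
          simp [step, Pi.single_eq_of_ne (Ne.symm hne)] at hs
        have he : y + step ℤ u = reflect i y := by
          ext j
          by_cases hj : j = i
          · subst hj; rw [Pi.add_apply, reflect_same, hs, hyi]; norm_num
          · rw [reflect_of_ne hj, Pi.add_apply, step, hui, Pi.single_eq_of_ne hj, add_zero]
        rw [he]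
        have hb := halfBoxBarrier_reflect_add_nonneg (i := i) (n := n) (by omega) hyi
        have : 0 ≤ M / (n : ℝ) ^ 2 *
            (halfBoxBarrier i n (reflect i y) + halfBoxBarrier i n y) :=
          mul_nonneg (by positivity) hb
        simp only [hh, reflect_reflect] at hneg ⊢
        linarith
      · have hi1 : 1 ≤ (y + step ℤ u) i := by
          rw [Pi.add_apply] at h0 ⊢
          omega
        have hi2 : (y + step ℤ u) i ≤ n := (le_abs_self _).trans (hy' i)
        by_contra! hlt
        have hin : ¬ ((y + step ℤ u) i = n ∨ ∃ j, j ≠ i ∧ |(y + step ℤ u) j| = n) := fun hor =>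
          absurd (hboundary _ hi1 hi2 hy' hor) (not_le.2 hlt)
        push Not at hin
        refine hu ⟨hi1, by have := hin.1; omega, fun j => ?_, hlt⟩
        by_cases hj : j = i
        · subst hj
          rw [abs_of_pos (by omega)]
          have := hin.1; omega
        · have := hin.2 j hj
          have := hy' j
          omega
  have hpos : 0 ≤ h (Pi.single i 1) := by
    have habs : ∀ j, |(Pi.single i 1 : Fin d → ℤ) j| ≤ 1 := fun j => by
      have := abs_step_le (i, true) j
      simpa [step] using this
    by_contra! hlt
    have hin : ¬ ((Pi.single i 1 : Fin d → ℤ) i = n ∨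
        ∃ j, j ≠ i ∧ |(Pi.single i 1 : Fin d → ℤ) j| = n) := fun hor =>
      absurd (hboundary _ (by simp) (by simpa using hn) (fun j => (habs j).trans hn) hor)
        (not_le.2 hlt)
    push Not at hin
    have hn1 : (1 : ℤ) ≠ n := by simpa using hin.1
    exact absurd (key _ ⟨by simp, by simp; omega, fun j => (habs j).trans (by omega), hlt⟩)
      (not_le.2 hlt)
  have hr : reflect i (Pi.single i 1 : Fin d → ℤ) = 0 := by
    ext j
    by_cases hj : j = i
    · subst hj; simp [reflect]
    · simp [reflect, hj]
  have hb : halfBoxBarrier i n (Pi.single i 1) = d * n := by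
    have := normSq_add_single (0 : Fin d → ℤ) i 1
    simp only [zero_add] at this
    rw [halfBoxBarrier, this]
    simp [normSq]
    ring
  simp only [hh, hr, hb] at hpos
  have : M / (n : ℝ) ^ 2 * (d * n) = d * M / n := by field_simp
  linarith

/-- The one-sided bound applied to `F` and to `M - F` controls both signs of the increment. -/
theorem gradient_estimate {F : (Fin d → ℤ) → ℝ} {n : ℤ} (hn : 1 ≤ n) {M : ℝ} (p : Fin d → ℤ)
    (hF : ∀ y : Fin d → ℤ, (∀ j, |y j - p j| ≤ n) → HarmonicAt F y ∧ 0 ≤ F y ∧ F y ≤ M)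
    (i : Fin d) : |F (p + Pi.single i 1) - F p| ≤ d * M / n := by
  have h1 := gradient_estimate_zero (F := fun y => F (y + p)) hn i (M := M) fun y hy => by
    have := hF (y + p) (fun j => by simpa using hy j)
    exact ⟨by have h := this.1; unfold HarmonicAt at *; rw [nbrSum_comp_add, h], this.2⟩
  have h2 := gradient_estimate_zero (F := fun y => M - F (y + p)) hn i (M := M) fun y hy => by
    have := hF (y + p) (fun j => by simpa using hy j)
    refine ⟨HarmonicAt.const_sub (F := fun y => F (y + p)) ?_ _, by linarith [this.2.2],
      by linarith [this.2.1]⟩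
    have h := this.1; unfold HarmonicAt at *; rw [nbrSum_comp_add, h]
  simp only [add_comm _ p] at h1 h2
  rw [abs_le]
  constructor <;> simp only [add_zero] at h1 h2 <;> linarith

/-- If all nearest-neighbour increments of `F` in a box are at most `δ`, then the values of `F` at a
point of the box and at its centre differ by at most `δ` times their `ℓ¹`-distance. -/
theorem abs_sub_le_of_increments {F : (Fin d → ℤ) → ℝ} {δ : ℝ} (p : Fin d → ℤ) {a : ℤ}
    (hδ : ∀ y : Fin d → ℤ, (∀ j, |y j - p j| ≤ a) → ∀ i, |F (y + Pi.single i 1) - F y| ≤ δ) :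
    ∀ y : Fin d → ℤ, (∀ j, |y j - p j| ≤ a) → |F y - F p| ≤ (∑ j, |y j - p j| : ℤ) * δ := by
  suffices H : ∀ k : ℕ, ∀ y : Fin d → ℤ, (∀ j, |y j - p j| ≤ a) → ∑ j, |y j - p j| = k →
      |F y - F p| ≤ k * δ by
    intro y hy
    have h0 : 0 ≤ ∑ j, |y j - p j| := Finset.sum_nonneg fun _ _ => abs_nonneg _
    have := H (∑ j, |y j - p j|).toNat y hy (by omega)
    have e : (((∑ j, |y j - p j|).toNat : ℕ) : ℝ) = ((∑ j, |y j - p j| : ℤ) : ℝ) := by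
      exact_mod_cast congrArg (Int.cast (R := ℝ)) (Int.toNat_of_nonneg h0)
    rwa [e] at this
  intro k
  induction k with
  | zero =>
    intro y _ h0
    have : y = p := by
      ext j
      have := (Finset.sum_eq_zero_iff_of_nonneg (fun _ _ => abs_nonneg _)).1
        (by simpa using h0) j (Finset.mem_univ j)
      rw [abs_eq_zero] at this
      omega
    simp [this]
  | succ k ih =>
    intro y hy hk
    obtain ⟨i, hi⟩ : ∃ i, y i ≠ p i := by
      by_contra! h
      simp [h] at hk
      omega
    have hsum : ∀ s : ℤ, |y i + s - p i| = |y i - p i| - 1 →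
        ∑ j, |(y + Pi.single i s : Fin d → ℤ) j - p j| = k := by
      intro s hs
      rw [← Finset.add_sum_erase _ _ (Finset.mem_univ i)] at hk ⊢
      have : ∀ j ∈ Finset.univ.erase i, |(y + Pi.single i s : Fin d → ℤ) j - p j| = |y j - p j| := by
        intro j hj
        simp [Pi.single_eq_of_ne (Finset.ne_of_mem_erase hj)]
      rw [Finset.sum_congr rfl this]
      simp only [Pi.add_apply, Pi.single_eq_same]
      push_cast at hk
      omega
    have hbox : ∀ s : ℤ, |y i + s - p i| = |y i - p i| - 1 →
        ∀ j, |(y + Pi.single i s : Fin d → ℤ) j - p j| ≤ a := by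
      intro s hs j
      by_cases hj : j = i
      · subst hj
        have := hy j
        simp only [Pi.add_apply, Pi.single_eq_same]
        omega
      · simpa [hj] using hy j
    push_cast
    rcases lt_or_gt_of_ne hi with hlt | hlt
    · have hs : |y i + 1 - p i| = |y i - p i| - 1 := by
        rw [abs_of_nonpos (by omega), abs_of_neg (by omega)]; omega
      have h1 := ih _ (hbox 1 hs) (hsum 1 hs)
      have h2 := hδ y hy i
      rw [abs_le] at *
      constructor <;> linarith [h1.1, h1.2, h2.1, h2.2]
    · have hs : |y i + -1 - p i| = |y i - p i| - 1 := by
        rw [abs_of_nonneg (by omega), abs_of_pos (by omega)]; omega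
      have h1 := ih _ (hbox (-1) hs) (hsum (-1) hs)
      have h2 := hδ _ (hbox (-1) hs) i
      have e : y + Pi.single i (-1) + Pi.single i 1 = y := by
        rw [add_assoc, ← Pi.single_add]; simp
      rw [e] at h2
      rw [abs_le] at *
      constructor <;> linarith [h1.1, h1.2, h2.1, h2.2]

end Gradient

/-! ### Lower bounds spread from a ball to its double -/

section Doubling

variable {d : ℕ}

theorem le_of_harmonicAt {R : Type*} [Ring R] {F : (Fin d → R) → ℝ} {y : Fin d → R}
    (hy : nbrSum F y ≤ 2 * d * F y) (h0 : ∀ u, 0 ≤ F (y + step R u)) (u : Fin d × Bool) :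
    F (y + step R u) ≤ 2 * d * F y :=
  (Finset.single_le_sum (f := fun u => F (y + step R u)) (fun u _ => h0 u)
    (Finset.mem_univ u)).trans hy

theorem sum_abs_le_normSq (y : Fin d → ℤ) : ((∑ j, |y j| : ℤ) : ℝ) ≤ normSq y := by
  unfold normSq
  push_cast
  refine Finset.sum_le_sum fun j _ => ?_
  have h : |y j| ≤ (y j) ^ 2 := by
    rw [← sq_abs]
    by_cases h : y j = 0
    · simp [h]
    · nlinarith [Int.one_le_abs h]
  exact_mod_cast h

theorem abs_cast_le_of_normSq {y : Fin d → ℤ} {s : ℝ} (hs : 0 ≤ s) (h : normSq y ≤ s ^ 2)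
    (j : Fin d) : |(y j : ℝ)| ≤ s :=
  abs_le_of_sq_le_sq ((sq_le_normSq y j).trans h) hs

theorem exists_step_toward_zero {y : Fin d → ℤ} (hy : y ≠ 0) :
    ∃ u : Fin d × Bool, normSq (y + step ℤ u) ≤ normSq y ∧
      (∑ j, |(y + step ℤ u) j|) + 1 = ∑ j, |y j| ∧
      ∀ j, min (y j) 0 ≤ (y + step ℤ u) j ∧ (y + step ℤ u) j ≤ max (y j) 0 := by
  obtain ⟨i, hi⟩ := Function.ne_iff.1 hy
  rw [Pi.zero_apply] at hi
  have key : ∀ c : ℤ, |y i + c| + 1 = |y i| → 2 * c * y i + c ^ 2 ≤ 0 →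
      min (y i) 0 ≤ y i + c ∧ y i + c ≤ max (y i) 0 →
      normSq (y + Pi.single i c) ≤ normSq y ∧
      (∑ j, |(y + Pi.single i c : Fin d → ℤ) j|) + 1 = ∑ j, |y j| ∧
      ∀ j, min (y j) 0 ≤ (y + Pi.single i c : Fin d → ℤ) j ∧
        (y + Pi.single i c : Fin d → ℤ) j ≤ max (y j) 0 := by
    intro c hc hc' hmm
    refine ⟨?_, ?_, fun j => ?_⟩
    · rw [normSq_add_single]
      have : ((2 * c * y i + c ^ 2 : ℤ) : ℝ) ≤ 0 := by exact_mod_cast hc'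
      push_cast at this
      linarith
    · rw [← Finset.add_sum_erase _ _ (Finset.mem_univ i),
        ← Finset.add_sum_erase Finset.univ (fun j => |y j|) (Finset.mem_univ i)]
      have : ∀ j ∈ Finset.univ.erase i, |(y + Pi.single i c : Fin d → ℤ) j| = |y j| := by
        intro j hj
        simp [Pi.single_eq_of_ne (Finset.ne_of_mem_erase hj)]
      rw [Finset.sum_congr rfl this]
      simp only [Pi.add_apply, Pi.single_eq_same]
      omega
    · by_cases hj : j = i
      · subst hj
        simp only [Pi.add_apply, Pi.single_eq_same]
        exact hmm
      · simp [hj]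
  rcases lt_or_gt_of_ne hi with h | h
  · refine ⟨(i, true), ?_⟩
    have := key 1 (by rw [abs_of_neg h, abs_of_nonpos (by omega)]; omega) (by omega) (by omega)
    simpa [step] using this
  · refine ⟨(i, false), ?_⟩
    have := key (-1) (by rw [abs_of_pos h, abs_of_nonneg (by omega)]; omega) (by omega) (by omega)
    simpa [step] using this

/-- Each step towards `0` costs at most a factor `2d`, because one neighbour's value is at most the
sum over all neighbours. -/
theorem lower_bound_along_path {F : (Fin d → ℤ) → ℝ} {t : ℝ}
    (hF : ∀ y, normSq y ≤ t → nbrSum F y ≤ 2 * d * F y ∧ ∀ u, 0 ≤ F (y + step ℤ u)) :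
    ∀ (k : ℕ) (y : Fin d → ℤ), normSq y ≤ t → ∑ j, |y j| = k → F 0 ≤ (2 * d) ^ k * F y := by
  intro k
  induction k with
  | zero =>
    intro y _ h0
    have : y = 0 := by
      ext j
      have := (Finset.sum_eq_zero_iff_of_nonneg (fun _ _ => abs_nonneg _)).1
        (by simpa using h0) j (Finset.mem_univ j)
      simpa using this
    simp [this]
  | succ k ih =>
    intro y hy hk
    obtain ⟨u, hu, hu', -⟩ := exists_step_toward_zero (y := y) (by
      rintro rfl
      simp at hk
      omega)
    have h1 := ih _ (hu.trans hy) (by push_cast at hk; omega)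
    have h2 := le_of_harmonicAt (hF y hy).1 (hF y hy).2 u
    calc F 0 ≤ (2 * d) ^ k * F (y + step ℤ u) := h1
      _ ≤ (2 * d) ^ k * (2 * d * F y) := by gcongr
      _ = (2 * d) ^ (k + 1) * F y := by ring

theorem one_add_sq_div_two_le_cosh (t : ℝ) : 1 + t ^ 2 / 2 ≤ Real.cosh t := by
  have h1 : Real.cosh t = 1 + 2 * Real.sinh (t / 2) ^ 2 := by
    have h := Real.cosh_two_mul (t / 2)
    rw [mul_div_cancel₀ t two_ne_zero, Real.cosh_sq] at h
    linarith
  have h2 : (t / 2) ^ 2 ≤ Real.sinh (t / 2) ^ 2 := by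
    rw [sq_le_sq, Real.abs_sinh]
    exact Real.self_le_sinh_iff.2 (abs_nonneg _)
  rw [h1]
  linarith

/-- The Gaussian barrier is subharmonic away from the centre. -/
theorem gaussian_subharmonic {l s : ℝ} (hl : l * s ^ 2 = d) (hl0 : 0 ≤ l) (hl1 : l ≤ 1)
    {y : Fin d → ℤ} (hy : s ^ 2 ≤ normSq y) :
    2 * d * Real.exp (-(l * normSq y)) ≤ nbrSum (fun y => Real.exp (-(l * normSq y))) y := by
  have hterm : ∀ i, Real.exp (-(l * normSq y)) * Real.exp (-l) * (2 + (2 * l * y i) ^ 2) ≤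
      Real.exp (-(l * normSq (y + Pi.single i 1))) +
      Real.exp (-(l * normSq (y - Pi.single i 1))) := by
    intro i
    have h1 : Real.exp (-(l * normSq (y + Pi.single i 1))) =
        Real.exp (-(l * normSq y)) * Real.exp (-l) * Real.exp (-(2 * l * y i)) := by
      rw [← Real.exp_add, ← Real.exp_add, normSq_add_single]
      push_cast
      ring_nf
    have h2 : Real.exp (-(l * normSq (y - Pi.single i 1))) =
        Real.exp (-(l * normSq y)) * Real.exp (-l) * Real.exp (2 * l * y i) := by
      rw [← Real.exp_add, ← Real.exp_add, normSq_sub_single]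
      ring_nf
    rw [h1, h2, ← mul_add]
    have h3 := one_add_sq_div_two_le_cosh (2 * l * y i)
    rw [Real.cosh_eq] at h3
    refine mul_le_mul_of_nonneg_left ?_ (by positivity)
    linarith
  have hexp : Real.exp l ≤ 1 + 2 * l := by
    have := abs_le.1 (Real.abs_exp_sub_one_sub_id_le (x := l) (by rw [abs_of_nonneg hl0]; exact hl1))
    nlinarith [this.2]
  have hexp' : 1 ≤ Real.exp (-l) * (1 + 2 * l) := by
    calc (1 : ℝ) = Real.exp (-l) * Real.exp l := by rw [← Real.exp_add]; simp
      _ ≤ _ := by gcongr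
  rw [nbrSum_eq]
  refine le_trans ?_ (Finset.sum_le_sum fun i _ => hterm i)
  rw [← Finset.mul_sum, Finset.sum_add_distrib]
  have hsq : ∑ i, (2 * l * (y i : ℝ)) ^ 2 = 4 * l ^ 2 * normSq y := by
    rw [normSq, Finset.mul_sum]
    exact Finset.sum_congr rfl fun _ _ => by ring
  rw [hsq]
  simp only [Finset.sum_const, Finset.card_univ, Fintype.card_fin, nsmul_eq_mul]
  -- Since `l * s ^ 2 = d`, the hypothesis on `normSq y` gives `l ^ 2 * normSq y ≥ l * d`. This gain
  -- outweighs the loss `exp (-l)`.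
  have h4 : 2 * d * (1 + 2 * l) ≤ d * 2 + 4 * l ^ 2 * normSq y := by
    nlinarith [mul_le_mul_of_nonneg_left hy (sq_nonneg l)]
  calc 2 * d * Real.exp (-(l * normSq y))
      ≤ 2 * d * Real.exp (-(l * normSq y)) * (Real.exp (-l) * (1 + 2 * l)) :=
        le_mul_of_one_le_right (by positivity) hexp'
    _ = Real.exp (-(l * normSq y)) * Real.exp (-l) * (2 * d * (1 + 2 * l)) := by ring
    _ ≤ _ := by gcongr

/-- Comparison with `a * (w - exp (-9d))` on the annulus of radii `s` and `3 * s`: the barrier is at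
most `a` on the inner side and non-positive outside. On the ball of radius `2 * s` the Gaussian `w`
is still at least `exp (-4d)`. -/
theorem doubling_zero_of_large [NeZero d] {F : (Fin d → ℤ) → ℝ} {s a : ℝ} (hs : 0 < s)
    (hsd : (d : ℝ) ≤ s ^ 2) (ha : 0 ≤ a)
    (hF : ∀ y : Fin d → ℤ, (∀ j, |(y j : ℝ)| ≤ 3 * s + 1) → 0 ≤ F y ∧ HarmonicAt F y)
    (hFa : ∀ y, normSq y ≤ s ^ 2 → a ≤ F y) {y : Fin d → ℤ} (hy : normSq y ≤ (2 * s) ^ 2) :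
    (Real.exp (-(4 * d)) - Real.exp (-(9 * d))) * a ≤ F y := by
  set l : ℝ := d / s ^ 2 with hl
  have hls : l * s ^ 2 = d := by rw [hl]; field_simp
  have hl0 : 0 ≤ l := by positivity
  have hl1 : l ≤ 1 := by rw [hl, div_le_one (by positivity)]; exact hsd
  set w : (Fin d → ℤ) → ℝ := fun y => Real.exp (-(l * normSq y)) with hw
  have hw1 : ∀ y, w y ≤ 1 := fun y =>
    Real.exp_le_one_iff.2 (neg_nonpos.2 (mul_nonneg hl0 (normSq_nonneg y)))
  have key : ∀ y ∈ {y : Fin d → ℤ | s ^ 2 < normSq y ∧ normSq y ≤ (3 * s) ^ 2},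
      0 ≤ F y - a * (w y - Real.exp (-(9 * d))) := by
    refine minimum_principle_int ((finite_sup_ball 0 ⌈3 * s⌉).subset ?_) ?_ ?_
    · rintro y ⟨_, hy⟩ j
      have := abs_cast_le_of_normSq (by positivity) hy j
      simp only [Pi.zero_apply, sub_zero]
      exact_mod_cast this.trans (Int.le_ceil _)
    · rintro y ⟨hy1, hy2⟩
      have h1 := (hF y fun j =>
        (abs_cast_le_of_normSq (by positivity) hy2 j).trans (by linarith)).2
      have h2 := gaussian_subharmonic hls hl0 hl1 hy1.le
      rw [nbrSum_sub, nbrSum_const_mul, nbrSum_sub, nbrSum_const, h1]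
      have := mul_le_mul_of_nonneg_left h2 ha
      linarith
    · rintro y ⟨hy1, hy2⟩ u hu
      have hdom : ∀ j, |(((y + step ℤ u : Fin d → ℤ) j : ℤ) : ℝ)| ≤ 3 * s + 1 := fun j => by
        have h1 := abs_cast_le_of_normSq (by positivity) hy2 j
        have h2 : |(step ℤ u j : ℝ)| ≤ 1 := by exact_mod_cast abs_step_le u j
        rw [Pi.add_apply]
        push_cast
        exact (abs_add_le _ _).trans (add_le_add h1 h2)
      rcases le_or_gt (normSq (y + step ℤ u)) (s ^ 2) with h | h
      · have h1 := hFa _ h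
        have h2 := hw1 (y + step ℤ u)
        have h3 := Real.exp_pos (-(9 * d : ℝ))
        nlinarith
      · have h9 : (3 * s) ^ 2 < normSq (y + step ℤ u) := by
          by_contra! h'
          exact hu ⟨h, h'⟩
        have h1 : w (y + step ℤ u) ≤ Real.exp (-(9 * d)) := by
          apply Real.exp_le_exp.2
          nlinarith [mul_le_mul_of_nonneg_left h9.le hl0]
        have h2 := (hF _ hdom).1
        nlinarith
  rcases le_or_gt (normSq y) (s ^ 2) with h | h
  · refine le_trans ?_ (hFa y h)
    have h3 := Real.exp_pos (-(9 * d : ℝ))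
    have h4 : Real.exp (-(4 * d : ℝ)) ≤ 1 := Real.exp_le_one_iff.2 (by
      have : (0 : ℝ) ≤ d := by positivity
      linarith)
    nlinarith
  · have h1 := key y ⟨h, hy.trans (by nlinarith [sq_nonneg s])⟩
    have h2 : Real.exp (-(4 * d)) ≤ w y := by
      apply Real.exp_le_exp.2
      nlinarith [mul_le_mul_of_nonneg_left hy hl0]
    nlinarith

/-- When `s ^ 2 ≤ d` the Gaussian is not subharmonic with this argument, but every point of the ball
of radius `2 * s` is at most `4 * d` steps away from `0`. -/
theorem doubling_zero_of_small [NeZero d] {F : (Fin d → ℤ) → ℝ} {s a : ℝ} (hs : 0 < s)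
    (hsd : s ^ 2 ≤ (d : ℝ))
    (hF : ∀ y : Fin d → ℤ, (∀ j, |(y j : ℝ)| ≤ 3 * s + 1) → 0 ≤ F y ∧ HarmonicAt F y)
    (hFa : a ≤ F 0) {y : Fin d → ℤ} (hy : normSq y ≤ (2 * s) ^ 2) :
    ((2 * d : ℝ) ^ (4 * d))⁻¹ * a ≤ F y := by
  have hd : (1 : ℝ) ≤ d := by exact_mod_cast Nat.one_le_iff_ne_zero.2 (NeZero.ne d)
  have h0 : 0 ≤ ∑ j, |y j| := Finset.sum_nonneg fun _ _ => abs_nonneg _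
  have hk : (((∑ j, |y j|).toNat : ℕ) : ℤ) = ∑ j, |y j| := Int.toNat_of_nonneg h0
  have hdom : ∀ y : Fin d → ℤ, normSq y ≤ (2 * s) ^ 2 → ∀ u j,
      |(((y + step ℤ u : Fin d → ℤ) j : ℤ) : ℝ)| ≤ 3 * s + 1 := fun y hy u j => by
    have h1 := abs_cast_le_of_normSq (by positivity) hy j
    have h2 : |(step ℤ u j : ℝ)| ≤ 1 := by exact_mod_cast abs_step_le u j
    rw [Pi.add_apply]
    push_cast
    exact (abs_add_le _ _).trans (by linarith)
  have hdom' : ∀ y : Fin d → ℤ, normSq y ≤ (2 * s) ^ 2 → ∀ j, |(y j : ℝ)| ≤ 3 * s + 1 :=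
    fun y hy j => (abs_cast_le_of_normSq (by positivity) hy j).trans (by linarith)
  have h1 := lower_bound_along_path (F := F) (t := (2 * s) ^ 2)
    (fun y hy => ⟨(hF y (hdom' y hy)).2.le, fun u => (hF _ (hdom y hy u)).1⟩) _ y hy hk.symm
  have hle : (∑ j, |y j|).toNat ≤ 4 * d := by
    have h2 : (((∑ j, |y j|).toNat : ℕ) : ℝ) ≤ (4 * d : ℕ) := by
      have : (((∑ j, |y j|).toNat : ℕ) : ℝ) = ((∑ j, |y j| : ℤ) : ℝ) := by
        exact_mod_cast congrArg (Int.cast (R := ℝ)) hk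
      rw [this]
      push_cast
      refine le_trans (by exact_mod_cast sum_abs_le_normSq y) (hy.trans ?_)
      nlinarith
    exact_mod_cast h2
  rw [inv_mul_le_iff₀ (by positivity)]
  refine hFa.trans (h1.trans ?_)
  have hFy := (hF y (hdom' y hy)).1
  gcongr
  linarith

/-- A non-negative harmonic function that is at least `a` on a Euclidean ball is at least `c * a`
on the ball of twice the radius. -/
theorem exists_doubling (d : ℕ) [NeZero d] : ∃ c : ℝ, 0 < c ∧ c < 1 ∧
    ∀ (F : (Fin d → ℤ) → ℝ) (p : Fin d → ℤ) (s a : ℝ), 0 < s → 0 ≤ a →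
      (∀ y : Fin d → ℤ, (∀ j, |(y j : ℝ) - p j| ≤ 3 * s + 1) → 0 ≤ F y ∧ HarmonicAt F y) →
      (∀ y, normSq (y - p) ≤ s ^ 2 → a ≤ F y) →
      ∀ y, normSq (y - p) ≤ (2 * s) ^ 2 → c * a ≤ F y := by
  have hd : (1 : ℝ) ≤ d := by exact_mod_cast Nat.one_le_iff_ne_zero.2 (NeZero.ne d)
  have hpos : 0 < Real.exp (-(4 * d : ℝ)) - Real.exp (-(9 * d : ℝ)) :=
    sub_pos.2 (Real.exp_lt_exp.2 (by linarith))
  refine ⟨min (Real.exp (-(4 * d)) - Real.exp (-(9 * d))) ((2 * d : ℝ) ^ (4 * d))⁻¹,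
    lt_min hpos (by positivity), ?_, ?_⟩
  · refine (min_le_left _ _).trans_lt ?_
    have h4 : Real.exp (-(4 * d : ℝ)) ≤ 1 := Real.exp_le_one_iff.2 (by linarith)
    have h3 := Real.exp_pos (-(9 * d : ℝ))
    linarith
  · intro F p s a hs ha hF hFa y hy
    have hF' : ∀ y : Fin d → ℤ, (∀ j, |(y j : ℝ)| ≤ 3 * s + 1) →
        0 ≤ F (y + p) ∧ HarmonicAt (fun y => F (y + p)) y := fun y hy => by
      have h := hF (y + p) (fun j => by simpa using hy j)
      exact ⟨h.1, by have h := h.2; unfold HarmonicAt at *; rw [nbrSum_comp_add, h]⟩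
    have hFa' : ∀ y, normSq y ≤ s ^ 2 → a ≤ F (y + p) := fun y hy => hFa _ (by simpa using hy)
    have e : F y = (fun y => F (y + p)) (y - p) := by simp
    rw [e]
    rcases le_total (d : ℝ) (s ^ 2) with h | h
    · refine le_trans (mul_le_mul_of_nonneg_right (min_le_left _ _) ha)
        (doubling_zero_of_large hs h ha hF' hFa' hy)
    · refine le_trans (mul_le_mul_of_nonneg_right (min_le_right _ _) ha)
        (doubling_zero_of_small hs h hF' (hFa' 0 ?_) hy)
      simp [normSq]
      positivity

end Doubling

/-! ### Elliptic Harnack inequality on `ℤ^d` -/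

section Harnack

variable {d : ℕ}

theorem iterate_doubling {c : ℝ} (hc0 : 0 < c)
    (hc : ∀ (F : (Fin d → ℤ) → ℝ) (p : Fin d → ℤ) (s a : ℝ), 0 < s → 0 ≤ a →
      (∀ y : Fin d → ℤ, (∀ j, |(y j : ℝ) - p j| ≤ 3 * s + 1) → 0 ≤ F y ∧ HarmonicAt F y) →
      (∀ y, normSq (y - p) ≤ s ^ 2 → a ≤ F y) →
      ∀ y, normSq (y - p) ≤ (2 * s) ^ 2 → c * a ≤ F y)
    {F : (Fin d → ℤ) → ℝ} {p : Fin d → ℤ} {s a : ℝ} (hs : 0 < s) (ha : 0 ≤ a)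
    (hFa : ∀ y, normSq (y - p) ≤ s ^ 2 → a ≤ F y) (k : ℕ)
    (hF : ∀ y : Fin d → ℤ, (∀ j, |(y j : ℝ) - p j| ≤ 3 * (2 ^ k * s) + 1) →
      0 ≤ F y ∧ HarmonicAt F y) :
    ∀ y, normSq (y - p) ≤ (2 ^ k * s) ^ 2 → c ^ k * a ≤ F y := by
  induction k with
  | zero => simpa using hFa
  | succ k ih =>
    have hmono : 3 * (2 ^ k * s) + 1 ≤ 3 * (2 ^ (k + 1) * s) + 1 := by
      have : 0 < 2 ^ k * s := by positivity
      rw [pow_succ]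
      linarith
    have h1 := ih fun y hy => hF y fun j => (hy j).trans hmono
    have h2 := hc F p (2 ^ k * s) (c ^ k * a) (by positivity) (by positivity)
      (fun y hy => hF y fun j => (hy j).trans hmono) h1
    intro y hy
    have := h2 y (by rw [pow_succ] at hy; convert hy using 2; ring)
    rw [pow_succ]
    linarith

theorem normSq_le_of_abs_le {y : Fin d → ℤ} {s : ℝ} (h : ∀ j, |(y j : ℝ)| ≤ s) :
    normSq y ≤ (d * s) ^ 2 := by
  have h1 : normSq y ≤ ∑ _j : Fin d, s ^ 2 :=
    Finset.sum_le_sum fun j _ => sq_le_sq' (by linarith [(abs_le.1 (h j)).1]) (abs_le.1 (h j)).2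
  simp only [Finset.sum_const, Finset.card_univ, Fintype.card_fin, nsmul_eq_mul] at h1
  refine h1.trans ?_
  rcases Nat.eq_zero_or_pos d with h0 | h0
  · simp [h0]
  · have : (1 : ℝ) ≤ d := by exact_mod_cast h0
    nlinarith [mul_nonneg (sub_nonneg.2 this) (sq_nonneg s), sq_nonneg s]

/-- If a non-negative function, harmonic in a large box around `x`, drops by a factor `2` at a
point of the Euclidean ball of radius `s` around `x`, then it is much larger than `F x` somewhere
in the large box. -/
theorem exists_large_value {F : (Fin d → ℤ) → ℝ} {x w : Fin d → ℤ} {s c : ℝ} (hs : 0 < s)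
    (hc : 0 < c) {Λ : ℕ} (hΛ : 2 * d ^ 2 / c ≤ Λ - 1) (hΛ2 : 2 ≤ Λ)
    (hF : ∀ y : Fin d → ℤ, (∀ j, |(y j : ℝ) - x j| ≤ Λ * s) → 0 ≤ F y ∧ HarmonicAt F y)
    (hw : normSq (w - x) ≤ s ^ 2) (hFw : F w < F x / 2) :
    ∃ z : Fin d → ℤ, (∀ j, |(z j : ℝ) - x j| ≤ Λ * s) ∧ F x ≤ c * F z := by
  have hΛ' : (2 : ℝ) ≤ Λ := by exact_mod_cast hΛ2
  have hx0 := (hF x (fun j => by simp; positivity)).1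
  set a : ℤ := ⌊s⌋ with ha
  have has : (a : ℝ) ≤ s := Int.floor_le s
  have hwa : ∀ j, |w j - x j| ≤ a := fun j => by
    have := abs_cast_le_of_normSq hs.le hw j
    rw [ha, Int.le_floor]
    push_cast
    simpa using this
  have ha1 : 1 ≤ a := by
    by_contra! h
    have hwx : w = x := by
      ext j
      have := hwa j
      have h0 := abs_nonneg (w j - x j)
      have : w j - x j = 0 := abs_eq_zero.1 (by omega)
      omega
    rw [hwx] at hFw
    linarith
  have ha1' : (1 : ℝ) ≤ a := by exact_mod_cast ha1
  -- Otherwise `F ≤ F x / c` on the large box. The gradient estimate in boxes of radius `(Λ - 1) *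
  -- a`, summed over at most `d * a` steps from `x` to `w`, then bounds the drop by `d ^ 2 / (c * (Λ
  -- - 1)) * F x ≤ F x / 2`.
  by_contra! hcon
  have hbox : ∀ z : Fin d → ℤ, (∀ j, |z j - x j| ≤ Λ * a) → ∀ j, |(z j : ℝ) - x j| ≤ Λ * s := by
    intro z hz j
    have h1 : (|z j - x j| : ℝ) ≤ Λ * a := by exact_mod_cast hz j
    exact h1.trans (by gcongr)
  have hn : 1 ≤ ((Λ : ℤ) - 1) * a := by
    have : (2 : ℤ) ≤ Λ := by exact_mod_cast hΛ2
    nlinarith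
  have hinc := abs_sub_le_of_increments (F := F) (δ := d * (F x / c) / (((Λ : ℤ) - 1) * a : ℤ)) x
    (a := a) (fun y hy i => gradient_estimate hn y (fun z hz => by
      have hzx : ∀ j, |z j - x j| ≤ Λ * a := fun j => by
        have h1 := hz j
        have h2 := hy j
        have h3 := abs_sub_le (z j) (y j) (x j)
        linarith
      have h1 := hF z (hbox z hzx)
      refine ⟨h1.2, h1.1, ?_⟩
      rw [le_div_iff₀ hc]
      linarith [hcon z (hbox z hzx)]) i) w hwa
  have hsum : ((∑ j, |w j - x j| : ℤ) : ℝ) ≤ d * a := by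
    have : ∑ j, |w j - x j| ≤ ∑ _j : Fin d, a := Finset.sum_le_sum fun j _ => hwa j
    simp only [Finset.sum_const, Finset.card_univ, Fintype.card_fin, nsmul_eq_mul] at this
    exact_mod_cast this
  have hΛ1 : (0 : ℝ) < Λ - 1 := by linarith
  have hδ : (0 : ℝ) ≤ d * (F x / c) / (((Λ : ℤ) - 1) * a : ℤ) := by
    push_cast
    positivity
  have hbound : |F w - F x| ≤ F x / 2 := by
    refine hinc.trans ((mul_le_mul_of_nonneg_right hsum hδ).trans ?_)
    push_cast
    have e : (d : ℝ) * a * (d * (F x / c) / ((Λ - 1) * a)) = d ^ 2 / c / (Λ - 1) * F x := by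
      field_simp
    rw [e]
    have : d ^ 2 / c / ((Λ : ℝ) - 1) ≤ 1 / 2 := by
      rw [div_le_iff₀ hΛ1]
      rw [mul_div_assoc] at hΛ
      linarith
    nlinarith
  have := (abs_le.1 hbound).1
  linarith

/-- The elliptic Harnack inequality for non-negative harmonic functions on the lattice. -/
theorem exists_harnack (d : ℕ) [NeZero d] : ∃ (H : ℝ) (L : ℕ), 1 ≤ H ∧ 1 ≤ L ∧
    ∀ (F : (Fin d → ℤ) → ℝ) (x₀ : Fin d → ℤ) (n : ℕ), 1 ≤ n →
      (∀ y : Fin d → ℤ, (∀ j, |y j - x₀ j| ≤ L * n) → 0 ≤ F y ∧ HarmonicAt F y) →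
      ∀ y : Fin d → ℤ, (∀ j, |y j - x₀ j| ≤ n) → F x₀ ≤ H * F y := by
  obtain ⟨c, hc0, hc1, hc⟩ := exists_doubling d
  obtain ⟨Λ, hΛ⟩ := exists_nat_ge (2 * (d : ℝ) ^ 2 / c + 2)
  have hΛ2 : (2 : ℝ) ≤ Λ := le_trans (by have : 0 ≤ 2 * (d : ℝ) ^ 2 / c := by positivity
                                         linarith) hΛ
  -- With this `i`, the Euclidean ball of radius `2 ^ i * n` around any point within `2 * Λ * n` of
  -- `x₀` contains `y`.
  obtain ⟨i, hi⟩ := pow_unbounded_of_one_lt ((d : ℝ) * (1 + 2 * Λ)) (one_lt_two)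
  refine ⟨2 / c ^ i, 2 * Λ + 3 * 2 ^ i + 1, ?_, by omega, ?_⟩
  · rw [le_div_iff₀ (by positivity), one_mul]
    exact (pow_le_one₀ hc0.le hc1.le).trans one_le_two
  intro F x₀ n hn hF y hy
  have hn' : (1 : ℝ) ≤ n := by exact_mod_cast hn
  have hFr : ∀ y : Fin d → ℤ, (∀ j, |(y j : ℝ) - x₀ j| ≤ 2 * Λ * n + (3 * (2 ^ i * n) + 1)) →
      0 ≤ F y ∧ HarmonicAt F y := fun y hy => hF y fun j => by
    have h1 := hy j
    have h2 : |(y j : ℝ) - x₀ j| ≤ (2 * Λ + 3 * 2 ^ i + 1) * n := h1.trans (by nlinarith)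
    exact_mod_cast h2
  by_contra! hcon
  have hy' : ∀ j, |(y j : ℝ) - x₀ j| ≤ n := fun j => by exact_mod_cast hy j
  have hFy : 0 ≤ F y := (hFr y fun j => (hy' j).trans (by
    have : 0 ≤ 2 * (Λ : ℝ) * n := by positivity
    have : (1 : ℝ) ≤ 2 ^ i := one_le_pow₀ one_le_two
    nlinarith)).1
  have hFx₀ : 0 < F x₀ := lt_of_le_of_lt (by positivity) hcon
  have hFy2 : F y < c ^ i * F x₀ / 2 := by
    rw [div_mul_eq_mul_div, div_lt_iff₀ (by positivity)] at hcon
    linarith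
  -- If Harnack fails at `y`, there are points where `F` grows like `c ^ (-j)`. The `j`-th
  -- displacement is `Λ * n / 2 ^ j`, so all of them stay within `2 * Λ * n` of `x₀`, which is
  -- impossible for a function on a finite box.
  have key : ∀ j : ℕ, ∃ x : Fin d → ℤ, (∀ k, |(x k : ℝ) - x₀ k| ≤ 2 * Λ * n * (1 - (1 / 2) ^ j)) ∧
      F x₀ ≤ c ^ j * F x := by
    intro j
    induction j with
    | zero => exact ⟨x₀, by simp, by simp⟩
    | succ j ih =>
      obtain ⟨x, hx, hFx⟩ := ih
      set s : ℝ := n * (1 / 2) ^ j with hs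
      have hs0 : 0 < s := by positivity
      have hx' : ∀ k, |(x k : ℝ) - x₀ k| ≤ 2 * Λ * n := fun k => (hx k).trans
        (mul_le_of_le_one_right (by positivity) (by
          have : (0 : ℝ) ≤ (1 / 2) ^ j := by positivity
          linarith))
      have htri : ∀ {z : Fin d → ℤ} {t : ℝ}, (∀ k, |(z k : ℝ) - x k| ≤ t) → ∀ k,
          |(z k : ℝ) - x₀ k| ≤ 2 * Λ * n * (1 - (1 / 2) ^ j) + t := fun {z t} hz k => by
        have := abs_sub_le (z k : ℝ) (x k) (x₀ k)
        linarith [hz k, hx k]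
      have htri' : ∀ {z : Fin d → ℤ} {t : ℝ}, (∀ k, |(z k : ℝ) - x k| ≤ t) → ∀ k,
          |(z k : ℝ) - x₀ k| ≤ 2 * Λ * n + t := fun {z t} hz k => by
        have := abs_sub_le (z k : ℝ) (x k) (x₀ k)
        linarith [hz k, hx' k]
      have hstep : 2 * Λ * n * (1 - (1 / 2) ^ j) + Λ * s = 2 * Λ * n * (1 - (1 / 2) ^ (j + 1)) := by
        rw [hs, pow_succ]
        ring
      have hFx0 : 0 ≤ F x := by
        by_contra! h
        have : c ^ j * F x < 0 := mul_neg_of_pos_of_neg (by positivity) h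
        linarith
      -- If `F` stayed above `F x / 2` on the ball of radius `s`, then `j + i` doublings would carry
      -- this bound to `y`, with `F y ≥ c ^ (j + i) * F x / 2 ≥ c ^ i * F x₀ / 2`.
      obtain ⟨w, hw, hFw⟩ : ∃ w, normSq (w - x) ≤ s ^ 2 ∧ F w < F x / 2 := by
        by_contra! h
        have hs2 : 2 ^ (j + i) * s = 2 ^ i * n := by
          rw [hs, pow_add, one_div, inv_pow]
          field_simp
        have h1 := iterate_doubling hc0 hc hs0 (by positivity) h (j + i) (fun z hz => by
          rw [hs2] at hz
          exact hFr z (htri' hz)) y (by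
            rw [hs2]
            refine (normSq_le_of_abs_le (s := n + 2 * Λ * n) fun k => ?_).trans ?_
            · have := abs_sub_le (y k : ℝ) (x₀ k) (x k)
              rw [abs_sub_comm (x₀ k : ℝ)] at this
              simp only [Pi.sub_apply, Int.cast_sub]
              linarith [hy' k, hx' k]
            · have : (d : ℝ) * (n + 2 * Λ * n) = d * (1 + 2 * Λ) * n := by ring
              rw [this]
              gcongr)
        rw [pow_add] at h1
        have : c ^ i * F x₀ ≤ c ^ i * (c ^ j * F x) := by gcongr
        nlinarith
      obtain ⟨z, hz, hFz⟩ := exists_large_value (Λ := Λ) hs0 hc0 (by linarith) (by exact_mod_cast hΛ2)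
        (fun z hz => hFr z fun k => ((htri hz k).trans (by
          rw [hstep]
          have h1 : (0 : ℝ) ≤ (1 / 2) ^ (j + 1) := by positivity
          have h2 : 0 ≤ 2 * (Λ : ℝ) * n := by positivity
          have h3 : 0 ≤ 3 * ((2 : ℝ) ^ i * n) + 1 := by positivity
          nlinarith))) hw hFw
      refine ⟨z, fun k => (htri hz k).trans hstep.le, hFx.trans ?_⟩
      rw [pow_succ, mul_assoc]
      gcongr
  obtain ⟨B, hB⟩ := ((finite_sup_ball x₀ (2 * Λ * n)).image F).bddAbove
  have hle : ∀ j : ℕ, F x₀ ≤ c ^ j * B := fun j => by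
    obtain ⟨x, hx, hFx⟩ := key j
    refine hFx.trans ?_
    gcongr
    refine hB ⟨x, fun k => ?_, rfl⟩
    have : |(x k : ℝ) - x₀ k| ≤ 2 * Λ * n := (hx k).trans
      (mul_le_of_le_one_right (by positivity) (by
        have : (0 : ℝ) ≤ (1 / 2) ^ j := by positivity
        linarith))
    exact_mod_cast this
  have hlim : Filter.Tendsto (fun j : ℕ => c ^ j * B) Filter.atTop (nhds (0 * B)) :=
    (tendsto_pow_atTop_nhds_zero_of_lt_one hc0.le hc1).mul_const B
  have := ge_of_tendsto' hlim hle
  linarith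

end Harnack

/-! ### Harnack chains on `ℓ_∞`-spheres -/

section SphereHarnack

variable {d : ℕ}

/-- The point obtained from `x` by moving each coordinate towards that of `y` by at most `a`. -/
def moveToward (x y : Fin d → ℤ) (a : ℤ) : Fin d → ℤ :=
  fun i => x i + max (-a) (min a (y i - x i))

/-- Harnack chain between two points of a sphere that share a coordinate of maximal modulus. -/
theorem harnack_of_shared_coord {H : ℝ} {L : ℕ} (hH : 1 ≤ H)
    (hHL : ∀ (F : (Fin d → ℤ) → ℝ) (x₀ : Fin d → ℤ) (n : ℕ), 1 ≤ n →
      (∀ y : Fin d → ℤ, (∀ j, |y j - x₀ j| ≤ L * n) → 0 ≤ F y ∧ HarmonicAt F y) →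
      ∀ y : Fin d → ℤ, (∀ j, |y j - x₀ j| ≤ n) → F x₀ ≤ H * F y)
    {G : (Fin d → ℤ) → ℝ} {n : ℕ} (hn : 1 ≤ n)
    (hG : ∀ y : Fin d → ℤ, (∃ j, L * n ≤ |y j|) → (∀ j, |y j| ≤ 3 * (L * n)) →
      0 ≤ G y ∧ HarmonicAt G y)
    {x y : Fin d → ℤ} (hx : ∀ j, |x j| ≤ 2 * (L * n)) (hy : ∀ j, |y j| ≤ 2 * (L * n))
    {l : Fin d} (hl : x l = y l) (hxl : |x l| = 2 * (L * n)) :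
    G x ≤ H ^ (4 * L) * G y := by
  have hH0 : 0 < H := one_pos.trans_le hH
  -- The shared coordinate `l` stays at modulus `2 * L * n` along the chain, so every box of radius
  -- `L * n` used by Harnack lies in the annulus. As coordinates differ by at most `4 * L * n`, `4 *
  -- L` moves of size `n` reach `y`.
  have key : ∀ t : ℕ, G x ≤ H ^ t * G (moveToward x y (t * n)) := by
    intro t
    induction t with
    | zero =>
      have h0 : moveToward x y ((0 : ℕ) * n) = x := by
        ext j
        simp only [moveToward, Nat.cast_zero, zero_mul]
        omega
      rw [h0, pow_zero, one_mul]
    | succ t ih =>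
      refine ih.trans ?_
      rw [pow_succ, mul_assoc]
      refine mul_le_mul_of_nonneg_left ?_ (by positivity)
      have ht : (0 : ℤ) ≤ t * n := by positivity
      refine hHL G _ n hn (fun z hz => hG z ⟨l, ?_⟩ fun j => ?_) _ fun j => ?_
      · have h1 := hz l
        simp only [moveToward, ← hl, sub_self] at h1
        rw [min_eq_right ht, max_eq_right (by omega), add_zero] at h1
        have h2 := abs_sub_abs_le_abs_sub (x l) (z l)
        rw [abs_sub_comm] at h2
        omega
      · have h1 := hz j
        have h2 := hx j
        have h3 := hy j
        have h4 : |moveToward x y (t * n) j| ≤ 2 * (L * n) := by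
          simp only [moveToward]
          generalize (t : ℤ) * n = a at *
          rw [abs_le] at *
          omega
        have h5 := abs_sub_abs_le_abs_sub (z j) (moveToward x y (t * n) j)
        omega
      · simp only [moveToward]
        push_cast
        rw [add_mul, one_mul]
        generalize (t : ℤ) * n = a at *
        rw [abs_le]
        omega
  have he : moveToward x y ((4 * L : ℕ) * n) = y := by
    ext j
    have h2 := hx j
    have h3 := hy j
    simp only [moveToward]
    push_cast
    rw [mul_assoc]
    generalize (L : ℤ) * n = a at *
    rw [abs_le] at *
    omega
  have := key (4 * L)
  rwa [he] at this

/-- Harnack inequality on spheres for non-negative harmonic functions on an annulus. -/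
theorem exists_sphere_harnack (d : ℕ) (hd : 3 ≤ d) : ∃ (H : ℝ) (L : ℕ), 1 ≤ H ∧ 1 ≤ L ∧
    ∀ (G : (Fin d → ℤ) → ℝ) (n : ℕ), 1 ≤ n →
      (∀ y : Fin d → ℤ, (∃ j, L * n ≤ |y j|) → (∀ j, |y j| ≤ 3 * (L * n)) →
        0 ≤ G y ∧ HarmonicAt G y) →
      ∀ x y : Fin d → ℤ, (∀ j, |x j| ≤ 2 * (L * n)) → (∃ j, |x j| = 2 * (L * n)) →
        (∀ j, |y j| ≤ 2 * (L * n)) → (∃ j, |y j| = 2 * (L * n)) → G x ≤ H * G y := by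
  have : NeZero d := ⟨by omega⟩
  obtain ⟨H, L, hH, hL, hHL⟩ := exists_harnack d
  refine ⟨H ^ (4 * L) * (H ^ (4 * L) * H ^ (4 * L)), L, ?_, hL, ?_⟩
  · have := one_le_pow₀ (n := 4 * L) hH
    exact one_le_mul_of_one_le_of_one_le this (one_le_mul_of_one_le_of_one_le this this)
  intro G n hn hG x y hx ⟨j, hj⟩ hy ⟨k, hk⟩
  -- Here `3 ≤ d` enters: a third coordinate `l` can be raised to `2 * L * n` in both points. The
  -- chain runs from `x` to raised `x` (sharing `j`), to raised `y` (sharing `l`), to `y` (sharing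
  -- `k`).
  obtain ⟨l, hl⟩ : ∃ l, l ∉ ({j, k} : Finset (Fin d)) := by
    by_contra! h
    have h1 : Finset.univ ⊆ ({j, k} : Finset (Fin d)) := fun l _ => h l
    have h2 := (Finset.card_le_card h1).trans Finset.card_le_two
    rw [Finset.card_univ, Fintype.card_fin] at h2
    omega
  simp only [Finset.mem_insert, Finset.mem_singleton, not_or] at hl
  have hm : |(2 * (L * n) : ℤ)| = 2 * (L * n) := abs_of_nonneg (by positivity)
  have hbox : ∀ z : Fin d → ℤ, (∀ i, |z i| ≤ 2 * (L * n)) →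
      ∀ i, |Function.update z l (2 * (L * n) : ℤ) i| ≤ 2 * (L * n) := by
    intro z hz i
    by_cases hi : i = l
    · subst hi; simp [hm]
    · simpa [hi] using hz i
  have h1 := harnack_of_shared_coord hH hHL hn hG (l := j) hx (hbox x hx)
    (by rw [Function.update_of_ne (Ne.symm hl.1)]) hj
  have h2 := harnack_of_shared_coord hH hHL hn hG (l := l) (hbox x hx) (hbox y hy)
    (by simp) (by simp)
  have h3 := harnack_of_shared_coord hH hHL hn hG (l := k) (hbox y hy) hy
    (by rw [Function.update_of_ne (Ne.symm hl.2)])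
    (by rw [Function.update_of_ne (Ne.symm hl.2)]; exact hk)
  have hp : 0 ≤ H ^ (4 * L) := by positivity
  rw [mul_assoc, mul_assoc]
  exact h1.trans (mul_le_mul_of_nonneg_left (h2.trans (mul_le_mul_of_nonneg_left h3 hp)) hp)

end SphereHarnack

/-! ### Harnack inequality and decay of oscillation on the torus -/

section Torus

variable {d N : ℕ}

/-- Reduction modulo `N`. -/
def proj (N : ℕ) (z : Fin d → ℤ) : Fin d → ZMod N := fun i => (z i : ZMod N)

theorem proj_lift (x : Fin d → ZMod N) : proj N (lift x) = x := by
  ext i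
  simp [proj, lift]

theorem lift_proj_of_mem_Ioc [NeZero N] {z : Fin d → ℤ}
    (hz : ∀ i, z i * 2 ∈ Set.Ioc (-N : ℤ) N) : lift (proj N z) = z := by
  ext i
  exact (ZMod.valMinAbs_spec _ _).2 ⟨rfl, hz i⟩

theorem lift_proj [NeZero N] {z : Fin d → ℤ} (hz : ∀ i, 2 * |z i| < N) : lift (proj N z) = z :=
  lift_proj_of_mem_Ioc fun i => by
    have := hz i
    rcases abs_cases (z i) with h | h <;> constructor <;> omega

theorem proj_add_step (z : Fin d → ℤ) (u : Fin d × Bool) :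
    proj N (z + step ℤ u) = proj N z + step (ZMod N) u := by
  ext i
  by_cases h : i = u.1
  · subst h
    cases hu : u.2 <;> simp [proj, step, hu]
  · simp [proj, step, h]

theorem lift_add_step [NeZero N] {x : Fin d → ZMod N} {u : Fin d × Bool}
    (h : ∀ i, (lift x + step ℤ u : Fin d → ℤ) i * 2 ∈ Set.Ioc (-N : ℤ) N) :
    lift (x + step (ZMod N) u) = lift x + step ℤ u := by
  have := lift_proj_of_mem_Ioc h
  rwa [proj_add_step, proj_lift] at this

theorem lift_add_step_of_lt [NeZero N] {x : Fin d → ZMod N} (u : Fin d × Bool) {m : ℤ}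
    (hm : 2 * (m + 1) < N) (h : ∀ i, |lift x i| ≤ m) :
    lift (x + step (ZMod N) u) = lift x + step ℤ u :=
  lift_add_step fun i => by
    have h1 := h i
    have h2 := abs_step_le u i
    rw [abs_le] at h1 h2
    rw [Pi.add_apply]
    constructor <;> omega

theorem lift_mem_Ioc [NeZero N] (x : Fin d → ZMod N) (i : Fin d) :
    lift x i * 2 ∈ Set.Ioc (-N : ℤ) N := ZMod.valMinAbs_mem_Ioc _

theorem nbrSum_comp_proj (f : (Fin d → ZMod N) → ℝ) (z : Fin d → ℤ) :
    nbrSum (fun z => f (proj N z)) z = nbrSum f (proj N z) := by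
  simp [nbrSum, proj_add_step]

/-- The inverse step. -/
theorem step_add_step_not (R : Type*) [Ring R] (u : Fin d × Bool) :
    step R u + step R (u.1, !u.2) = 0 := by
  rcases u with ⟨i, b⟩
  cases b <;> simp [step, ← Pi.single_add]

/-- The `ℓ¹`-norm of the representative of `x` in `ℤ^d`. -/
def liftNorm (x : Fin d → ZMod N) : ℕ := (∑ j, |lift x j|).toNat

/-- Moving a coordinate towards `0` keeps the representative in `(-N/2, N/2]`, so nothing wraps
around. This makes `liftNorm` an admissible descent function for the minimum principle. -/
theorem exists_step_liftNorm_lt [NeZero N] {x : Fin d → ZMod N} (hx : lift x ≠ 0) :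
    ∃ u, liftNorm (x + step (ZMod N) u) < liftNorm x := by
  obtain ⟨u, -, hu, hu'⟩ := exists_step_toward_zero hx
  refine ⟨u, ?_⟩
  have hl : lift (x + step (ZMod N) u) = lift x + step ℤ u := lift_add_step fun j => by
    have h1 := hu' j
    have h2 := lift_mem_Ioc x j
    have hN : 0 < N := Nat.pos_of_ne_zero (NeZero.ne N)
    rw [Set.mem_Ioc] at h2 ⊢
    omega
  have h0 : 0 ≤ ∑ j, |(lift x + step ℤ u : Fin d → ℤ) j| :=
    Finset.sum_nonneg fun _ _ => abs_nonneg _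
  unfold liftNorm
  rw [hl, Int.toNat_lt_toNat (by omega)]
  omega

/-- The minimum principle for functions on the torus that are harmonic outside a box. -/
theorem torus_minimum_principle [NeZero N] {m : ℕ} (hm : 2 * m < N) {f : (Fin d → ZMod N) → ℝ}
    (hf : ∀ x : Fin d → ZMod N, (∃ i, (m : ℤ) < |lift x i|) → HarmonicAt f x) {c : ℝ}
    (hc : ∀ x : Fin d → ZMod N, (∀ i, |lift x i| ≤ m) → (∃ i, |lift x i| = m) → c ≤ f x)
    {x : Fin d → ZMod N} (hx : ∃ i, (m : ℤ) ≤ |lift x i|) : c ≤ f x := by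
  have key : ∀ x ∈ {x : Fin d → ZMod N | ∃ i, (m : ℤ) < |lift x i|}, 0 ≤ f x - c := by
    refine minimum_principle (Set.toFinite _) liftNorm ?_ ?_ ?_
    · rintro x ⟨i, hi⟩
      refine exists_step_liftNorm_lt fun h => ?_
      rw [h] at hi
      simp at hi
      omega
    · intro x hx
      exact ((hf x hx).sub_const c).le
    · rintro x ⟨i, hi⟩ u hu
      simp only [Set.mem_ofPred_eq, not_exists, not_lt] at hu
      refine sub_nonneg.2 (hc _ hu ?_)
      by_contra! hne
      have hlt : ∀ j, |lift (x + step (ZMod N) u) j| ≤ (m : ℤ) - 1 := fun j => by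
        have := hu j
        have := hne j
        omega
      have hl := lift_add_step_of_lt (N := N) (u.1, !u.2) (by omega) hlt
      rw [add_assoc, step_add_step_not, add_zero] at hl
      have h1 := hlt i
      have h2 := abs_step_le (u.1, !u.2) i
      rw [hl, Pi.add_apply] at hi
      have := abs_add_le (lift (x + step (ZMod N) u) i) (step ℤ (u.1, !u.2) i)
      omega
  by_cases h : ∃ i, (m : ℤ) < |lift x i|
  · exact sub_nonneg.1 (key x h)
  · push Not at h
    obtain ⟨i, hi⟩ := hx
    exact hc x h ⟨i, le_antisymm (h i) hi⟩

theorem harmonicAt_neg {R : Type*} [Ring R] {f : (Fin d → R) → ℝ} {x : Fin d → R}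
    (h : HarmonicAt f x) : HarmonicAt (fun y => -f y) x := by
  have := h.const_sub 0
  simpa using this

/-- Harnack inequality on the torus for functions that are harmonic outside a box. -/
theorem exists_torus_harnack (d : ℕ) (hd : 3 ≤ d) : ∃ (H : ℝ) (L : ℕ), 1 < H ∧ 1 ≤ L ∧
    ∀ (N : ℕ) [NeZero N] (f : (Fin d → ZMod N) → ℝ) (n : ℕ), 1 ≤ n → 8 * (L * n) ≤ N →
      (∀ x : Fin d → ZMod N, (∃ i, ((L * n : ℕ) : ℤ) ≤ |lift x i|) → 0 ≤ f x ∧ HarmonicAt f x) →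
      ∀ x y : Fin d → ZMod N, (∃ i, ((2 * (L * n) : ℕ) : ℤ) ≤ |lift x i|) →
        (∃ i, ((2 * (L * n) : ℕ) : ℤ) ≤ |lift y i|) → f x ≤ H * f y := by
  obtain ⟨H, L, hH, hL, hHL⟩ := exists_sphere_harnack d hd
  refine ⟨H + 1, L, by linarith, hL, ?_⟩
  intro N _ f n hn hN hf x y hx hy
  have hLn : 1 ≤ L * n := Nat.mul_pos hL hn
  have hf' : ∀ x : Fin d → ZMod N, (∃ i, ((2 * (L * n) : ℕ) : ℤ) < |lift x i|) →
      HarmonicAt f x := fun x ⟨i, hi⟩ => (hf x ⟨i, by push_cast at *; omega⟩).2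
  have hsphere : ∀ s t : Fin d → ZMod N, (∀ i, |lift s i| ≤ ((2 * (L * n) : ℕ) : ℤ)) →
      (∃ i, |lift s i| = ((2 * (L * n) : ℕ) : ℤ)) →
      (∀ i, |lift t i| ≤ ((2 * (L * n) : ℕ) : ℤ)) →
      (∃ i, |lift t i| = ((2 * (L * n) : ℕ) : ℤ)) → f s ≤ H * f t := by
    intro s t hs hs' ht ht'
    push_cast at hs hs' ht ht'
    have := hHL (fun z => f (proj N z)) n hn (fun z ⟨j, hj⟩ hz => by
      have hlp : lift (proj N z) = z := lift_proj fun i => by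
        have := hz i
        push_cast at *
        have : (8 * (L * n) : ℤ) ≤ N := by exact_mod_cast hN
        have : (1 : ℤ) ≤ L * n := by exact_mod_cast hLn
        omega
      have := hf (proj N z) ⟨j, by rw [hlp]; exact_mod_cast hj⟩
      exact ⟨this.1, by
        have := this.2
        unfold HarmonicAt at *
        rw [nbrSum_comp_proj, this]⟩) (lift s) (lift t) hs hs' ht ht'
    simpa only [proj_lift] using this
  have hm : 2 * (2 * (L * n)) < N := by omega
  have hH0 : 0 < H := by linarith
  have hfy : 0 ≤ f y := by
    obtain ⟨i, hi⟩ := hy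
    exact (hf y ⟨i, by push_cast at *; omega⟩).1
  -- The sphere inequality extends to the whole exterior by the minimum principle, first in `y` and
  -- then, applied to `-f`, in `x`.
  have h1 : ∀ s : Fin d → ZMod N, (∀ i, |lift s i| ≤ ((2 * (L * n) : ℕ) : ℤ)) →
      (∃ i, |lift s i| = ((2 * (L * n) : ℕ) : ℤ)) → f s ≤ H * f y := by
    intro s hs hs'
    have := torus_minimum_principle (c := f s / H) hm hf' (fun t ht ht' => by
      rw [div_le_iff₀ hH0, mul_comm]
      exact hsphere s t hs hs' ht ht') hy
    rwa [div_le_iff₀ hH0, mul_comm] at this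
  have h2 := torus_minimum_principle (f := fun z => -f z) (c := -(H * f y)) hm
    (fun z hz => harmonicAt_neg (hf' z hz)) (fun s hs hs' => neg_le_neg (h1 s hs hs')) hx
  linarith

/-- Geometric decay of oscillations on the torus: far from a box off which it is harmonic, a
non-negative function is almost constant. -/
theorem exists_torus_oscillation (d : ℕ) (hd : 3 ≤ d) : ∃ (H : ℝ) (L : ℕ), 1 < H ∧ 1 ≤ L ∧
    ∀ (N : ℕ) [NeZero N] (f : (Fin d → ZMod N) → ℝ) (n : ℕ), 1 ≤ n → (∀ x, 0 ≤ f x) →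
      (∀ x : Fin d → ZMod N, (∃ i, ((L * n : ℕ) : ℤ) ≤ |lift x i|) → HarmonicAt f x) →
      ∀ k : ℕ, 4 * (L * (2 ^ (k + 1) * n)) ≤ N → ∀ x y : Fin d → ZMod N,
        (∃ i, ((L * (2 ^ (k + 1) * n) : ℕ) : ℤ) ≤ |lift x i|) →
        (∃ i, ((L * (2 ^ (k + 1) * n) : ℕ) : ℤ) ≤ |lift y i|) →
        f x ≤ (1 + H * (1 - 1 / H) ^ k) * f y := by
  obtain ⟨H, L, hH, hL, hHL⟩ := exists_torus_harnack d hd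
  refine ⟨H, L, hH, hL, ?_⟩
  intro N _ f n hn hf hharm k hk x y hx hy
  have hH0 : 0 < H := by linarith
  have hθ : 0 ≤ 1 - 1 / H := by
    rw [sub_nonneg, div_le_one hH0]
    exact hH.le
  set D : ℕ → Set (Fin d → ZMod N) :=
    fun k => {x | ∃ i, ((L * (2 ^ k * n) : ℕ) : ℤ) ≤ |lift x i|} with hD
  have hmem : ∀ k x, x ∈ D k ↔ ∃ i, ((L * (2 ^ k * n) : ℕ) : ℤ) ≤ |lift x i| := fun _ _ => Iff.rfl
  have hanti : ∀ {j k : ℕ}, j ≤ k → D k ⊆ D j := by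
    rintro j k hjk z ⟨i, hi⟩
    refine ⟨i, le_trans ?_ hi⟩
    exact_mod_cast Nat.mul_le_mul_left L
      (Nat.mul_le_mul_right n (Nat.pow_le_pow_right (by norm_num) hjk))
  have hsucc : ∀ k, L * (2 ^ (k + 1) * n) = 2 * (L * (2 ^ k * n)) := fun k => by ring
  have hpos : ∀ k, 1 ≤ 2 ^ k * n := fun k => Nat.mul_pos (by positivity) hn
  have hharmD : ∀ k, ∀ x ∈ D k, HarmonicAt f x := fun k x hx => by
    have := hanti (Nat.zero_le k) hx
    simp only [hD, pow_zero, one_mul] at this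
    exact hharm x this
  -- The oscillation is measured in units of the minimum of `f` over `D 1`, so that the final bound
  -- is multiplicative.
  obtain ⟨x₁, hx₁, hmin⟩ := (D 1).toFinite.exists_minimalFor f (D 1) ⟨x, hanti (by omega) hx⟩
  have hmin' : ∀ z ∈ D 1, f x₁ ≤ f z := fun z hz => by
    by_contra! h
    exact absurd (hmin hz h.le) (not_le.2 h)
  have key : ∀ k, 4 * (L * (2 ^ (k + 1) * n)) ≤ N → ∀ x ∈ D (k + 1), ∀ y ∈ D (k + 1),
      f x - f y ≤ H * (1 - 1 / H) ^ k * f x₁ := by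
    intro k
    induction k with
    | zero =>
      intro hk x hx y hy
      have := hHL N f n hn (by rw [hsucc, pow_zero, one_mul] at hk; omega)
        (fun z hz => ⟨hf z, hharm z hz⟩) x x₁
        (by simpa only [hmem, hsucc, pow_zero, one_mul] using hx)
        (by simpa only [hmem, pow_one, mul_left_comm] using hx₁)
      rw [pow_zero, mul_one]
      linarith [hf y]
    | succ k ih =>
      intro hk x hx y hy
      have ih' := ih (by rw [hsucc (k + 1)] at hk; omega)
      obtain ⟨y₀, hy₀, hy₀min⟩ := (D (k + 1)).toFinite.exists_minimalFor f _
        ⟨x, hanti (by omega) hx⟩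
      -- Harnack for `f` minus its minimum over `D (k + 1)` contracts the oscillation by the factor
      -- `1 - 1 / H` on passing to `D (k + 2)`.
      have hG := hHL N (fun z => f z - f y₀) (2 ^ (k + 1) * n) (hpos _)
        (by rw [hsucc (k + 1)] at hk; omega) (fun z hz => ⟨by
          have hz' : z ∈ D (k + 1) := hz
          by_contra! h
          have h' : f z < f y₀ := by linarith
          exact absurd (hy₀min hz' h'.le) (not_le.2 h'), (hharmD (k + 1) z hz).sub_const _⟩)
        x y (by simpa only [hmem, hsucc (k + 1)] using hx)
        (by simpa only [hmem, hsucc (k + 1)] using hy)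
      have h1 := ih' x (hanti (by omega) hx) y₀ hy₀
      have h2 : (f x - f y₀) / H ≤ f y - f y₀ := by
        rw [div_le_iff₀ hH0]
        linarith
      have h3 : f x - f y ≤ (1 - 1 / H) * (f x - f y₀) := by
        rw [one_sub_mul, one_div_mul_eq_div]
        linarith
      refine h3.trans ((mul_le_mul_of_nonneg_left h1 hθ).trans (le_of_eq ?_))
      ring
  have h1 := key k hk x hx y hy
  have h2 := hmin' y (hanti (by omega) hy)
  have h3 : 0 ≤ H * (1 - 1 / H) ^ k := by positivity
  nlinarith [mul_le_mul_of_nonneg_left h2 h3]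

end Torus

/-! ### An explicit superharmonic function in dimension at least three -/

section Superharmonic

variable {d : ℕ}

theorem rpow_neg_quarter_le {b p : ℝ} (hb : 0 < b) (hp : 0 ≤ p) (h : 1 ≤ p ^ 4 * b) :
    b ^ (-(1 / 4) : ℝ) ≤ p := by
  have h1 : b⁻¹ ≤ p ^ 4 := by rw [inv_le_iff_one_le_mul₀ hb]; exact h
  calc b ^ (-(1 / 4) : ℝ) = (b⁻¹) ^ (1 / 4 : ℝ) := by
        rw [Real.inv_rpow hb.le, Real.rpow_neg hb.le]
    _ ≤ (p ^ 4) ^ (1 / 4 : ℝ) := Real.rpow_le_rpow (by positivity) h1 (by norm_num)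
    _ = p := by
        rw [← Real.rpow_natCast, ← Real.rpow_mul hp]
        norm_num

theorem le_rpow_neg_quarter {b p : ℝ} (hb : 0 < b) (hp : 0 ≤ p) (h : p ^ 4 * b ≤ 1) :
    p ≤ b ^ (-(1 / 4) : ℝ) := by
  have h1 : p ^ 4 ≤ b⁻¹ := by rw [← one_mul b⁻¹, le_mul_inv_iff₀ hb]; exact h
  calc p = (p ^ 4) ^ (1 / 4 : ℝ) := by
        rw [← Real.rpow_natCast, ← Real.rpow_mul hp]
        norm_num
    _ ≤ (b⁻¹) ^ (1 / 4 : ℝ) := Real.rpow_le_rpow (by positivity) h1 (by norm_num)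
    _ = b ^ (-(1 / 4) : ℝ) := by
        rw [Real.inv_rpow hb.le, Real.rpow_neg hb.le]

/-- The second Taylor coefficient is `5 / 32`; the slack up to `3 / 16` absorbs the higher-order
terms for `|τ| ≤ 1 / 32`. -/
theorem one_add_rpow_neg_quarter_le {τ : ℝ} (hτ : |τ| ≤ 1 / 32) :
    (1 + τ) ^ (-(1 / 4) : ℝ) ≤ 1 - τ / 4 + 3 / 16 * τ ^ 2 := by
  obtain ⟨h1, h2⟩ := abs_le.1 hτ
  have hsq := sq_nonneg τ
  refine rpow_neg_quarter_le (by linarith) (by nlinarith) ?_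
  have hp : 1 - τ / 2 + 55 / 128 * τ ^ 2 ≤ (1 - τ / 4 + 3 / 16 * τ ^ 2) ^ 2 := by
    nlinarith [mul_nonneg hsq (by linarith : (0 : ℝ) ≤ 1 / 32 - τ), sq_nonneg (τ ^ 2)]
  have hq : 1 - τ + 35 / 32 * τ ^ 2 ≤ (1 - τ / 2 + 55 / 128 * τ ^ 2) ^ 2 := by
    nlinarith [mul_nonneg hsq (by linarith : (0 : ℝ) ≤ 1 / 32 - τ), sq_nonneg (τ ^ 2)]
  have h0 : 0 ≤ 1 - τ / 2 + 55 / 128 * τ ^ 2 := by nlinarith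
  have hr : 1 - τ + 35 / 32 * τ ^ 2 ≤ (1 - τ / 4 + 3 / 16 * τ ^ 2) ^ 4 := by
    calc _ ≤ _ := hq
      _ ≤ ((1 - τ / 4 + 3 / 16 * τ ^ 2) ^ 2) ^ 2 := by gcongr
      _ = _ := by ring1
  have h3 : 1 ≤ (1 - τ + 35 / 32 * τ ^ 2) * (1 + τ) := by
    nlinarith [mul_nonneg hsq (by linarith : (0 : ℝ) ≤ 1 / 32 + τ)]
  exact h3.trans (mul_le_mul_of_nonneg_right hr (by linarith))

theorem le_one_sub_rpow_neg_quarter {x : ℝ} (h0 : 0 ≤ x) (h1 : x < 1) :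
    1 + x / 4 ≤ (1 - x) ^ (-(1 / 4) : ℝ) := by
  refine le_rpow_neg_quarter (by linarith) (by linarith) ?_
  have hb : (1 + x / 4) ^ 4 * (1 - x) = 1 - (5 / 8 * x ^ 2 + 5 / 16 * x ^ 3 + 15 / 256 * x ^ 4
      + x ^ 5 / 256) := by ring1
  rw [hb]
  have : 0 ≤ 5 / 8 * x ^ 2 + 5 / 16 * x ^ 3 + 15 / 256 * x ^ 4 + x ^ 5 / 256 := by positivity
  linarith

/-- A positive superharmonic function on `ℤ^d`, `d ≥ 3`, that vanishes at infinity. -/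
noncomputable def superharmonicFn (y : Fin d → ℤ) : ℝ := (normSq y + 1023) ^ (-(1 / 4) : ℝ)

theorem superharmonicFn_pos (y : Fin d → ℤ) : 0 < superharmonicFn y :=
  Real.rpow_pos_of_pos (by have := normSq_nonneg y; linarith) _

/-- With `V = normSq y + 1024` the base of the power is `V ± 2 * y i` at the neighbours and `V - 1`
at `y`. Relative to `V ^ (-1/4)`, the second-order terms at the neighbours add at most `(3 / 2) /
V`, while the centre gains at least `(d / 2) / V`; this is where `3 ≤ d` is needed. -/
theorem nbrSum_superharmonicFn_le (hd : 3 ≤ d) (y : Fin d → ℤ) :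
    nbrSum superharmonicFn y ≤ 2 * d * superharmonicFn y := by
  have hd' : (3 : ℝ) ≤ d := by exact_mod_cast hd
  have hQ := normSq_nonneg y
  set V : ℝ := normSq y + 1024 with hV
  have hV0 : 0 < V := by linarith
  have hterm : ∀ i, superharmonicFn (y + Pi.single i 1) + superharmonicFn (y - Pi.single i 1) ≤
      V ^ (-(1 / 4) : ℝ) * (2 + 3 / 8 * (2 * y i / V) ^ 2) := by
    intro i
    -- The shift `1024 = 32 ^ 2` is chosen for this: `64 * |y i| ≤ (y i) ^ 2 + 1024`.
    have hτ : |2 * y i / V| ≤ 1 / 32 := by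
      rw [abs_div, abs_of_pos hV0, div_le_iff₀ hV0, abs_mul, abs_two]
      have := sq_le_normSq y i
      rw [← sq_abs] at this
      nlinarith [sq_nonneg (|(y i : ℝ)| - 32)]
    obtain ⟨h1, h2⟩ := abs_le.1 hτ
    have e1 : normSq (y + Pi.single i 1) + 1023 = V * (1 + 2 * y i / V) := by
      rw [normSq_add_single, mul_add, mul_div_cancel₀ _ hV0.ne', hV]
      push_cast
      ring1
    have e2 : normSq (y - Pi.single i 1) + 1023 = V * (1 + -(2 * y i / V)) := by
      rw [normSq_sub_single, mul_add, mul_neg, mul_div_cancel₀ _ hV0.ne', hV]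
      ring1
    have h3 := one_add_rpow_neg_quarter_le hτ
    have h4 := one_add_rpow_neg_quarter_le (τ := -(2 * y i / V)) (by rwa [abs_neg])
    rw [superharmonicFn, superharmonicFn, e1, e2, Real.mul_rpow hV0.le (by linarith),
      Real.mul_rpow hV0.le (by linarith), ← mul_add]
    refine mul_le_mul_of_nonneg_left ?_ (Real.rpow_nonneg hV0.le _)
    rw [neg_sq] at h4
    linarith
  have hs : superharmonicFn y = V ^ (-(1 / 4) : ℝ) * (1 - 1 / V) ^ (-(1 / 4) : ℝ) := by
    have h1 : 1 / V < 1 := by rw [div_lt_one hV0]; linarith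
    rw [← Real.mul_rpow hV0.le (by linarith), superharmonicFn, mul_sub,
      mul_div_cancel₀ _ hV0.ne', hV]
    ring_nf
  have h5 := le_one_sub_rpow_neg_quarter (x := 1 / V) (by positivity)
    (by rw [div_lt_one hV0]; linarith)
  rw [nbrSum_eq, hs]
  refine (Finset.sum_le_sum fun i _ => hterm i).trans ?_
  rw [← Finset.mul_sum, mul_left_comm]
  refine mul_le_mul_of_nonneg_left ?_ (Real.rpow_nonneg hV0.le _)
  rw [Finset.sum_add_distrib, ← Finset.mul_sum]
  have hsq : ∑ i, (2 * (y i : ℝ) / V) ^ 2 = 4 * normSq y / V ^ 2 := by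
    rw [normSq, Finset.mul_sum, Finset.sum_div]
    exact Finset.sum_congr rfl fun _ _ => by rw [div_pow]; ring1
  have hle : 4 * normSq y / V ^ 2 ≤ 4 * (1 / V) := by
    rw [div_le_iff₀ (by positivity)]
    have : 4 * (1 / V) * V ^ 2 = 4 * V := by field_simp
    rw [this]
    linarith
  simp only [Finset.sum_const, Finset.card_univ, Fintype.card_fin, nsmul_eq_mul]
  rw [hsq]
  have h6 : 0 < 1 / V := by positivity
  nlinarith [mul_le_mul_of_nonneg_left h5 (by linarith : (0 : ℝ) ≤ 2 * d)]

end Superharmonic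

/-! ### Hitting probabilities of the discrete-time walk -/

section StepSequences

variable {d : ℕ} {R : Type*} [Ring R]

/-- The law of the sequence of steps of the walk. -/
noncomputable def stepMeasure (d : ℕ) : Measure (ℕ → Fin d × Bool) :=
  Measure.infinitePi fun _ : ℕ => uniformOn (Set.univ : Set (Fin d × Bool))

/-- The discrete-time walk as a function of the sequence of steps. -/
def walk (x : Fin d → R) (s : ℕ → Fin d × Bool) (n : ℕ) : Fin d → R :=
  x + ∑ k ∈ Finset.range n, step R (s k)

/-- Put the step `u` before the steps `s`. -/
def consSeq {α : Type*} (u : α) (s : ℕ → α) : ℕ → α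
  | 0 => u
  | n + 1 => s n

theorem walk_zero (x : Fin d → R) (s : ℕ → Fin d × Bool) : walk x s 0 = x := by simp [walk]

theorem walk_consSeq_succ (x : Fin d → R) (u : Fin d × Bool) (s : ℕ → Fin d × Bool) (n : ℕ) :
    walk x (consSeq u s) (n + 1) = walk (x + step R u) s n := by
  simp only [walk, Finset.sum_range_succ', consSeq]
  abel

instance [NeZero d] : IsProbabilityMeasure (stepMeasure d) := by
  unfold stepMeasure
  infer_instance

theorem measurable_consSeq {α : Type*} [MeasurableSpace α] :
    Measurable fun p : α × (ℕ → α) => consSeq p.1 p.2 := by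
  refine measurable_pi_lambda _ fun n => ?_
  cases n with
  | zero => exact measurable_fst
  | succ n => exact (measurable_pi_apply n).comp measurable_snd

/-- Prepending an independent entry to an i.i.d. sequence preserves its law, as seen on finite
cylinders: coordinate `0` constrains the new entry, coordinate `n + 1` the old entry `n`. All
first-step analysis rests on this. -/
theorem map_consSeq_prod_infinitePi {α : Type*} [MeasurableSpace α] (μ : Measure α)
    [IsProbabilityMeasure μ] :
    (μ.prod (Measure.infinitePi fun _ : ℕ => μ)).map (fun p => consSeq p.1 p.2) =
      Measure.infinitePi fun _ : ℕ => μ := by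
  refine Measure.eq_infinitePi _ fun s t ht => ?_
  rw [Measure.map_apply measurable_consSeq
    (MeasurableSet.pi s.countable_toSet fun i _ => ht i)]
  classical
  set t' : ℕ → Set α := fun n => if n ∈ s then t n else Set.univ with ht'
  have ht'm : ∀ n, MeasurableSet (t' n) := fun n => by
    simp only [ht']
    split_ifs
    exacts [ht n, MeasurableSet.univ]
  obtain ⟨K, hK⟩ : ∃ K, s ⊆ Finset.range (K + 1) :=
    ⟨s.sup id, fun n hn => Finset.mem_range.2 (Nat.lt_succ_of_le (Finset.le_sup (f := id) hn))⟩
  have hpre : (fun p : α × (ℕ → α) => consSeq p.1 p.2) ⁻¹' (Set.pi s t) =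
      (t' 0) ×ˢ (Set.pi (Finset.range K) fun n => t' (n + 1)) := by
    ext ⟨u, f⟩
    simp only [Set.mem_preimage, Set.mem_pi, Finset.mem_coe, Set.mem_prod, Finset.mem_range]
    constructor
    · intro h
      refine ⟨?_, fun n _ => ?_⟩
      · simp only [ht']
        split_ifs with h0
        exacts [h 0 h0, trivial]
      · simp only [ht']
        split_ifs with h0
        exacts [h (n + 1) h0, trivial]
    · rintro ⟨h0, h1⟩ n hn
      have hnK := Finset.mem_range.1 (hK hn)
      cases n with
      | zero => simpa [ht', hn, consSeq] using h0
      | succ n => simpa [ht', hn, consSeq] using h1 n (by omega)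
  rw [hpre, Measure.prod_prod, Measure.infinitePi_pi _ (fun n _ => ht'm (n + 1)), mul_comm,
    ← Finset.prod_range_succ' (fun n => μ (t' n)), ← Finset.prod_subset hK]
  · exact Finset.prod_congr rfl fun n hn => by simp [ht', hn]
  · intro n _ hn
    simp [ht', hn]

theorem uniformOn_univ_singleton (u : Fin d × Bool) :
    uniformOn (Set.univ : Set (Fin d × Bool)) {u} = ((2 * d : ℕ) : ℝ≥0∞)⁻¹ := by
  rw [uniformOn_univ, Measure.count_singleton, Fintype.card_prod, Fintype.card_fin,
    Fintype.card_bool, mul_comm d 2, one_div]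

/-- The Markov property at the first step. -/
theorem stepMeasure_real_eq_sum [NeZero d] {E : Set (ℕ → Fin d × Bool)} (hE : MeasurableSet E) :
    2 * d * (stepMeasure d).real E =
      ∑ u : Fin d × Bool, (stepMeasure d).real {s | consSeq u s ∈ E} := by
  have hd : (d : ℝ) ≠ 0 := by exact_mod_cast NeZero.ne d
  have h1 : stepMeasure d E =
      ∑ u : Fin d × Bool, stepMeasure d {s | consSeq u s ∈ E} * ((2 * d : ℕ) : ℝ≥0∞)⁻¹ := by
    have hmap := map_consSeq_prod_infinitePi (uniformOn (Set.univ : Set (Fin d × Bool)))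
    conv_lhs => rw [stepMeasure, ← hmap, Measure.map_apply measurable_consSeq hE,
      Measure.prod_apply (measurable_consSeq hE), lintegral_fintype]
    refine Finset.sum_congr rfl fun u _ => ?_
    rw [uniformOn_univ_singleton]
    rfl
  have h2 : (stepMeasure d).real E = ∑ u : Fin d × Bool,
      (stepMeasure d).real {s | consSeq u s ∈ E} * (2 * d : ℝ)⁻¹ := by
    rw [measureReal_def, h1, ENNReal.toReal_sum]
    · refine Finset.sum_congr rfl fun u _ => ?_
      rw [ENNReal.toReal_mul, ENNReal.toReal_inv, measureReal_def]
      simp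
    · intro u _
      refine ENNReal.mul_ne_top (measure_ne_top _ _) (ENNReal.inv_ne_top.2 ?_)
      exact_mod_cast mul_ne_zero two_ne_zero (NeZero.ne d)
  rw [h2, ← Finset.sum_mul]
  field_simp

theorem measurableSet_walk_mem (x : Fin d → R) (n : ℕ) (S : Set (Fin d → R)) :
    MeasurableSet {s : ℕ → Fin d × Bool | walk x s n ∈ S} := by
  have h : {s : ℕ → Fin d × Bool | walk x s n ∈ S} =
      (fun (s : ℕ → Fin d × Bool) (k : Fin n) => s k) ⁻¹'
        {f | x + ∑ k : Fin n, step R (f k) ∈ S} := by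
    ext s
    simp only [Set.mem_ofPred_eq, Set.mem_preimage, walk, Finset.sum_range]
  rw [h]
  exact (measurable_pi_lambda _ fun k : Fin n => measurable_pi_apply (k : ℕ))
    (Set.toFinite _).measurableSet

/-- The walk started at `x` visits `W` no later than the first visit to `V`. -/
def hitSet (V W : Set (Fin d → R)) (x : Fin d → R) : Set (ℕ → Fin d × Bool) :=
  {s | ∃ n, walk x s n ∈ W ∧ ∀ k < n, walk x s k ∉ V}

/-- The probability that the walk started at `x` visits `W` no later than the first visit
to `V`. -/
noncomputable def hitProb (V W : Set (Fin d → R)) (x : Fin d → R) : ℝ :=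
  (stepMeasure d).real (hitSet V W x)

theorem measurableSet_hitSet (V W : Set (Fin d → R)) (x : Fin d → R) :
    MeasurableSet (hitSet V W x) := by
  have : hitSet V W x = ⋃ n, {s | walk x s n ∈ W} ∩ ⋂ k, ⋂ (_ : k < n), {s | walk x s k ∈ Vᶜ} := by
    ext s
    simp [hitSet]
  rw [this]
  exact .iUnion fun n => (measurableSet_walk_mem x n W).inter
    (.iInter fun k => .iInter fun _ => measurableSet_walk_mem x k Vᶜ)

theorem hitProb_nonneg (V W : Set (Fin d → R)) (x : Fin d → R) : 0 ≤ hitProb V W x :=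
  measureReal_nonneg

theorem hitProb_of_mem_of_notMem {V W : Set (Fin d → R)} {x : Fin d → R} (hV : x ∈ V)
    (hW : x ∉ W) : hitProb V W x = 0 := by
  have : hitSet V W x = ∅ := by
    refine Set.eq_empty_of_forall_notMem ?_
    rintro s ⟨n, hn, hk⟩
    cases n with
    | zero => rw [walk_zero] at hn; exact hW hn
    | succ n => exact hk 0 n.succ_pos (by rwa [walk_zero])
  rw [hitProb, this, measureReal_empty]

theorem mem_hitSet_self_iff {V : Set (Fin d → R)} {x : Fin d → R} {s : ℕ → Fin d × Bool} :
    s ∈ hitSet V V x ↔ ∃ n, walk x s n ∈ V := by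
  classical
  refine ⟨fun ⟨n, hn, _⟩ => ⟨n, hn⟩, fun h => ⟨Nat.find h, Nat.find_spec h, fun k hk => ?_⟩⟩
  exact Nat.find_min h hk

variable [NeZero d]

theorem hitProb_le_one (V W : Set (Fin d → R)) (x : Fin d → R) : hitProb V W x ≤ 1 :=
  measureReal_le_one

theorem hitProb_of_mem {V W : Set (Fin d → R)} {x : Fin d → R} (hW : x ∈ W) :
    hitProb V W x = 1 := by
  have : hitSet V W x = Set.univ :=
    Set.eq_univ_of_forall fun s => ⟨0, by rwa [walk_zero], by simp⟩
  rw [hitProb, this, probReal_univ]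

theorem harmonicAt_hitProb {V W : Set (Fin d → R)} {x : Fin d → R} (hV : x ∉ V)
    (hW : x ∉ W) : HarmonicAt (hitProb V W) x := by
  rw [HarmonicAt, hitProb, stepMeasure_real_eq_sum (measurableSet_hitSet V W x), nbrSum]
  refine Finset.sum_congr rfl fun u _ => ?_
  rw [hitProb]
  congr 1
  ext s
  constructor
  · rintro ⟨n, hn, hk⟩
    refine ⟨n + 1, by rwa [walk_consSeq_succ], fun k hkn => ?_⟩
    cases k with
    | zero => rwa [walk_zero]
    | succ k => rw [walk_consSeq_succ]; exact hk k (by omega)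
  · rintro ⟨n, hn, hk⟩
    cases n with
    | zero => rw [walk_zero] at hn; exact absurd hn hW
    | succ n =>
      rw [walk_consSeq_succ] at hn
      exact ⟨n, hn, fun k hkn => by
        have := hk (k + 1) (by omega)
        rwa [walk_consSeq_succ] at this⟩

/-- The hitting probability of `V` is the least non-negative function that is superharmonic off
`V` and at least `1` on `V`. -/
theorem hitProb_le_of_superharmonic {V : Set (Fin d → R)} {F : (Fin d → R) → ℝ}
    (h0 : ∀ x, 0 ≤ F x) (h1 : ∀ x ∈ V, 1 ≤ F x) (hF : ∀ x ∉ V, nbrSum F x ≤ 2 * d * F x)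
    (x : Fin d → R) : hitProb V V x ≤ F x := by
  have hd : (0 : ℝ) < 2 * d := by
    have : (0 : ℝ) < d := by exact_mod_cast Nat.pos_of_ne_zero (NeZero.ne d)
    positivity
  -- The bound is proved by induction for visits up to time `n`, conditioning on the first step, and
  -- then `n` tends to infinity.
  set E : ℕ → (Fin d → R) → Set (ℕ → Fin d × Bool) :=
    fun n x => {s | ∃ m ≤ n, walk x s m ∈ V} with hE
  have hEm : ∀ n x, MeasurableSet (E n x) := fun n x => by
    have : E n x = ⋃ m, ⋃ (_ : m ≤ n), {s | walk x s m ∈ V} := by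
      ext s
      simp [hE]
    rw [this]
    exact .iUnion fun m => .iUnion fun _ => measurableSet_walk_mem x m V
  have key : ∀ n x, (stepMeasure d).real (E n x) ≤ F x := by
    intro n
    induction n with
    | zero =>
      intro x
      by_cases hx : x ∈ V
      · exact measureReal_le_one.trans (h1 x hx)
      · have : E 0 x = ∅ := by
          ext s
          simp [hE, walk_zero, hx]
        rw [this, measureReal_empty]
        exact h0 x
    | succ n ih =>
      intro x
      by_cases hx : x ∈ V
      · exact measureReal_le_one.trans (h1 x hx)
      · have h2 : 2 * d * (stepMeasure d).real (E (n + 1) x) ≤ 2 * d * F x := by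
          rw [stepMeasure_real_eq_sum (hEm _ _)]
          refine (Finset.sum_le_sum fun u _ => ?_).trans (hF x hx)
          refine le_trans (le_of_eq ?_) (ih (x + step R u))
          congr 1
          ext s
          constructor
          · rintro ⟨m, hm, hmV⟩
            cases m with
            | zero => rw [walk_zero] at hmV; exact absurd hmV hx
            | succ m => exact ⟨m, by omega, by rwa [walk_consSeq_succ] at hmV⟩
          · rintro ⟨m, hm, hmV⟩
            exact ⟨m + 1, by omega, by rwa [walk_consSeq_succ]⟩
        exact le_of_mul_le_mul_left h2 hd
  have hU : hitSet V V x = ⋃ n, E n x := by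
    ext s
    rw [mem_hitSet_self_iff, Set.mem_iUnion]
    exact ⟨fun ⟨n, hn⟩ => ⟨n, n, le_rfl, hn⟩, fun ⟨_, m, _, hm⟩ => ⟨m, hm⟩⟩
  have hmono : Monotone fun n => E n x := fun m n hmn s ⟨k, hk, hkV⟩ => ⟨k, hk.trans hmn, hkV⟩
  have hlim := tendsto_measure_iUnion_atTop (μ := stepMeasure d) hmono
  have hlim' := (ENNReal.tendsto_toReal (measure_ne_top _ _)).comp hlim
  rw [hitProb, hU]
  exact le_of_tendsto' hlim' fun n => key n x

/-- The probability of never visiting `V` after the first step. -/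
theorem stepMeasure_real_escape (V : Set (Fin d → R)) (x : Fin d → R) :
    2 * d * (stepMeasure d).real {s | ∀ n, walk x s (n + 1) ∉ V} =
      2 * d - nbrSum (hitProb V V) x := by
  have hm : MeasurableSet {s : ℕ → Fin d × Bool | ∀ n, walk x s (n + 1) ∉ V} := by
    have : {s : ℕ → Fin d × Bool | ∀ n, walk x s (n + 1) ∉ V} =
        ⋂ n, {s | walk x s (n + 1) ∈ Vᶜ} := by
      ext s
      simp
    rw [this]
    exact .iInter fun n => measurableSet_walk_mem x (n + 1) Vᶜ
  have h1 : (2 * d : ℝ) = nbrSum (fun _ : Fin d → R => 1) x := by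
    rw [nbrSum_const, mul_one]
  rw [stepMeasure_real_eq_sum hm]
  conv_rhs => rw [h1, ← nbrSum_sub]
  refine Finset.sum_congr rfl fun u _ => ?_
  change _ = 1 - (stepMeasure d).real (hitSet V V (x + step R u))
  rw [← probReal_compl_eq_one_sub (measurableSet_hitSet _ _ _)]
  congr 1
  ext s
  rw [Set.mem_compl_iff, mem_hitSet_self_iff]
  simp [walk_consSeq_succ]

end StepSequences

/-! ### Almost sure properties of the holding times -/

section HoldingTimes

/-- Sequences of holding times that are positive and exceed `1` infinitely often. -/
def goodHoldingTimes : Set (ℕ → ℝ) := {h | (∀ n, 0 < h n) ∧ ∀ m, ∃ n ≥ m, 1 < h n}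

theorem expMeasure_one_Iic (x : ℝ) (hx : 0 ≤ x) :
    expMeasure 1 (Set.Iic x) = ENNReal.ofReal (1 - Real.exp (-x)) := by
  have : IsProbabilityMeasure (expMeasure 1) := isProbabilityMeasure_expMeasure one_pos
  have h := cdf_expMeasure_eq one_pos x
  rw [cdf_eq_real, if_pos hx, one_mul] at h
  rw [← h, ofReal_measureReal]

/-- Infinitely many holding times above `1` rule out explosion. They occur almost surely, since `K`
consecutive holding times are all at most `1` with probability `p ^ K` for some `p < 1`. -/
theorem ae_goodHoldingTimes :
    ∀ᵐ h ∂(Measure.infinitePi fun _ : ℕ => expMeasure 1), h ∈ goodHoldingTimes := by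
  have : IsProbabilityMeasure (expMeasure 1) := isProbabilityMeasure_expMeasure one_pos
  have h1 : ∀ᵐ h ∂(Measure.infinitePi fun _ : ℕ => expMeasure 1), ∀ n, 0 < h n := by
    refine ae_all_iff.2 fun n => ?_
    have hmp := measurePreserving_eval_infinitePi (fun _ : ℕ => expMeasure 1) n
    refine hmp.quasiMeasurePreserving.ae (p := fun t : ℝ => 0 < t) ?_
    rw [ae_iff]
    have : {a : ℝ | ¬0 < a} = Set.Iic 0 := by
      ext a
      simp
    rw [this, expMeasure_one_Iic 0 le_rfl]
    simp
  have h2 : ∀ᵐ h ∂(Measure.infinitePi fun _ : ℕ => expMeasure 1), ∀ m, ∃ n ≥ m, 1 < h n := by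
    refine ae_all_iff.2 fun m => ?_
    rw [ae_iff]
    set p : ℝ≥0∞ := expMeasure 1 (Set.Iic 1) with hp
    have hp1 : p < 1 := by
      rw [hp, expMeasure_one_Iic 1 zero_le_one, ENNReal.ofReal_lt_one]
      linarith [Real.exp_pos (-1)]
    have hle : ∀ K : ℕ, Measure.infinitePi (fun _ : ℕ => expMeasure 1)
        {h | ¬∃ n ≥ m, 1 < h n} ≤ p ^ K := by
      intro K
      have hbox := Measure.infinitePi_pi (fun _ : ℕ => expMeasure 1)
        (s := Finset.Ico m (m + K)) (t := fun _ => Set.Iic (1 : ℝ)) fun _ _ => measurableSet_Iic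
      rw [Finset.prod_const, Nat.card_Ico, Nat.add_sub_cancel_left] at hbox
      rw [hp, ← hbox]
      refine measure_mono fun h hh n hn => ?_
      simp only [Set.mem_ofPred_eq, not_exists, not_and, not_lt] at hh
      exact hh n (Finset.mem_Ico.1 hn).1
    have hlim := ENNReal.tendsto_pow_atTop_nhds_zero_of_lt_one hp1
    exact le_antisymm (ge_of_tendsto' hlim hle) zero_le
  filter_upwards [h1, h2] with h h1 h2 using ⟨h1, h2⟩

end HoldingTimes

/-! ### Reduction from continuous to discrete time -/

section ContinuousTime

variable {d : ℕ} {R : Type*} [Ring R]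

theorem jumpTime_succ (ω : Sample d) (n : ℕ) :
    jumpTime ω (n + 1) = jumpTime ω n + (ω.2 n).toNNReal := by
  simp [jumpTime, Finset.sum_range_succ]

theorem strictMono_jumpTime {ω : Sample d} (hω : ω.2 ∈ goodHoldingTimes) :
    StrictMono (jumpTime ω) :=
  strictMono_nat_of_lt_succ fun n => by
    rw [jumpTime_succ]
    exact lt_add_of_pos_right _ (Real.toNNReal_pos.2 (hω.1 n))

theorem exists_lt_jumpTime {ω : Sample d} (hω : ω.2 ∈ goodHoldingTimes) (t : ℝ≥0) :
    ∃ n, t < jumpTime ω n := by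
  have key : ∀ T : ℕ, ∃ n, (T : ℝ≥0) ≤ jumpTime ω n := by
    intro T
    induction T with
    | zero => exact ⟨0, by simp⟩
    | succ T ih =>
      obtain ⟨n, hn⟩ := ih
      obtain ⟨k, hk, hk1⟩ := hω.2 n
      refine ⟨k + 1, ?_⟩
      rw [jumpTime_succ]
      push_cast
      refine add_le_add (hn.trans ((strictMono_jumpTime hω).monotone hk)) ?_
      rw [← Real.toNNReal_one]
      exact Real.toNNReal_le_toNNReal hk1.le
  obtain ⟨T, hT⟩ := exists_nat_gt t
  obtain ⟨n, hn⟩ := key T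
  exact ⟨n, hT.trans_le hn⟩

theorem jumpCount_eq {ω : Sample d} (hω : ω.2 ∈ goodHoldingTimes) {t : ℝ≥0} {n : ℕ}
    (h1 : jumpTime ω n ≤ t) (h2 : t < jumpTime ω (n + 1)) : jumpCount ω t = n := by
  have : {k : ℕ | jumpTime ω (k + 1) ≤ t} = Set.Iio n := by
    ext k
    simp only [Set.mem_ofPred_eq, Set.mem_Iio]
    constructor
    · intro hk
      have := (strictMono_jumpTime hω).lt_iff_lt.1 (hk.trans_lt h2)
      omega
    · intro hk
      exact ((strictMono_jumpTime hω).monotone (by omega)).trans h1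
  rw [jumpCount, this, Set.ncard_eq_toFinset_card']
  simp

theorem jumpCount_jumpTime {ω : Sample d} (hω : ω.2 ∈ goodHoldingTimes) (n : ℕ) :
    jumpCount ω (jumpTime ω n) = n :=
  jumpCount_eq hω le_rfl (strictMono_jumpTime hω n.lt_succ_self)

theorem exists_jumpTime_le_lt {ω : Sample d} (hω : ω.2 ∈ goodHoldingTimes) (t : ℝ≥0) :
    ∃ n, jumpTime ω n ≤ t ∧ t < jumpTime ω (n + 1) := by
  classical
  have h := exists_lt_jumpTime hω t
  have h0 : Nat.find h ≠ 0 := fun h0 => by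
    have := Nat.find_spec h
    rw [h0] at this
    simp [jumpTime] at this
  obtain ⟨n, hn⟩ := Nat.exists_eq_succ_of_ne_zero h0
  refine ⟨n, not_lt.1 (Nat.find_min h (by omega)), ?_⟩
  have := Nat.find_spec h
  rwa [hn] at this

theorem jumpTime_jumpCount_le {ω : Sample d} (hω : ω.2 ∈ goodHoldingTimes) (t : ℝ≥0) :
    jumpTime ω (jumpCount ω t) ≤ t := by
  obtain ⟨n, h1, h2⟩ := exists_jumpTime_le_lt hω t
  rwa [jumpCount_eq hω h1 h2]

theorem Y_eq_walk (x : Fin d → R) (ω : Sample d) (t : ℝ≥0) :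
    Y x ω t = walk x ω.1 (jumpCount ω t) := rfl

theorem entranceTime_eq_jumpTime {V : Set (Fin d → R)} {x : Fin d → R} {ω : Sample d}
    (hω : ω.2 ∈ goodHoldingTimes) {n : ℕ} (hn : walk x ω.1 n ∈ V)
    (hk : ∀ k < n, walk x ω.1 k ∉ V) : entranceTime V (Y x ω) = (jumpTime ω n : ℝ≥0∞) := by
  refine le_antisymm (iInf₂_le _ ?_) (le_iInf₂ fun t ht => ?_)
  · rwa [Y_eq_walk, jumpCount_jumpTime hω]
  · rw [Y_eq_walk] at ht
    have h1 : n ≤ jumpCount ω t := by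
      by_contra! h
      exact hk _ h ht
    exact_mod_cast ((strictMono_jumpTime hω).monotone h1).trans (jumpTime_jumpCount_le hω t)

theorem entrance_iff {V : Set (Fin d → R)} {x z : Fin d → R} (hz : z ∈ V) {ω : Sample d}
    (hω : ω.2 ∈ goodHoldingTimes) :
    (∃ t : ℝ≥0, entranceTime V (Y x ω) = (t : ℝ≥0∞) ∧ Y x ω t = z) ↔ ω.1 ∈ hitSet V {z} x := by
  constructor
  · rintro ⟨t, ht, hY⟩
    obtain ⟨n, hn, hk⟩ : ω.1 ∈ hitSet V V x := mem_hitSet_self_iff.2 ⟨_, by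
      rw [Y_eq_walk] at hY
      rw [hY]
      exact hz⟩
    rw [entranceTime_eq_jumpTime hω hn hk] at ht
    have ht' : jumpTime ω n = t := by exact_mod_cast ht
    refine ⟨n, ?_, hk⟩
    rw [← hY, Y_eq_walk, ← ht', jumpCount_jumpTime hω]
    rfl
  · rintro ⟨n, hn, hk⟩
    have hn' : walk x ω.1 n = z := hn
    refine ⟨jumpTime ω n, entranceTime_eq_jumpTime hω (by rwa [hn']) hk, ?_⟩
    rw [Y_eq_walk, jumpCount_jumpTime hω, hn']

theorem hittingTime_eq_top_iff {V : Set (Fin d → R)} {x : Fin d → R} {ω : Sample d}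
    (hω : ω.2 ∈ goodHoldingTimes) :
    hittingTime V x ω = ∞ ↔ ∀ n, walk x ω.1 (n + 1) ∉ V := by
  rw [hittingTime, ENNReal.add_eq_top, or_iff_left ENNReal.coe_ne_top]
  constructor
  · intro h n hn
    have h1 : jumpTime ω 1 ≤ jumpTime ω (n + 1) := (strictMono_jumpTime hω).monotone (by omega)
    have h2 : entranceTime V (fun t => Y x ω (jumpTime ω 1 + t)) ≤
        ((jumpTime ω (n + 1) - jumpTime ω 1 : ℝ≥0) : ℝ≥0∞) := by
      refine iInf₂_le _ ?_
      simp only [add_tsub_cancel_of_le h1]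
      rwa [Y_eq_walk, jumpCount_jumpTime hω]
    rw [h, top_le_iff] at h2
    exact ENNReal.coe_ne_top h2
  · intro h
    refine iInf₂_eq_top.2 fun t ht => ?_
    change Y x ω (jumpTime ω 1 + t) ∈ V at ht
    rw [Y_eq_walk] at ht
    obtain ⟨n, hn1, hn2⟩ := exists_jumpTime_le_lt hω (jumpTime ω 1 + t)
    rw [jumpCount_eq hω hn1 hn2] at ht
    have : 1 < n + 1 := (strictMono_jumpTime hω).lt_iff_lt.1 (lt_of_le_of_lt le_self_add hn2)
    obtain ⟨m, rfl⟩ := Nat.exists_eq_succ_of_ne_zero (by omega : n ≠ 0)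
    exact absurd ht (h m)

/-- The event `S` coincides almost surely with the cylinder `E ×ˢ univ`, and the holding times
integrate out to `1`. No measurability of `S` is needed. -/
theorem walkMeasure_real_eq [NeZero d] {S : Set (Sample d)} {E : Set (ℕ → Fin d × Bool)}
    (h : ∀ ω : Sample d, ω.2 ∈ goodHoldingTimes → (ω ∈ S ↔ ω.1 ∈ E)) :
    (walkMeasure d).real S = (stepMeasure d).real E := by
  have : IsProbabilityMeasure (expMeasure 1) := isProbabilityMeasure_expMeasure one_pos
  have hae : S =ᵐ[walkMeasure d] E ×ˢ Set.univ := by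
    have hgood : ∀ᵐ ω ∂(walkMeasure d), ω.2 ∈ goodHoldingTimes :=
      Measure.quasiMeasurePreserving_snd.ae ae_goodHoldingTimes
    refine Filter.eventuallyEq_set.2 ?_
    filter_upwards [hgood] with ω hω
    rw [h ω hω]
    simp
  rw [measureReal_congr hae, measureReal_def, walkMeasure, Measure.prod_prod, measure_univ,
    mul_one]
  rfl

theorem entranceProb_eq_hitProb [NeZero d] {V : Set (Fin d → R)} (x : Fin d → R) {z : Fin d → R}
    (hz : z ∈ V) : entranceProb V x z = hitProb V {z} x :=
  walkMeasure_real_eq fun _ hω => entrance_iff hz hω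

/-- The equilibrium measure becomes minus the discrete Laplacian of the hitting probability, which
allows comparison by harmonic functions. -/
theorem equilibrium_eq [NeZero d] {V : Set (Fin d → ℤ)} {x : Fin d → ℤ} (hx : x ∈ V) :
    2 * d * equilibrium V x = 2 * d - nbrSum (hitProb V V) x := by
  rw [equilibrium, if_pos hx, ← stepMeasure_real_escape]
  congr 1
  exact walkMeasure_real_eq fun _ hω => hittingTime_eq_top_iff hω

end ContinuousTime

/-! ### The quasistationary distribution as a probability vector -/

section Perron

/-- A symmetric matrix with non-negative entries has a non-negative eigenvector for its largest
eigenvalue. -/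
theorem exists_nonneg_top_eigenvector {ι : Type*} [Fintype ι] [DecidableEq ι] [Nonempty ι]
    {A : Matrix ι ι ℝ} (hA : A.IsSymm) (hA0 : ∀ i j, 0 ≤ A i j) :
    ∃ (l : ℝ) (v : ι → ℝ), v ≠ 0 ∧ A.mulVec v = l • v ∧
      (∀ (m : ℝ) (w : ι → ℝ), w ≠ 0 → A.mulVec w = m • w → m ≤ l) ∧ ∀ i, 0 ≤ v i := by
  set T : EuclideanSpace ℝ ι →L[ℝ] EuclideanSpace ℝ ι := Matrix.toEuclideanCLM (𝕜 := ℝ) A with hT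
  have hTapp : ∀ (x : EuclideanSpace ℝ ι) i, T x i = A.mulVec x.ofLp i := fun x i => by
    rw [hT, Matrix.ofLp_toEuclideanCLM]
  have hsa : IsSelfAdjoint T := by
    have : IsSelfAdjoint A := by
      rw [IsSelfAdjoint, Matrix.star_eq_conjTranspose, Matrix.conjTranspose_eq_transpose_of_trivial]
      exact hA
    exact this.map (Matrix.toEuclideanCLM (n := ι) (𝕜 := ℝ))
  have hq : ∀ x : EuclideanSpace ℝ ι, T.reApplyInnerSelf x = ∑ i, ∑ j, A i j * x j * x i := by
    intro x
    rw [ContinuousLinearMap.reApplyInnerSelf_apply, PiLp.inner_apply]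
    simp only [RCLike.re_to_real, map_sum]
    refine Finset.sum_congr rfl fun i _ => ?_
    simp [hTapp, Matrix.mulVec, dotProduct, Finset.mul_sum, mul_comm]
  obtain ⟨x, hx, hmax⟩ := (isCompact_sphere (0 : EuclideanSpace ℝ ι) 1).exists_isMaxOn
    (NormedSpace.sphere_nonempty.2 zero_le_one) T.reApplyInnerSelf_continuous.continuousOn
  -- Replacing a maximiser of the quadratic form by its entrywise absolute value does not decrease
  -- the form, since `A` has non-negative entries. The result is again a maximiser, hence an
  -- eigenvector.
  set v : EuclideanSpace ℝ ι := WithLp.toLp 2 fun i => |x i| with hv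
  have hvn : ‖v‖ = 1 := by
    rw [← mem_sphere_zero_iff_norm.1 hx, EuclideanSpace.norm_eq, EuclideanSpace.norm_eq]
    simp [hv]
  have hvmax : IsMaxOn T.reApplyInnerSelf (Metric.sphere 0 ‖v‖) v := by
    rw [hvn]
    intro y hy
    have hxy : T.reApplyInnerSelf y ≤ T.reApplyInnerSelf x := hmax hy
    refine hxy.trans ?_
    change T.reApplyInnerSelf x ≤ T.reApplyInnerSelf v
    rw [hq, hq]
    refine Finset.sum_le_sum fun i _ => Finset.sum_le_sum fun j _ => ?_
    rw [mul_assoc, mul_assoc]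
    refine mul_le_mul_of_nonneg_left ?_ (hA0 i j)
    simp only [hv]
    rw [← abs_mul]
    exact le_abs_self _
  have hv0 : v ≠ 0 := fun h => by simp [h] at hvn
  have hev := hsa.hasEigenvector_of_isMaxOn hv0 hvmax
  have hval : ∀ (m : ℝ) (y : EuclideanSpace ℝ ι), T y = m • y → ‖y‖ = 1 →
      T.reApplyInnerSelf y = m := by
    intro m y hy hy1
    rw [ContinuousLinearMap.reApplyInnerSelf_apply, hy, real_inner_smul_left,
      real_inner_self_eq_norm_sq, hy1]
    simp
  set l : ℝ := ⨆ x : { x : EuclideanSpace ℝ ι // x ≠ 0 }, T.rayleighQuotient x with hl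
  have hTv : T v = l • v := hev.apply_eq_smul
  refine ⟨l, v.ofLp, fun h => hv0 (by ext i; simpa using congrFun h i), ?_, ?_,
    fun i => abs_nonneg _⟩
  · ext i
    rw [← hTapp, hTv]
    rfl
  · intro m w hw hAw
    set y : EuclideanSpace ℝ ι := WithLp.toLp 2 w with hy
    have hy0 : y ≠ 0 := fun h => hw (by
      have := congrArg WithLp.ofLp h
      simpa [hy] using this)
    have hyn : ‖y‖ ≠ 0 := norm_ne_zero_iff.2 hy0
    have hTy : T y = m • y := by
      ext i
      rw [hTapp, hy, hAw]
      rfl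
    have hnorm : ‖‖y‖⁻¹ • y‖ = 1 := by
      rw [norm_smul, norm_inv, norm_norm, inv_mul_cancel₀ hyn]
    have h1 := hval m (‖y‖⁻¹ • y) (by rw [map_smul, hTy, smul_comm]) hnorm
    have h2 := hval l v hTv hvn
    rw [← h1, ← h2]
    exact hvmax (by rw [mem_sphere_zero_iff_norm, hnorm, hvn])

variable {d N : ℕ}

theorem adj_symm {R : Type*} [Ring R] {x y : Fin d → R} (h : Adj x y) : Adj y x := by
  obtain ⟨u, rfl⟩ := h
  exact ⟨(u.1, !u.2), by rw [add_assoc, step_add_step_not, add_zero]⟩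

/-- Existence suffices for the choice operator to satisfy the specification. Uniqueness plays no
role, since later only a probability vector off `B` is required. -/
theorem isQuasistationary_quasistationary [NeZero N] {B : Set (Fin d → ZMod N)}
    (hB : ∃ x, x ∉ B) : IsQuasistationary B (quasistationary B) := by
  classical
  obtain ⟨x₀, hx₀⟩ := hB
  have : Nonempty {x : Fin d → ZMod N // x ∉ B} := ⟨⟨x₀, hx₀⟩⟩
  have hsymm : (killedMatrix B).IsSymm := by
    ext x y
    simp only [killedMatrix, Matrix.transpose_apply, Matrix.of_apply]
    rw [if_congr ⟨adj_symm, adj_symm⟩ rfl rfl]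
  have h0 : ∀ x y, 0 ≤ killedMatrix B x y := fun x y => by
    simp only [killedMatrix, Matrix.of_apply]
    split_ifs <;> positivity
  obtain ⟨l, v, hv, hl, hmax, hv0⟩ := exists_nonneg_top_eigenvector hsymm h0
  refine Classical.epsilon_spec (p := IsQuasistationary B)
    ⟨fun x => if h : x ∉ B then v ⟨x, h⟩ / ∑ y, v y else 0, l, v, hv, ?_, ?_, hv0, ?_⟩
  · exact hl
  · exact hmax
  · intro x
    by_cases h : x ∈ B
    · simp [h]
    · simp only [h, not_false_eq_true, dite_true]

/-- The quasistationary distribution is a probability distribution on the complement of `B`. -/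
theorem quasistationary_spec [NeZero N] {B : Set (Fin d → ZMod N)} (hB : ∃ x, x ∉ B) :
    (∀ x, 0 ≤ quasistationary B x) ∧ (∀ x ∈ B, quasistationary B x = 0) ∧
      ∑ x, quasistationary B x = 1 := by
  classical
  obtain ⟨l, v, hv, -, -, hv0, hσ⟩ := isQuasistationary_quasistationary hB
  have hpos : 0 < ∑ y, v y := by
    obtain ⟨y, hy⟩ := Function.ne_iff.1 hv
    exact Finset.sum_pos' (fun y _ => hv0 y) ⟨y, Finset.mem_univ _, lt_of_le_of_ne (hv0 y) (Ne.symm hy)⟩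
  have hout : ∀ y : {x // x ∉ B}, quasistationary B y = v y / ∑ y, v y := fun y => by
    rw [hσ, dif_pos y.2]
  have hin : ∀ x ∈ B, quasistationary B x = 0 := fun x hx => by
    rw [hσ, dif_neg (by simpa using hx)]
  refine ⟨fun x => ?_, hin, ?_⟩
  · by_cases hx : x ∈ B
    · exact (hin x hx).ge
    · rw [hout ⟨x, hx⟩]
      exact div_nonneg (hv0 _) hpos.le
  · have h1 : ∑ x, quasistationary B x = ∑ y : {x // x ∉ B}, quasistationary B y := by
      rw [← Fintype.sum_subtype_add_sum_subtype (fun x => x ∉ B) (quasistationary B),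
        Finset.sum_eq_zero (s := (Finset.univ : Finset {x // ¬x ∉ B}))
          (fun y _ => hin y (not_not.1 y.2)), add_zero]
    rw [h1]
    simp only [hout]
    rw [← Finset.sum_div, div_self hpos.ne']

end Perron

/-! ### Boxes and their representatives -/

section Boxes

variable {d N : ℕ}

theorem mem_lift_image_box [NeZero N] {r : ℝ} (hr : 2 * r < N) {z : Fin d → ℤ} :
    z ∈ lift '' box d N r ↔ ∀ i, |(z i : ℝ)| ≤ r := by
  constructor
  · rintro ⟨x, hx, rfl⟩
    exact hx
  · intro h
    have hz : lift (proj N z) = z := lift_proj fun i => by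
      have h1 : 2 * |(z i : ℝ)| < N := by linarith [h i]
      exact_mod_cast h1
    exact ⟨proj N z, fun i => by rw [hz]; exact h i, hz⟩

theorem lift_injective : Function.Injective (lift : (Fin d → ZMod N) → Fin d → ℤ) :=
  fun x y h => by rw [← proj_lift x, ← proj_lift y, h]

theorem notMem_box {r : ℝ} {x : Fin d → ZMod N} :
    x ∉ box d N r ↔ ∃ i, r < |((lift x i : ℤ) : ℝ)| := by
  simp [box]

/-- A box of radius at least `1` inside the box of radius `N / 4` has radius less than
`N / 4 + 1`. -/
theorem four_mul_floor_le [NeZero d] [NeZero N] {b : ℝ} (hb : 1 ≤ b) (hN : 2 ≤ N)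
    (h : box d N b ⊆ box d N ((N : ℝ) / 4)) : 4 * ⌊b⌋₊ ≤ N := by
  have hb1 : 1 ≤ ⌊b⌋₊ := by rwa [Nat.one_le_floor_iff]
  -- The cap at `N / 2` makes `m` its own representative. The inclusion yields `4 * m ≤ N`, which
  -- excludes `m = N / 2` because `2 ≤ N`.
  set m : ℕ := min ⌊b⌋₊ (N / 2) with hm
  have hl : lift (proj N (Pi.single (0 : Fin d) (m : ℤ))) = Pi.single (0 : Fin d) (m : ℤ) := by
    refine lift_proj_of_mem_Ioc fun i => ?_
    by_cases hi : i = 0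
    · subst hi
      rw [Pi.single_eq_same]
      constructor <;> omega
    · rw [Pi.single_eq_of_ne hi]
      constructor <;> omega
  have hmb : (m : ℝ) ≤ b :=
    (Nat.cast_le.2 (min_le_left _ _)).trans (Nat.floor_le (by linarith))
  have h1 := h (show proj N (Pi.single (0 : Fin d) (m : ℤ)) ∈ box d N b from fun i => by
    rw [hl]
    by_cases hi : i = 0
    · subst hi
      simpa using hmb
    · rw [Pi.single_eq_of_ne hi]
      simp
      linarith) 0
  rw [hl, Pi.single_eq_same] at h1
  have h2 : (4 * m : ℝ) ≤ N := by
    simp at h1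
    linarith
  have h3 : 4 * m ≤ N := by exact_mod_cast h2
  omega

end Boxes

/-! ### Green's identity on the torus -/

section Green

variable {d N : ℕ} [NeZero N]

/-- The discrete Laplacian on the torus is symmetric. -/
theorem sum_mul_nbrSum_comm (f g : (Fin d → ZMod N) → ℝ) :
    ∑ x, f x * nbrSum g x = ∑ x, g x * nbrSum f x := by
  simp only [nbrSum, Finset.mul_sum]
  rw [Finset.sum_comm, Finset.sum_comm (s := Finset.univ) (t := Finset.univ)
    (f := fun x u => g x * f (x + step (ZMod N) u))]
  have hinv : ∀ u : Fin d × Bool, ∑ x, f x * g (x + step (ZMod N) u) =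
      ∑ x, g x * f (x + step (ZMod N) (u.1, !u.2)) := by
    intro u
    rw [← Equiv.sum_comp (Equiv.addRight (step (ZMod N) u))
      (fun x => g x * f (x + step (ZMod N) (u.1, !u.2)))]
    refine Finset.sum_congr rfl fun x _ => ?_
    rw [Equiv.coe_addRight, add_assoc, step_add_step_not, add_zero, mul_comm]
  rw [Finset.sum_congr rfl fun u _ => hinv u]
  exact Equiv.sum_comp ((Equiv.refl (Fin d)).prodCongr Equiv.boolNot)
    (fun u => ∑ x, g x * f (x + step (ZMod N) u))

open Classical in
/-- Green's identity for a function `f` harmonic off `A` and a function `k` that equals `1` on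
`A`, vanishes off `B` and is harmonic on `B \ A`. -/
theorem green_identity {A B : Set (Fin d → ZMod N)} {f k : (Fin d → ZMod N) → ℝ}
    (hAB : A ⊆ B) (hf : ∀ x ∉ A, HarmonicAt f x) (hkA : ∀ x ∈ A, k x = 1)
    (hkB : ∀ x ∉ B, k x = 0) (hk : ∀ x ∈ B, x ∉ A → HarmonicAt k x) :
    ∑ x, (if x ∈ A then f x * (2 * d - nbrSum k x) else 0) =
      ∑ x, if x ∈ B then 0 else f x * nbrSum k x := by
  have h0 : ∑ x, (nbrSum f x - 2 * d * f x) = 0 := by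
    have := sum_mul_nbrSum_comm (fun _ : Fin d → ZMod N => (1 : ℝ)) f
    simp only [one_mul, nbrSum_const, mul_one] at this
    rw [Finset.sum_sub_distrib, this, ← Finset.sum_sub_distrib]
    exact Finset.sum_eq_zero fun x _ => by ring
  -- The Laplacian of `f` lives on `A`, where `k = 1`, so weighting by `k` leaves its zero total
  -- unchanged.
  have h1 : ∑ x, k x * (nbrSum f x - 2 * d * f x) = 0 := by
    rw [← h0]
    refine Finset.sum_congr rfl fun x _ => ?_
    by_cases hx : x ∈ A
    · rw [hkA x hx, one_mul]
    · rw [hf x hx, sub_self, mul_zero]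
  have h2 : ∑ x, f x * (nbrSum k x - 2 * d * k x) = 0 := by
    rw [← h1]
    simp only [mul_sub, Finset.sum_sub_distrib]
    rw [sum_mul_nbrSum_comm f k]
    congr 1
    exact Finset.sum_congr rfl fun x _ => by ring
  rw [← sub_eq_zero]
  refine Eq.trans ?_ (neg_eq_zero.2 h2)
  rw [← Finset.sum_sub_distrib, ← Finset.sum_neg_distrib]
  refine Finset.sum_congr rfl fun x _ => ?_
  by_cases hA : x ∈ A
  · rw [if_pos hA, if_pos (hAB hA), hkA x hA]
    ring
  · rw [if_neg hA]
    by_cases hB : x ∈ B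
    · rw [if_pos hB, hk x hB hA]
      ring
    · rw [if_neg hB, hkB x hB]
      ring

end Green

/-! ### Escape to infinity versus escape from the larger box -/

section Comparison

variable {d N : ℕ}

/-- The hitting probability of a box decays polynomially. -/
theorem hitProb_box_le (hd : 3 ≤ d) {r ρ : ℝ} (hr : 1 ≤ r) (hρ : 0 < ρ) {V : Set (Fin d → ℤ)}
    (hV : ∀ z ∈ V, ∀ i, |(z i : ℝ)| ≤ r) {y : Fin d → ℤ} {i : Fin d} (hy : ρ ≤ |(y i : ℝ)|) :
    hitProb V V y ≤ (d + 1023) * √(r / ρ) := by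
  have : NeZero d := ⟨by omega⟩
  have hd0 : (0 : ℝ) ≤ d := by positivity
  -- `D` bounds `normSq + 1023` on `V`, so the superharmonic function divided by `D ^ (-1/4)` is at
  -- least `1` there.
  set D : ℝ := d ^ 2 * r ^ 2 + 1023 with hD
  have hD0 : 0 < D := by positivity
  have hDp : 0 < D ^ (-(1 / 4) : ℝ) := Real.rpow_pos_of_pos hD0 _
  have h1 := hitProb_le_of_superharmonic (V := V)
    (F := fun z => (D ^ (-(1 / 4) : ℝ))⁻¹ * superharmonicFn z)
    (fun z => mul_nonneg (inv_nonneg.2 hDp.le) (superharmonicFn_pos z).le)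
    (fun z hz => by
      rw [le_inv_mul_iff₀ hDp, mul_one, superharmonicFn]
      refine Real.rpow_le_rpow_of_nonpos (by have := normSq_nonneg z; linarith) ?_ (by norm_num)
      rw [hD, ← mul_pow]
      gcongr
      exact normSq_le_of_abs_le (hV z hz))
    (fun z _ => by
      rw [nbrSum_const_mul, mul_left_comm]
      exact mul_le_mul_of_nonneg_left (nbrSum_superharmonicFn_le hd z) (inv_nonneg.2 hDp.le)) y
  refine h1.trans ?_
  have hQ := normSq_nonneg y
  have hρQ : ρ ^ 2 ≤ normSq y := by
    refine le_trans ?_ (sq_le_normSq y i)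
    rw [← sq_abs (y i : ℝ)]
    gcongr
  rw [superharmonicFn, inv_mul_eq_div, ← Real.div_rpow (by linarith) hD0.le]
  refine rpow_neg_quarter_le (by positivity) (by positivity) ?_
  have hs : √(r / ρ) ^ 4 = r ^ 2 / ρ ^ 2 := by
    rw [show 4 = 2 * 2 by norm_num, pow_mul, Real.sq_sqrt (by positivity), div_pow]
  rw [mul_pow, hs]
  have h2 : D ≤ (d + 1023) ^ 2 * r ^ 2 := by
    rw [hD]
    nlinarith [mul_nonneg hd0 (sq_nonneg r), one_le_pow₀ (n := 2) hr]
  calc (1 : ℝ) ≤ (d + 1023) ^ 2 := by nlinarith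
    _ = (d + 1023) ^ 4 * (r ^ 2 / ρ ^ 2) * (ρ ^ 2 / ((d + 1023) ^ 2 * r ^ 2)) := by
        field_simp
    _ ≤ (d + 1023) ^ 4 * (r ^ 2 / ρ ^ 2) * ((normSq y + 1023) / D) := by
        gcongr
        linarith

/-- Comparison of the escape probability from the box of radius `r` to infinity with the escape
probability to the complement of the box of radius `b`. -/
theorem hitProb_comparison [NeZero d] [NeZero N] {r b δ : ℝ} (hr : 0 ≤ r) (hrb : r ≤ b)
    (hb : 2 * (⌊b⌋ + 1) < (N : ℤ))
    (hδ : ∀ x : Fin d → ZMod N, x ∉ box d N b →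
      hitProb (lift '' box d N r) (lift '' box d N r) (lift x) ≤ δ) (x : Fin d → ZMod N) :
    hitProb (box d N r ∪ (box d N b)ᶜ) (box d N r) x ≤
        hitProb (lift '' box d N r) (lift '' box d N r) (lift x) ∧
      hitProb (lift '' box d N r) (lift '' box d N r) (lift x) ≤
        hitProb (box d N r ∪ (box d N b)ᶜ) (box d N r) x +
          δ * (1 - hitProb (box d N r ∪ (box d N b)ᶜ) (box d N r) x) := by
  set A := box d N r with hA
  set B := box d N b with hB
  set k := hitProb (A ∪ Bᶜ) A with hk
  set h := fun x : Fin d → ZMod N => hitProb (lift '' A) (lift '' A) (lift x) with hh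
  have hAB : A ⊆ B := fun x hx i => (hx i).trans hrb
  have hkA : ∀ x ∈ A, k x = 1 := fun x hx => hitProb_of_mem hx
  have hhA : ∀ x ∈ A, h x = 1 := fun x hx => hitProb_of_mem ⟨x, hx, rfl⟩
  have hkB : ∀ x ∉ B, k x = 0 := fun x hx =>
    hitProb_of_mem_of_notMem (Or.inr hx) fun hxA => hx (hAB hxA)
  have hkh : ∀ x ∈ B \ A, HarmonicAt k x := fun x hx =>
    harmonicAt_hitProb (fun hx' => hx'.elim hx.2 fun h => h hx.1) hx.2
  have hhh : ∀ x ∈ B \ A, HarmonicAt h x := fun x hx => by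
    have hl : ∀ u, lift (x + step (ZMod N) u) = lift x + step ℤ u := fun u =>
      lift_add_step_of_lt u hb fun i => by
        rw [Int.le_floor]
        push_cast
        exact hx.1 i
    have hxA : lift x ∉ lift '' A := fun ⟨y, hy, hyx⟩ => hx.2 (lift_injective hyx ▸ hy)
    have := harmonicAt_hitProb hxA hxA
    unfold HarmonicAt at *
    rw [← this]
    simp only [nbrSum, hh, hl]
  have hdesc : ∀ x ∈ B \ A, ∃ u, liftNorm (x + step (ZMod N) u) < liftNorm x := fun x hx =>
    exists_step_liftNorm_lt fun h0 => hx.2 fun i => by simpa [h0] using hr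
  have hcase : ∀ x ∉ B \ A, x ∈ A ∨ x ∉ B := fun x hx => by
    by_contra! hc
    exact hx ⟨hc.2, hc.1⟩
  have hbd1 : ∀ x ∉ B \ A, 0 ≤ h x - k x := fun x hx => by
    rcases hcase x hx with hx | hx
    · rw [hkA x hx, hhA x hx, sub_self]
    · rw [hkB x hx, sub_zero]
      exact hitProb_nonneg _ _ _
  have hbd2 : ∀ x ∉ B \ A, 0 ≤ (k x + δ * (1 - k x)) - h x := fun x hx => by
    rcases hcase x hx with hx | hx
    · rw [hkA x hx, hhA x hx]
      simp
    · rw [hkB x hx]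
      have := hδ x hx
      simp only [hh]
      linarith
  -- `h` and `k` are both harmonic on `B \ A` and equal `1` on `A`; off `B`, `k` vanishes and `0 ≤ h
  -- ≤ δ`.
  have h1 := minimum_principle (Set.toFinite (B \ A)) liftNorm hdesc (F := fun x => h x - k x)
    (fun x hx => by rw [nbrSum_sub, hkh x hx, hhh x hx, mul_sub])
    (fun x _ u hu => hbd1 _ hu)
  have h2 := minimum_principle (Set.toFinite (B \ A)) liftNorm hdesc
    (F := fun x => (k x + δ * (1 - k x)) - h x)
    (fun x hx => by
      rw [nbrSum_sub, nbrSum_add, nbrSum_const_mul, nbrSum_sub, nbrSum_const, hkh x hx, hhh x hx]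
      apply le_of_eq
      ring)
    (fun x _ u hu => hbd2 _ hu)
  by_cases hx : x ∈ B \ A
  · exact ⟨sub_nonneg.1 (h1 x hx), sub_nonneg.1 (h2 x hx)⟩
  · exact ⟨sub_nonneg.1 (hbd1 x hx), sub_nonneg.1 (hbd2 x hx)⟩

end Comparison

/-! ### Equilibrium measure and capacity of a box -/

section Equilibrium

variable {d N : ℕ}

theorem equilibrium_nonneg (V : Set (Fin d → ℤ)) (z : Fin d → ℤ) : 0 ≤ equilibrium V z := by
  unfold equilibrium
  split_ifs
  exacts [measureReal_nonneg, le_rfl]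

theorem equilibrium_of_notMem {V : Set (Fin d → ℤ)} {z : Fin d → ℤ} (hz : z ∉ V) :
    equilibrium V z = 0 := if_neg hz

theorem equilibrium_le_one [NeZero d] (V : Set (Fin d → ℤ)) (z : Fin d → ℤ) :
    equilibrium V z ≤ 1 := by
  have := isProbabilityMeasure_walkMeasure (NeZero.ne d)
  unfold equilibrium
  split_ifs
  exacts [measureReal_le_one, zero_le_one]

theorem capacity_lift_image [NeZero N] (A : Set (Fin d → ZMod N)) :
    capacity (lift '' A) = ∑ x : Fin d → ZMod N, equilibrium (lift '' A) (lift x) := by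
  rw [capacity, ← (lift_injective (d := d) (N := N)).tsum_eq (f := equilibrium (lift '' A)), tsum_fintype]
  intro z hz
  by_contra h
  refine hz (equilibrium_of_notMem ?_)
  rintro ⟨x, -, hx⟩
  exact h ⟨x, hx⟩

/-- A lower bound for the equilibrium measure of a box on its inner boundary. -/
theorem half_le_equilibrium (hd : 3 ≤ d) {r : ℝ} (hr : 1 ≤ r) {V : Set (Fin d → ℤ)}
    (hV : ∀ z, z ∈ V ↔ ∀ i, |(z i : ℝ)| ≤ r) {x : Fin d → ℤ} (hx : x ∈ V) {u : Fin d × Bool}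
    (hu : x + step ℤ u ∉ V) {m : ℕ} (hm : 4 * (d + 1023) ^ 2 * r ≤ m) :
    1 / 2 ≤ (2 * d) ^ (m + 1) * equilibrium V x := by
  have : NeZero d := ⟨by omega⟩
  have hd0 : (0 : ℝ) < d := by exact_mod_cast Nat.pos_of_ne_zero (NeZero.ne d)
  have hm0 : (0 : ℝ) < m := lt_of_lt_of_le (by positivity) hm
  obtain ⟨i, b⟩ := u
  have hstep : ∀ j, j ≠ i → step ℤ (i, b) j = 0 := fun j hj => by simp [step, hj]
  have hs : step ℤ (i, b) i = 1 ∨ step ℤ (i, b) i = -1 := by cases b <;> simp [step]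
  have hi : r < |((x i + step ℤ (i, b) i : ℤ) : ℝ)| := by
    by_contra! h
    refine hu ((hV _).2 fun j => ?_)
    by_cases hj : j = i
    · rw [hj]; exact h
    · rw [Pi.add_apply, hstep j hj, add_zero]
      exact (hV x).1 hx j
  have hxi := (hV x).1 hx i
  have hgrow : ∀ j : ℕ, |x i + (j + 1) * step ℤ (i, b) i| = |x i + step ℤ (i, b) i| + j ∧
      1 ≤ |x i + step ℤ (i, b) i| := by
    have h1 : |x i| < |x i + step ℤ (i, b) i| := by
      have : (|x i| : ℝ) < |((x i + step ℤ (i, b) i : ℤ) : ℝ)| := hxi.trans_lt hi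
      exact_mod_cast this
    intro j
    rcases hs with hs | hs <;> rw [hs] at h1 ⊢ <;> constructor
    · rw [abs_of_nonneg (by
        rcases abs_cases (x i) with h | h <;> rcases abs_cases (x i + 1) with h' | h' <;> omega),
        abs_of_nonneg (by
        rcases abs_cases (x i) with h | h <;> rcases abs_cases (x i + 1) with h' | h' <;> omega)]
      ring
    · have := abs_nonneg (x i)
      omega
    · rw [abs_of_nonpos (by
        rcases abs_cases (x i) with h | h <;> rcases abs_cases (x i + -1) with h' | h' <;> omega),
        abs_of_nonpos (by
        rcases abs_cases (x i) with h | h <;> rcases abs_cases (x i + -1) with h' | h' <;> omega)]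
      ring
    · have := abs_nonneg (x i)
      omega
  -- The walk may escape along the straight ray leaving the box through `x`. Each step costs a
  -- factor `2d`, and after `m` further steps the return probability is at most `1 / 2`.
  set p : ℕ → Fin d → ℤ := fun j => x + (j + 1) • step ℤ (i, b) with hp
  have hpi : ∀ j, p j i = x i + (j + 1) * step ℤ (i, b) i := fun j => by simp [hp]
  have hpV : ∀ j, p j ∉ V := fun j hj => by
    have h1 := (hV _).1 hj i
    rw [hpi] at h1
    have h2 : (|x i + step ℤ (i, b) i| : ℤ) ≤ |x i + (j + 1) * step ℤ (i, b) i| := by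
      rw [(hgrow j).1]
      omega
    have h3 : |((x i + step ℤ (i, b) i : ℤ) : ℝ)| ≤
        |((x i + (j + 1) * step ℤ (i, b) i : ℤ) : ℝ)| := by exact_mod_cast h2
    linarith
  set g : (Fin d → ℤ) → ℝ := fun z => 1 - hitProb V V z with hg
  have hg0 : ∀ z, 0 ≤ g z := fun z => sub_nonneg.2 (hitProb_le_one V V z)
  have hgstep : ∀ j, g (p (j + 1)) ≤ 2 * d * g (p j) := fun j => by
    have hh := (harmonicAt_hitProb (hpV j) (hpV j)).const_sub 1
    have := le_of_harmonicAt hh.le (fun u => hg0 _) (i, b)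
    have e : p (j + 1) = p j + step ℤ (i, b) := by
      simp only [hp]
      rw [succ_nsmul _ (j + 1), add_assoc]
    rw [e]
    exact this
  have hgpow : ∀ j, g (p j) ≤ (2 * d) ^ j * g (p 0) := by
    intro j
    induction j with
    | zero => simp
    | succ j ih =>
      calc g (p (j + 1)) ≤ 2 * d * g (p j) := hgstep j
        _ ≤ 2 * d * ((2 * d) ^ j * g (p 0)) := by gcongr
        _ = _ := by ring
  have hp0 : g (p 0) ≤ 2 * d * equilibrium V x := by
    rw [equilibrium_eq hx]
    have h1 : (2 * d : ℝ) - nbrSum (hitProb V V) x = nbrSum g x := by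
      rw [hg, nbrSum_sub, nbrSum_const, mul_one]
    rw [h1]
    have e : p 0 = x + step ℤ (i, b) := by simp [hp]
    rw [e]
    exact Finset.single_le_sum (f := fun u => g (x + step ℤ u)) (fun u _ => hg0 _)
      (Finset.mem_univ (i, b))
  have hfar : 1 / 2 ≤ g (p m) := by
    have h1 : (m : ℝ) ≤ |(p m i : ℝ)| := by
      have : (m : ℤ) ≤ |p m i| := by
        rw [hpi, (hgrow m).1]
        have := (hgrow m).2
        omega
      exact_mod_cast this
    have h2 := hitProb_box_le hd hr hm0 (fun z hz => (hV z).1 hz) h1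
    have h3 : √(r / m) ≤ 1 / (2 * (d + 1023)) := by
      rw [Real.sqrt_le_left (by positivity), div_pow, div_le_div_iff₀ hm0 (by positivity)]
      linarith
    have h4 : (d + 1023 : ℝ) * √(r / m) ≤ 1 / 2 := by
      calc _ ≤ (d + 1023 : ℝ) * (1 / (2 * (d + 1023))) := by gcongr
        _ = 1 / 2 := by field_simp
    simp only [hg]
    linarith
  calc 1 / 2 ≤ g (p m) := hfar
    _ ≤ (2 * d) ^ m * g (p 0) := hgpow m
    _ ≤ (2 * d) ^ m * (2 * d * equilibrium V x) := by gcongr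
    _ = _ := by ring

end Equilibrium

/-! ### Entrance law versus normalized equilibrium measure -/

section EntranceLaw

variable {d N : ℕ}

open Classical in
/-- If the hitting probability of the box `A` from outside the larger box `B` is at most `δ`, and
the entrance law of `A` varies by a factor at most `1 + η` outside `B`, then started from any
distribution off `B` the entrance law of `A` is close to the normalized equilibrium measure. -/
theorem entranceLaw_bounds [NeZero d] [NeZero N] {r b δ η : ℝ} (hr : 0 ≤ r) (hrb : r ≤ b)
    (hb : 2 * (⌊b⌋ + 1) < (N : ℤ)) (hδ1 : δ < 1) (hη : 0 ≤ η)
    (hδ : ∀ x : Fin d → ZMod N, x ∉ box d N b →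
      hitProb (lift '' box d N r) (lift '' box d N r) (lift x) ≤ δ)
    {z : Fin d → ZMod N} (hz : z ∈ box d N r)
    (hosc : ∀ x y : Fin d → ZMod N, x ∉ box d N b → y ∉ box d N b →
      hitProb (box d N r) {z} x ≤ (1 + η) * hitProb (box d N r) {z} y)
    (he : 0 < equilibrium (lift '' box d N r) (lift z)) {σ : (Fin d → ZMod N) → ℝ}
    (hσ0 : ∀ x, 0 ≤ σ x) (hσB : ∀ x ∈ box d N b, σ x = 0) (hσ1 : ∑ x, σ x = 1) :
    (1 - δ) / (1 + η) ≤ entranceProbFrom σ (box d N r) z * capacity (lift '' box d N r) /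
        equilibrium (lift '' box d N r) (lift z) ∧
      entranceProbFrom σ (box d N r) z * capacity (lift '' box d N r) /
        equilibrium (lift '' box d N r) (lift z) ≤ (1 + η) / (1 - δ) := by
  have hd : (0 : ℝ) < d := by exact_mod_cast Nat.pos_of_ne_zero (NeZero.ne d)
  set A := box d N r with hA
  set B := box d N b with hB
  set f := hitProb A {z} with hf
  set k := hitProb (A ∪ Bᶜ) A with hk
  have hAB : A ⊆ B := fun x hx i => (hx i).trans hrb
  have hf0 : ∀ x, 0 ≤ f x := hitProb_nonneg _ _
  have hk0 : ∀ x, 0 ≤ k x := hitProb_nonneg _ _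
  have hfh : ∀ x ∉ A, HarmonicAt f x := fun x hx =>
    harmonicAt_hitProb hx fun h => hx (by rw [Set.mem_singleton_iff.1 h]; exact hz)
  have hkA : ∀ x ∈ A, k x = 1 := fun x hx => hitProb_of_mem hx
  have hkB : ∀ x ∉ B, k x = 0 := fun x hx =>
    hitProb_of_mem_of_notMem (Or.inr hx) fun hxA => hx (hAB hxA)
  have hkh : ∀ x ∈ B, x ∉ A → HarmonicAt k x := fun x hxB hxA =>
    harmonicAt_hitProb (fun hx' => hx'.elim hxA fun h => h hxB) hxA
  set E : (Fin d → ZMod N) → ℝ := fun x => 2 * d - nbrSum k x with hE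
  set S : ℝ := ∑ x, if x ∈ B then 0 else nbrSum k x with hS
  have hSE : ∑ x, (if x ∈ A then E x else 0) = S := by
    have := green_identity hAB (f := fun _ => 1)
      (fun x _ => by rw [HarmonicAt, nbrSum_const]) hkA hkB hkh
    simpa only [one_mul] using this
  -- On `A` the function `f` is the indicator of `z`, so the left side of Green's identity reduces
  -- to `E z`.
  have hEz : E z = ∑ x, if x ∈ B then 0 else f x * nbrSum k x := by
    rw [← green_identity hAB hfh hkA hkB hkh, Finset.sum_eq_single z]
    · rw [if_pos hz, hf, hitProb_of_mem (Set.mem_singleton z), one_mul]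
    · intro x _ hxz
      by_cases hx : x ∈ A
      · rw [if_pos hx, hf, hitProb_of_mem_of_notMem hx (by simpa using hxz), zero_mul]
      · rw [if_neg hx]
    · simp
  have hcomp : ∀ x ∈ A, 2 * d * equilibrium (lift '' A) (lift x) ≤ E x ∧
      (1 - δ) * E x ≤ 2 * d * equilibrium (lift '' A) (lift x) := by
    intro x hx
    have hl : ∀ u, lift (x + step (ZMod N) u) = lift x + step ℤ u := fun u =>
      lift_add_step_of_lt u hb fun i => by
        rw [Int.le_floor]
        push_cast
        exact hAB hx i
    have h1 : nbrSum (hitProb (lift '' A) (lift '' A)) (lift x) =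
        nbrSum (fun y => hitProb (lift '' A) (lift '' A) (lift y)) x := by
      simp only [nbrSum, hl]
    have h2 := nbrSum_mono x (F := k)
      (G := fun y => hitProb (lift '' A) (lift '' A) (lift y)) fun u =>
      (hitProb_comparison hr hrb hb hδ (x + step (ZMod N) u)).1
    have h3 := nbrSum_mono x (F := fun y => hitProb (lift '' A) (lift '' A) (lift y))
      (G := fun y => k y + δ * (1 - k y)) fun u =>
      (hitProb_comparison hr hrb hb hδ (x + step (ZMod N) u)).2
    rw [nbrSum_add, nbrSum_const_mul, nbrSum_sub, nbrSum_const] at h3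
    rw [equilibrium_eq (Set.mem_image_of_mem lift hx), h1]
    simp only [hE]
    constructor
    · exact sub_le_sub_left h2 _
    · linarith
  have hq0 : ∀ x, 0 ≤ nbrSum k x := fun x => Finset.sum_nonneg fun u _ => hk0 _
  set C := capacity (lift '' A) with hC
  have hcap : 2 * d * C = ∑ x, if x ∈ A then 2 * d * equilibrium (lift '' A) (lift x) else 0 := by
    rw [hC, capacity_lift_image, Finset.mul_sum]
    refine Finset.sum_congr rfl fun x _ => ?_
    split_ifs with hx
    · rfl
    · rw [equilibrium_of_notMem (V := lift '' A) (z := lift x) (fun ⟨y, hy, hyx⟩ => hx (lift_injective hyx ▸ hy)), mul_zero]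
  have hcap1 : 2 * d * C ≤ S := by
    rw [hcap, ← hSE]
    refine Finset.sum_le_sum fun x _ => ?_
    split_ifs with hx
    exacts [(hcomp x hx).1, le_rfl]
  have hcap2 : (1 - δ) * S ≤ 2 * d * C := by
    rw [hcap, ← hSE, Finset.mul_sum]
    refine Finset.sum_le_sum fun x _ => ?_
    split_ifs with hx
    exacts [(hcomp x hx).2, by simp]
  set P : ℝ := entranceProbFrom σ A z with hP
  have hPf : P = ∑ x, σ x * f x := by
    rw [hP, entranceProbFrom]
    exact Finset.sum_congr rfl fun x _ => by rw [entranceProb_eq_hitProb x hz]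
  have hPle : ∀ y ∉ B, P ≤ (1 + η) * f y := fun y hy => by
    have h1 : (1 + η) * f y = ∑ x, σ x * ((1 + η) * f y) := by
      rw [← Finset.sum_mul, hσ1, one_mul]
    rw [hPf, h1]
    refine Finset.sum_le_sum fun x _ => ?_
    by_cases hx : x ∈ B
    · simp [hσB x hx]
    · exact mul_le_mul_of_nonneg_left (hosc x y hx hy) (hσ0 x)
  have hleP : ∀ y ∉ B, f y ≤ (1 + η) * P := fun y hy => by
    have h1 : f y = ∑ x, σ x * f y := by rw [← Finset.sum_mul, hσ1, one_mul]
    rw [hPf, h1, Finset.mul_sum]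
    refine Finset.sum_le_sum fun x _ => ?_
    by_cases hx : x ∈ B
    · simp [hσB x hx]
    · rw [mul_left_comm]
      exact mul_le_mul_of_nonneg_left (hosc y x hy hx) (hσ0 x)
  have hP0 : 0 ≤ P := by
    rw [hPf]
    exact Finset.sum_nonneg fun x _ => mul_nonneg (hσ0 x) (hf0 x)
  -- Off `B` the values of `f` and their `σ`-mean `P` agree up to the factor `1 + η`, so `E z` is `P
  -- * S` up to the same factor.
  have hE1 : P * S ≤ (1 + η) * E z := by
    rw [hEz, hS, Finset.mul_sum, Finset.mul_sum]
    refine Finset.sum_le_sum fun x _ => ?_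
    split_ifs with hx
    · simp
    · rw [← mul_assoc]
      exact mul_le_mul_of_nonneg_right (hPle x hx) (hq0 x)
  have hE2 : E z ≤ (1 + η) * (P * S) := by
    rw [hEz, hS, Finset.mul_sum, Finset.mul_sum]
    refine Finset.sum_le_sum fun x _ => ?_
    split_ifs with hx
    · simp
    · rw [← mul_assoc]
      exact mul_le_mul_of_nonneg_right (hleP x hx) (hq0 x)
  obtain ⟨hz1, hz2⟩ := hcomp z hz
  set e := equilibrium (lift '' A) (lift z) with he'
  have hδ' : 0 < 1 - δ := by linarith
  have hη' : 0 < 1 + η := by linarith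
  have hratio : P * C / e = P * (2 * d * C) / (2 * d * e) := by
    field_simp
  have hden : 0 < 2 * d * e := by positivity
  rw [hratio]
  constructor
  · rw [div_le_div_iff₀ hη' hden]
    calc (1 - δ) * (2 * d * e) ≤ (1 - δ) * E z := by gcongr
      _ ≤ (1 - δ) * ((1 + η) * (P * S)) := by gcongr
      _ = P * ((1 - δ) * S) * (1 + η) := by ring
      _ ≤ P * (2 * d * C) * (1 + η) := by gcongr
  · rw [div_le_div_iff₀ hden hδ']
    calc P * (2 * d * C) * (1 - δ) ≤ P * S * (1 - δ) := by gcongr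
      _ ≤ (1 + η) * E z * (1 - δ) := by gcongr
      _ = (1 + η) * ((1 - δ) * E z) := by ring
      _ ≤ (1 + η) * (2 * d * e) := by gcongr

theorem entranceProbFrom_le_one [NeZero d] [NeZero N] {A : Set (Fin d → ZMod N)}
    {z : Fin d → ZMod N} (hz : z ∈ A) {σ : (Fin d → ZMod N) → ℝ} (hσ0 : ∀ x, 0 ≤ σ x)
    (hσ1 : ∑ x, σ x = 1) : 0 ≤ entranceProbFrom σ A z ∧ entranceProbFrom σ A z ≤ 1 := by
  constructor
  · refine Finset.sum_nonneg fun x _ => mul_nonneg (hσ0 x) ?_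
    rw [entranceProb_eq_hitProb x hz]
    exact hitProb_nonneg _ _ _
  · rw [entranceProbFrom, ← hσ1]
    refine Finset.sum_le_sum fun x _ => ?_
    rw [entranceProb_eq_hitProb x hz]
    exact mul_le_of_le_one_right (hσ0 x) (hitProb_le_one _ _ _)

theorem capacity_lift_image_le [NeZero d] [NeZero N] (A : Set (Fin d → ZMod N)) :
    capacity (lift '' A) ≤ (N : ℝ) ^ d := by
  rw [capacity_lift_image]
  refine (Finset.sum_le_sum fun x _ => equilibrium_le_one _ (lift x)).trans ?_
  simp [ZMod.card]

end EntranceLaw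

/-! ### From dyadic scales to polynomial decay -/

section Scales

/-- The number of dyadic scales below `q`. -/
theorem exists_scale {H q : ℝ} (hH : 1 < H) (hq : 2 ≤ q) :
    ∃ k : ℕ, (2 : ℝ) ^ (k + 1) ≤ q ∧
      (1 - 1 / H) ^ k ≤ (q / 4) ^ (-(-Real.logb 2 (1 - 1 / H))) := by
  set θ : ℝ := 1 - 1 / H with hθ
  have hH0 : 0 < H := by linarith
  have hθ0 : 0 < θ := by
    rw [hθ, sub_pos, div_lt_one hH0]
    exact hH
  have hθ1 : θ ≤ 1 := by
    have : 0 < 1 / H := by positivity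
    linarith
  have hq1 : 1 < ⌊q⌋₊ := by
    rw [← Nat.succ_le_iff, Nat.le_floor_iff (by linarith)]
    exact_mod_cast hq
  have hK : 1 ≤ Nat.log 2 ⌊q⌋₊ := Nat.log_pos (by norm_num) hq1
  obtain ⟨k, hk⟩ := Nat.exists_eq_add_of_le' hK
  refine ⟨k, ?_, ?_⟩
  · have h1 : 2 ^ (k + 1) ≤ ⌊q⌋₊ := by
      rw [← hk]
      exact Nat.pow_log_le_self 2 (by omega)
    calc (2 : ℝ) ^ (k + 1) = ((2 ^ (k + 1) : ℕ) : ℝ) := by push_cast; rfl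
      _ ≤ (⌊q⌋₊ : ℝ) := by exact_mod_cast h1
      _ ≤ q := Nat.floor_le (by linarith)
  · have h1 : ⌊q⌋₊ + 1 ≤ 2 ^ (k + 2) := by
      have := Nat.lt_pow_succ_log_self (b := 2) (by norm_num) ⌊q⌋₊
      rw [hk] at this
      exact this
    have h2 : q / 4 ≤ 2 ^ k := by
      have h3 : ((⌊q⌋₊ + 1 : ℕ) : ℝ) ≤ ((2 ^ (k + 2) : ℕ) : ℝ) := by exact_mod_cast h1
      push_cast at h3
      have h4 := Nat.lt_floor_add_one q
      rw [pow_add] at h3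
      linarith
    -- Geometric decay in the number of scales is a power of the ratio of radii, with exponent
    -- `Real.logb 2 θ`.
    have e : θ ^ k = ((2 : ℝ) ^ k) ^ (Real.logb 2 θ) := by
      rw [← Real.rpow_natCast 2 k, ← Real.rpow_mul zero_le_two, mul_comm,
        Real.rpow_mul zero_le_two, Real.rpow_logb (by norm_num) (by norm_num) hθ0,
        Real.rpow_natCast]
    rw [e, neg_neg]
    exact Real.rpow_le_rpow_of_nonpos (by linarith) h2
      ((Real.logb_nonpos_iff (by norm_num) hθ0).2 hθ1)

/-- Polynomial decay of the oscillation of the entrance law of a box outside a larger box. -/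
theorem exists_entranceLaw_oscillation (d : ℕ) (hd : 3 ≤ d) : ∃ (K : ℝ) (q₀ : ℝ) (β : ℝ),
    0 < K ∧ 0 < q₀ ∧ 0 < β ∧ ∀ (N : ℕ) [NeZero N] (r b : ℝ), 1 ≤ r → q₀ ≤ b / r →
      4 * ⌊b⌋₊ ≤ N → ∀ z ∈ box d N r, ∀ x y : Fin d → ZMod N, x ∉ box d N b → y ∉ box d N b →
        hitProb (box d N r) {z} x ≤ (1 + K * (b / r) ^ (-β)) * hitProb (box d N r) {z} y := by
  have : NeZero d := ⟨by omega⟩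
  obtain ⟨H, L, hH, hL, hosc⟩ := exists_torus_oscillation d hd
  have hL' : (1 : ℝ) ≤ L := by exact_mod_cast hL
  have hH0 : 0 < H := by linarith
  set β : ℝ := -Real.logb 2 (1 - 1 / H) with hβ
  have hβ0 : 0 < β := by
    rw [hβ, neg_pos]
    refine Real.logb_neg (by norm_num) ?_ ?_
    · rw [sub_pos, div_lt_one hH0]
      exact hH
    · have : 0 < 1 / H := by positivity
      linarith
  -- As `n ≤ 2 * r`, the ratio `b / (L * n)` is at least `(b / r) / (2 * L)`. The threshold `4 * L`
  -- makes it at least `2`, and the quarter lost in `exists_scale` turns `2 * L` into `8 * L`.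
  refine ⟨H * (8 * L : ℝ)⁻¹ ^ (-β), 4 * L, β, by positivity, by positivity, hβ0, ?_⟩
  intro N _ r b hr hq hN z hz x y hx hy
  have hr0 : 0 < r := by linarith
  have hb0 : 0 < b := by
    have : 0 < b / r := lt_of_lt_of_le (by positivity) hq
    exact (div_pos_iff_of_pos_right hr0).1 this
  set n : ℕ := ⌊r⌋₊ + 1 with hn
  have hrn : r < n := by rw [hn]; push_cast; exact Nat.lt_floor_add_one r
  have hn2 : (n : ℝ) ≤ 2 * r := by
    rw [hn]; push_cast
    have := Nat.floor_le hr0.le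
    linarith
  have hn0 : (0 : ℝ) < n := hr0.trans hrn
  have hqle : (2 * L : ℝ)⁻¹ * (b / r) ≤ b / (L * n) := by
    rw [inv_mul_eq_div, div_div, div_le_div_iff_of_pos_left hb0 (by positivity) (by positivity)]
    nlinarith
  obtain ⟨k, hk1, hk2⟩ := exists_scale hH (q := b / (L * n)) (by
    refine le_trans ?_ hqle
    rw [inv_mul_eq_div, le_div_iff₀ (by positivity)]
    linarith)
  have hscale : ((L * (2 ^ (k + 1) * n) : ℕ) : ℝ) ≤ b := by
    rw [le_div_iff₀ (by positivity)] at hk1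
    push_cast
    linarith
  have hscale' : L * (2 ^ (k + 1) * n) ≤ ⌊b⌋₊ := Nat.le_floor hscale
  have hout : ∀ w : Fin d → ZMod N, w ∉ box d N b →
      ∃ i, ((L * (2 ^ (k + 1) * n) : ℕ) : ℤ) ≤ |lift w i| := fun w hw => by
    obtain ⟨i, hi⟩ := notMem_box.1 hw
    have h1 : ((L * (2 ^ (k + 1) * n) : ℕ) : ℝ) ≤ |((lift w i : ℤ) : ℝ)| := hscale.trans hi.le
    exact ⟨i, by exact_mod_cast h1⟩
  have h1 := hosc N (hitProb (box d N r) {z}) n (by omega) (hitProb_nonneg _ _)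
    (fun w ⟨i, hi⟩ => by
      have hw : w ∉ box d N r := notMem_box.2 ⟨i, by
        have h1 : ((L * n : ℕ) : ℝ) ≤ |((lift w i : ℤ) : ℝ)| := by exact_mod_cast hi
        push_cast at h1
        nlinarith⟩
      exact harmonicAt_hitProb hw fun h => hw (by rw [Set.mem_singleton_iff.1 h]; exact hz))
    k (by omega) x y (hout x hx) (hout y hy)
  refine h1.trans (mul_le_mul_of_nonneg_right ?_ (hitProb_nonneg _ _ _))
  have h2 : (b / (L * n) / 4) ^ (-β) ≤ ((8 * L : ℝ)⁻¹ * (b / r)) ^ (-β) := by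
    refine Real.rpow_le_rpow_of_nonpos (by positivity) ?_ (by linarith)
    have : (8 * L : ℝ)⁻¹ * (b / r) = (2 * L : ℝ)⁻¹ * (b / r) / 4 := by
      rw [mul_inv, mul_inv]
      ring
    rw [this]
    linarith
  rw [Real.mul_rpow (by positivity) (by positivity)] at h2
  have h3 : H * (1 - 1 / H) ^ k ≤ H * ((8 * L : ℝ)⁻¹ ^ (-β) * (b / r) ^ (-β)) :=
    mul_le_mul_of_nonneg_left (hk2.trans h2) hH0.le
  linarith

end Scales

/-! ### Choice of constants and conclusion -/

section Main

variable {d N : ℕ}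

theorem rpow_ratio {ε : ℝ} {N : ℕ} (hN : 0 < N) {r : ℝ} (hr : 1 ≤ r)
    (hr' : r ≤ (N : ℝ) ^ (1 - ε)) : (N : ℝ) ^ (ε / 2) ≤ (N : ℝ) ^ (1 - ε / 2) / r := by
  have hN0 : (0 : ℝ) < N := by exact_mod_cast hN
  rw [le_div_iff₀ (by linarith)]
  calc (N : ℝ) ^ (ε / 2) * r ≤ (N : ℝ) ^ (ε / 2) * (N : ℝ) ^ (1 - ε) := by gcongr
    _ = (N : ℝ) ^ (1 - ε / 2) := by
      rw [← Real.rpow_add hN0]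
      ring_nf

theorem abs_sub_one_le_of_bounds {δ η ρ : ℝ} (hδ0 : 0 ≤ δ) (hδ : δ ≤ 1 / 2) (hη : 0 ≤ η)
    (h1 : (1 - δ) / (1 + η) ≤ ρ) (h2 : ρ ≤ (1 + η) / (1 - δ)) : |ρ - 1| ≤ 2 * (δ + η) := by
  rw [div_le_iff₀ (by linarith)] at h1
  rw [le_div_iff₀ (by linarith)] at h2
  have hρ0 : 0 ≤ ρ := by
    by_contra! h
    nlinarith
  rw [abs_le]
  constructor
  · by_contra! h
    nlinarith
  · by_contra! h
    nlinarith

/-- Bounds for a fixed size of the torus. -/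
theorem equilibrium_pos_and_ratio_le (hd : 3 ≤ d) [NeZero N] {r b : ℝ} (hr : 1 ≤ r) (hrb : r ≤ b)
    (hb : 4 * ⌊b⌋₊ ≤ N) {N₀ m : ℕ} (hN₀ : N ≤ N₀) (hm : 4 * (d + 1023) ^ 2 * r ≤ m)
    {z : Fin d → ZMod N} (hz : z ∈ innerBoundary (box d N r)) {σ : (Fin d → ZMod N) → ℝ}
    (hσ0 : ∀ x, 0 ≤ σ x) (hσ1 : ∑ x, σ x = 1) :
    0 < equilibrium (lift '' box d N r) (lift z) ∧
      |entranceProbFrom σ (box d N r) z * capacity (lift '' box d N r) /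
        equilibrium (lift '' box d N r) (lift z) - 1| ≤ N₀ ^ d * (2 * (2 * d) ^ (m + 1)) + 1 := by
  have : NeZero d := ⟨by omega⟩
  have hd0 : (0 : ℝ) < d := by exact_mod_cast Nat.pos_of_ne_zero (NeZero.ne d)
  have hb1 : 1 ≤ ⌊b⌋₊ := by
    rw [Nat.one_le_floor_iff]
    linarith
  have hrN : 2 * r < N := by
    have h1 := Nat.lt_floor_add_one b
    have h2 : 2 * ⌊b⌋₊ + 2 ≤ N := by omega
    have h3 : (2 * ⌊b⌋₊ + 2 : ℝ) ≤ N := by exact_mod_cast h2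
    linarith
  obtain ⟨hzA, y, ⟨u, rfl⟩, hy⟩ := hz
  have hlow := half_le_equilibrium hd hr (V := lift '' box d N r)
    (fun w => mem_lift_image_box hrN) (x := lift z) ⟨z, hzA, rfl⟩ (u := u)
    (fun ⟨w, hw, hwz⟩ => hy (by
      have := congrArg (proj N) hwz
      rw [proj_lift, proj_add_step, proj_lift] at this
      rwa [← this])) hm
  set e := equilibrium (lift '' box d N r) (lift z) with he
  have he0 : 0 < e := by
    by_contra! h
    have : (2 * d : ℝ) ^ (m + 1) * e ≤ 0 := mul_nonpos_of_nonneg_of_nonpos (by positivity) h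
    linarith
  refine ⟨he0, ?_⟩
  obtain ⟨hP0, hP1⟩ := entranceProbFrom_le_one hzA hσ0 hσ1
  have hC0 : 0 ≤ capacity (lift '' box d N r) := by
    rw [capacity_lift_image]
    exact Finset.sum_nonneg fun x _ => equilibrium_nonneg _ _
  have hC1 : capacity (lift '' box d N r) ≤ (N₀ : ℝ) ^ d :=
    (capacity_lift_image_le _).trans (by gcongr)
  have hρ0 : 0 ≤ entranceProbFrom σ (box d N r) z * capacity (lift '' box d N r) / e := by
    positivity
  have hρ1 : entranceProbFrom σ (box d N r) z * capacity (lift '' box d N r) / e ≤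
      N₀ ^ d * (2 * (2 * d) ^ (m + 1)) := by
    rw [div_le_iff₀ he0]
    calc entranceProbFrom σ (box d N r) z * capacity (lift '' box d N r)
        ≤ 1 * (N₀ : ℝ) ^ d := by gcongr
      _ = N₀ ^ d * (2 * (1 / 2)) := by ring
      _ ≤ N₀ ^ d * (2 * ((2 * d) ^ (m + 1) * e)) := by gcongr
      _ = N₀ ^ d * (2 * (2 * d) ^ (m + 1)) * e := by ring
  rw [abs_le]
  constructor <;> linarith

theorem exists_notMem_box [NeZero d] [NeZero N] {b : ℝ} (hb1 : 1 ≤ b) (hb : 4 * ⌊b⌋₊ ≤ N) :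
    ∃ x, x ∉ box d N b := by
  have hf1 : 1 ≤ ⌊b⌋₊ := by rwa [Nat.one_le_floor_iff]
  have hl : lift (proj N (Pi.single (0 : Fin d) (⌊b⌋₊ + 1 : ℤ))) =
      Pi.single (0 : Fin d) (⌊b⌋₊ + 1 : ℤ) := by
    refine lift_proj_of_mem_Ioc fun i => ?_
    by_cases hi : i = 0
    · subst hi
      rw [Pi.single_eq_same]
      constructor <;> omega
    · rw [Pi.single_eq_of_ne hi]
      constructor <;> omega
  refine ⟨proj N (Pi.single (0 : Fin d) (⌊b⌋₊ + 1 : ℤ)), notMem_box.2 ⟨0, ?_⟩⟩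
  rw [hl, Pi.single_eq_same]
  refine lt_of_lt_of_le (Nat.lt_floor_add_one b) ?_
  push_cast
  exact le_abs_self _

/-- Beyond this size `δ ≤ 1 / 2` and the oscillation estimate applies. The condition `5 ≤ N₀` gives
`2 * (⌊b⌋ + 1) < N` from `4 * ⌊b⌋ ≤ N`; it would fail for `N = 4`, `⌊b⌋ = 1`. -/
theorem exists_large_size (d : ℕ) {ε : ℝ} (hε : 0 < ε) (q₀ : ℝ) : ∃ N₀ : ℕ, 5 ≤ N₀ ∧
    ∀ N : ℕ, N₀ ≤ N → (d + 1023) * (N : ℝ) ^ (-(ε / 4)) ≤ 1 / 2 ∧ q₀ ≤ (N : ℝ) ^ (ε / 2) := by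
  have h1 : Filter.Tendsto (fun N : ℕ => (d + 1023 : ℝ) * (N : ℝ) ^ (-(ε / 4))) Filter.atTop
      (nhds ((d + 1023) * 0)) :=
    ((tendsto_rpow_neg_atTop (by positivity)).comp tendsto_natCast_atTop_atTop).const_mul _
  have h2 : Filter.Tendsto (fun N : ℕ => (N : ℝ) ^ (ε / 2)) Filter.atTop Filter.atTop :=
    (tendsto_rpow_atTop (by positivity)).comp tendsto_natCast_atTop_atTop
  rw [mul_zero] at h1
  obtain ⟨N₀, hN₀⟩ := Filter.eventually_atTop.1
    ((h1.eventually_le_const (by norm_num : (0 : ℝ) < 1 / 2)).and (h2.eventually_ge_atTop q₀))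
  exact ⟨max 5 N₀, le_max_left _ _, fun N hN => hN₀ N ((le_max_right _ _).trans hN)⟩

end Main

end TorusWalk

open TorusWalk in
theorem lemma3p9 (d : ℕ) (hd : 3 ≤ d) (ε : ℝ) (hε : 0 < ε) (hε1 : ε < 1) :
    ∃ c c' : ℝ, 0 < c ∧ 0 < c' ∧
      ∀ (N : ℕ) [NeZero N], 2 ≤ N →
        TorusWalk.box d N ((N : ℝ) ^ (1 - ε / 2)) ⊆ TorusWalk.box d N ((N : ℝ) / 4) →
        ∀ r : ℝ, 1 ≤ r → r ≤ (N : ℝ) ^ (1 - ε) →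
          ∀ x ∈ TorusWalk.innerBoundary (TorusWalk.box d N r),
            0 < TorusWalk.equilibrium (TorusWalk.lift '' TorusWalk.box d N r)
                (TorusWalk.lift x) ∧
            |TorusWalk.entranceProbFrom
                  (TorusWalk.quasistationary (TorusWalk.box d N ((N : ℝ) ^ (1 - ε / 2))))
                  (TorusWalk.box d N r) x *
                TorusWalk.capacity (TorusWalk.lift '' TorusWalk.box d N r) /
                TorusWalk.equilibrium (TorusWalk.lift '' TorusWalk.box d N r)
                  (TorusWalk.lift x) - 1| ≤ c * (N : ℝ) ^ (-c') := by
  have : NeZero d := ⟨by omega⟩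
  obtain ⟨K, q₀, β, hK, -, hβ, hosc⟩ := exists_entranceLaw_oscillation d hd
  obtain ⟨N₀, hN₀5, hN₀⟩ := exists_large_size d hε q₀
  -- One `m` serves every `N < N₀`, since then `r ≤ N₀`.
  obtain ⟨m, hm⟩ := exists_nat_ge (4 * (d + 1023 : ℝ) ^ 2 * N₀)
  -- The exponent `ε / 4` comes from `√(r / b)`, and `ε / 2 * β` from `(b / r) ^ (-β)`.
  set c' : ℝ := min (ε / 4) (ε / 2 * β) with hc'
  have hc'0 : 0 < c' := lt_min (by positivity) (by positivity)
  set C₁ : ℝ := N₀ ^ d * (2 * (2 * d) ^ (m + 1)) + 1 with hC₁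
  have hC₁0 : 0 < C₁ := by positivity
  -- The first summand serves `N ≥ N₀`. The second exceeds the crude bound `C₁` once multiplied by
  -- `N ^ (-c')` with `N < N₀`.
  refine ⟨2 * ((d + 1023) + K) + C₁ * (N₀ : ℝ) ^ c', c', by positivity, hc'0, ?_⟩
  intro N _ hN hBC r hr hrN x hx
  have hNpos : 0 < N := by omega
  have hN1 : (1 : ℝ) ≤ N := by exact_mod_cast hNpos
  have hN0 : (0 : ℝ) < N := by linarith
  set b : ℝ := (N : ℝ) ^ (1 - ε / 2) with hb
  have hb1 : 1 ≤ b := Real.one_le_rpow hN1 (by linarith)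
  have hrb : r ≤ b := hrN.trans (Real.rpow_le_rpow_of_exponent_le hN1 (by linarith))
  have hb4 := four_mul_floor_le hb1 hN hBC
  obtain ⟨hσ0, hσB, hσ1⟩ := quasistationary_spec (exists_notMem_box (d := d) hb1 hb4)
  have hNc' : 0 < (N : ℝ) ^ (-c') := Real.rpow_pos_of_pos hN0 _
  rcases lt_or_ge N N₀ with hlt | hge
  · have hrN₀ : r ≤ N₀ := by
      refine hrN.trans ((Real.rpow_le_rpow_of_exponent_le hN1 (by linarith : 1 - ε ≤ 1)).trans ?_)
      rw [Real.rpow_one]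
      exact_mod_cast hlt.le
    obtain ⟨he, hbound⟩ := equilibrium_pos_and_ratio_le hd hr hrb hb4 hlt.le (m := m)
      (le_trans (by gcongr) hm) hx hσ0 hσ1
    refine ⟨he, hbound.trans ?_⟩
    have h1 : 1 ≤ (N₀ : ℝ) ^ c' * (N : ℝ) ^ (-c') := by
      rw [Real.rpow_neg hN0.le, ← div_eq_mul_inv, one_le_div (Real.rpow_pos_of_pos hN0 _)]
      exact Real.rpow_le_rpow hN0.le (by exact_mod_cast hlt.le) hc'0.le
    calc C₁ ≤ C₁ * ((N₀ : ℝ) ^ c' * (N : ℝ) ^ (-c')) := le_mul_of_one_le_right hC₁0.le h1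
      _ = 0 + C₁ * (N₀ : ℝ) ^ c' * (N : ℝ) ^ (-c') := by ring
      _ ≤ 2 * ((d + 1023) + K) * (N : ℝ) ^ (-c') + C₁ * (N₀ : ℝ) ^ c' * (N : ℝ) ^ (-c') := by
        gcongr
        positivity
      _ = _ := by ring
  · obtain ⟨hδ, hq⟩ := hN₀ N hge
    obtain ⟨m', hm'⟩ := exists_nat_ge (4 * (d + 1023 : ℝ) ^ 2 * r)
    have he := (equilibrium_pos_and_ratio_le hd hr hrb hb4 le_rfl hm' hx hσ0 hσ1).1
    refine ⟨he, ?_⟩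
    have hr0 : 0 < r := by linarith
    have hb0 : 0 < b := by linarith
    have hratio : (N : ℝ) ^ (ε / 2) ≤ b / r := rpow_ratio hNpos hr hrN
    have hbN : 2 * (⌊b⌋ + 1) < (N : ℤ) := by
      have h1 : ((⌊b⌋₊ : ℕ) : ℤ) = ⌊b⌋ := Int.natCast_floor_eq_floor hb0.le
      have h2 : 1 ≤ ⌊b⌋₊ := by rwa [Nat.one_le_floor_iff]
      omega
    have hη0 : 0 ≤ K * (b / r) ^ (-β) := by positivity
    have hhit : ∀ y : Fin d → ZMod N, y ∉ box d N b →
        hitProb (lift '' box d N r) (lift '' box d N r) (lift y) ≤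
          (d + 1023) * (N : ℝ) ^ (-(ε / 4)) := by
      intro y hy
      obtain ⟨i, hi⟩ := notMem_box.1 hy
      refine (hitProb_box_le hd hr hb0 (V := lift '' box d N r)
        (fun w ⟨v, hv, hvw⟩ j => hvw ▸ hv j) hi.le).trans ?_
      have h1 : √(r / b) ≤ (N : ℝ) ^ (-(ε / 4)) := by
        rw [Real.sqrt_le_left (by positivity), ← Real.rpow_natCast, ← Real.rpow_mul hN0.le]
        have h2 : r / b ≤ ((N : ℝ) ^ (ε / 2))⁻¹ := by
          rw [← inv_div]
          exact inv_anti₀ (by positivity) hratio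
        refine h2.trans (le_of_eq ?_)
        rw [← Real.rpow_neg hN0.le]
        congr 1
        push_cast
        ring
      gcongr
    obtain ⟨hlow, hup⟩ := entranceLaw_bounds (by linarith) hrb hbN (by linarith) hη0 hhit hx.1
      (hosc N r b hr (hq.trans hratio) hb4 x hx.1) he hσ0 hσB hσ1
    refine (abs_sub_one_le_of_bounds (by positivity) hδ hη0 hlow hup).trans ?_
    have hη : (b / r) ^ (-β) ≤ (N : ℝ) ^ (-c') := by
      calc (b / r) ^ (-β) ≤ ((N : ℝ) ^ (ε / 2)) ^ (-β) :=
            Real.rpow_le_rpow_of_nonpos (by positivity) hratio (by linarith)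
        _ = (N : ℝ) ^ (-(ε / 2 * β)) := by
            rw [← Real.rpow_mul hN0.le]
            ring_nf
        _ ≤ _ := Real.rpow_le_rpow_of_exponent_le hN1 (neg_le_neg (min_le_right _ _))
    have hδ' : (N : ℝ) ^ (-(ε / 4)) ≤ (N : ℝ) ^ (-c') :=
      Real.rpow_le_rpow_of_exponent_le hN1 (neg_le_neg (min_le_left _ _))
    calc 2 * ((d + 1023) * (N : ℝ) ^ (-(ε / 4)) + K * (b / r) ^ (-β))
        ≤ 2 * ((d + 1023) * (N : ℝ) ^ (-c') + K * (N : ℝ) ^ (-c')) := by gcongr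
      _ = 2 * ((d + 1023) + K) * (N : ℝ) ^ (-c') + 0 := by ring
      _ ≤ 2 * ((d + 1023) + K) * (N : ℝ) ^ (-c') + C₁ * (N₀ : ℝ) ^ c' * (N : ℝ) ^ (-c') := by
        gcongr
        positivity
      _ = _ := by ring
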